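/- For $\theta\in[0,1]$ let $\mathrm{BG}(\theta)$ be the law of $B\cdot G$ with $B\sim\mathrm{Ber}(\theta)$ and $G\sim\mathcal N(0,1)$ independent. For $\mu>0$ let $h_\mu(z)=\mu\log\cosh(z/\mu)$, and for a matrix $X_0\in\mathbb R^{n\times p}$ with columns $x_1,\dots,x_p$ let $$f(q;X_0)=\frac1p\sum_{k=1}^p h_\mu(q^{\top}x_k).$$ There exist positive numerical constants $C,c_a,c_b,c_c,c_d$ such that the following holds for all integers $n,p\ge 1$, all $\theta\in(0,1/2)$ and all $\mu$ with $0<\mu<\min\{c_a\theta n^{-1},\,c_b n^{-5/4}\}$ satisfying $$p\ \ge\ \frac{C}{\mu^2\theta^2}\,n^3\log\frac{n}{\mu\theta}.$$ Let $X_0\in\mathbb R^{n\times p}$ be a random matrix with i.i.d. $\mathrm{BG}(\theta)$ entries. Then, with probability at least $$1-8n^2p^{-10}-\theta(np)^{-7}-\exp(-0.3\,\theta np)-c_c\exp\!\left(-c_d\,p\mu^2\theta^2/n^2\right),$$ the function $f(\cdot;X_0)$ has exactly $2n$ local minimizers over the unit sphere $\mathbb S^{n-1}=\{q\in\mathbb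 R^n:\|q\|_2=1\}$, and there is a bijection between these local minimizers and the signed standard basis vectors $\{\pm e_1,\dots,\pm e_n\}$ such that every local minimizer $q_\star$ and its corresponding signed basis vector $b$ satisfy $$\|q_\star-b\|_2\ \le\ \sqrt2\,\min\left\{\frac{c_c\,\mu}{\theta}\sqrt{\frac{n\log p}{p}},\ \frac{\mu}{16}\right\}.$$ -/

import Mathlib

open MeasureTheory ProbabilityTheory

namespace DictLearning

noncomputable section

/-- The Bernoulli-Gaussian law `BG(θ)` on `ℝ`: the law of `B * G` with `B ∼ Ber(θ)` (values `1` and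
`0`) and `G ∼ N(0, 1)` independent. -/
def bernoulliGaussian (θ : unitInterval) : Measure ℝ :=
  ((bernoulliMeasure (1 : ℝ) 0 θ).prod (gaussianReal 0 1)).map (fun z : ℝ × ℝ => z.1 * z.2)

/-- The random `n × p` matrix `X` has i.i.d. entries with law `BG(θ)`. -/
structure IsIIDBernoulliGaussian {Ω : Type*} [MeasurableSpace Ω] {n p : ℕ}
    (X : Ω → Matrix (Fin n) (Fin p) ℝ) (θ : unitInterval) (P : Measure Ω) : Prop where
  hasLaw : ∀ i k, HasLaw (fun ω => X ω i k) (bernoulliGaussian θ) P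
  indep : iIndepFun (fun (e : Fin n × Fin p) (ω : Ω) => X ω e.1 e.2) P

/-- The smooth surrogate `h_μ(z) = μ log cosh (z / μ)` of the absolute value. -/
def smoothAbs (μ z : ℝ) : ℝ := μ * Real.log (Real.cosh (z / μ))

/-- The objective `f(q; Y) = (1 / p) ∑ₖ h_μ(q* yₖ)`, where `yₖ` is the `k`-th column of `Y`. -/
def objective {n p : ℕ} (μ : ℝ) (Y : Matrix (Fin n) (Fin p) ℝ) (q : EuclideanSpace ℝ (Fin n)) : ℝ :=
  (1 / (p : ℝ)) * ∑ k : Fin p, smoothAbs μ (∑ i : Fin n, q i * Y i k)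

/-- The local minimizers of `f(·; Y)` over the unit sphere of `ℝⁿ`. -/
def sphereLocalMinimizers {n p : ℕ} (μ : ℝ) (Y : Matrix (Fin n) (Fin p) ℝ) :
    Set (EuclideanSpace ℝ (Fin n)) :=
  {q | q ∈ Metric.sphere (0 : EuclideanSpace ℝ (Fin n)) 1 ∧
    IsLocalMinOn (objective μ Y) (Metric.sphere (0 : EuclideanSpace ℝ (Fin n)) 1) q}

/-- The signed standard basis vectors `± eᵢ` of `ℝⁿ`. -/
def signedBasis (n : ℕ) : Set (EuclideanSpace ℝ (Fin n)) :=
  {b | ∃ i : Fin n, b = EuclideanSpace.single i (1 : ℝ) ∨ b = -EuclideanSpace.single i (1 : ℝ)}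

end

end DictLearning

namespace DictLearning

/-! ### Fourier representation of the squared hyperbolic secant -/

/-! The expected objective is tractable because sech² is a mixture of cosines with a positive
density (`sechSq_eq_integral`), and hence tanh is a mixture of sines (`tanh_eq_integral`). Since
h_μ' = tanh(·/μ) and μ h_μ'' = sech²(·/μ), the expected gradient and Hessian become integrals over a
single frequency of products of one-coordinate characteristic functions (`popGrad_eq`,
`popHess_self_eq`, `popHess_eq`).

The sphere is explored by rotations in coordinate planes. In the plane of coordinates i and j the
expected derivative is q_i q_j times a quantity of order at least θ(q_i² - q_j²)
(`le_popGrad_rotation`), so descent shrinks the smaller coordinate. This degenerates when the two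
coordinates are comparable, but then the expected second derivative is at most a negative multiple
of θ q_i⁴ (`popHess_rotation_le`). Near ±e_i the expected Hessian is at least of order θ/μ on
directions almost orthogonal to e_i (`popHess_quadratic_ge`).

Randomness enters only through `IsRegular`: the empirical gradient and μ-scaled Hessian are within
`devConst * μ * θ / n` of their means, uniformly on the cube, and the off-axis gradient at basis
vectors is at most τ. `measure_not_isRegular_le` proves this by Bernstein's inequality on a grid
together with a tail bound for one variable that dominates the oscillation in every cell. The sample
size absorbs the cardinality of the grid (`covering_mul_exp_le`).

The rest is deterministic. At a local minimizer the second order condition forbids a coordinate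
comparable to the largest one, and the first order condition then forces all the others below
`capConst * μ / n` (`IsRegular.exists_inCap`). In each half cap the gradient is strongly monotone
with constant θ/(16μ), which beats the multiplier terms of order n because 128nμ < θ. So there is at
most one critical point (`IsRegular.eq_of_inCap`), and a minimizer over the closed half cap cannot
lie on its boundary (`IsRegular.exists_mem_sphereLocalMinimizers`). Comparing it with ±e_i by the
same monotonicity gives a distance of order (μ/θ)√n τ, with τ of order √(log p / p). -/

/-- The squared hyperbolic secant, the derivative of `tanh`. -/
noncomputable def sechSq (z : ℝ) : ℝ := 1 / Real.cosh z ^ 2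

lemma sechSq_pos (z : ℝ) : 0 < sechSq z := by
  have := Real.cosh_pos z
  unfold sechSq; positivity

lemma sechSq_le_one (z : ℝ) : sechSq z ≤ 1 := by
  have := Real.one_le_cosh z
  unfold sechSq
  rw [div_le_one (by positivity)]
  nlinarith

lemma continuous_sechSq : Continuous sechSq := by
  unfold sechSq
  exact continuous_const.div (Real.continuous_cosh.pow 2)
    (fun z => (pow_pos (Real.cosh_pos z) 2).ne')

lemma hasDerivAt_tanh (z : ℝ) : HasDerivAt Real.tanh (sechSq z) z := by
  have h := (Real.hasDerivAt_sinh z).div (Real.hasDerivAt_cosh z) (Real.cosh_pos z).ne'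
  have e : Real.tanh = fun y => Real.sinh y / Real.cosh y := by
    ext y; exact Real.tanh_eq_sinh_div_cosh y
  rw [e]
  refine h.congr_deriv ?_
  unfold sechSq
  congr 1
  have := Real.cosh_sq_sub_sinh_sq z
  nlinarith

lemma continuous_tanh : Continuous Real.tanh :=
  continuous_iff_continuousAt.2 fun z => (hasDerivAt_tanh z).continuousAt

/-- The density whose cosine transform is `sechSq`. -/
noncomputable def sechDensity (ω : ℝ) : ℝ :=
  1 / Real.pi * ‖Complex.Gamma (1 + (ω / 2 : ℝ) * Complex.I)‖ ^ 2

lemma one_add_mul_I_re (y : ℝ) : ((1 : ℂ) + (y : ℂ) * Complex.I).re = 1 := by simp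

lemma sechDensity_pos (ω : ℝ) : 0 < sechDensity ω := by
  have h : Complex.Gamma (1 + (ω / 2 : ℝ) * Complex.I) ≠ 0 :=
    Complex.Gamma_ne_zero_of_re_pos (by rw [one_add_mul_I_re]; norm_num)
  have := Real.pi_pos
  have := norm_pos_iff.2 h
  unfold sechDensity; positivity

lemma continuous_sechDensity : Continuous sechDensity := by
  unfold sechDensity
  refine continuous_const.mul (Continuous.pow (Continuous.norm ?_) 2)
  refine continuous_iff_continuousAt.2 fun ω => ?_
  have h1 : ContinuousAt Complex.Gamma (1 + (ω / 2 : ℝ) * Complex.I) := by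
    refine Complex.continuousAt_Gamma _ fun m h => ?_
    have := congrArg Complex.re h
    rw [one_add_mul_I_re] at this
    simp at this
    have : (0 : ℝ) ≤ m := Nat.cast_nonneg m
    linarith
  exact ContinuousAt.comp (f := fun ω : ℝ => (1 : ℂ) + (ω / 2 : ℝ) * Complex.I) h1
    (by fun_prop)

lemma normSq_Gamma_one_add_mul_I (y : ℝ) :
    ((‖Complex.Gamma (1 + (y : ℂ) * Complex.I)‖ ^ 2 : ℝ) : ℂ) =
      Complex.Gamma (1 + (y : ℂ) * Complex.I) * Complex.Gamma (1 - (y : ℂ) * Complex.I) := by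
  rw [← Complex.normSq_eq_norm_sq, ← Complex.mul_conj, ← Complex.Gamma_conj]
  congr 2
  simp [sub_eq_add_neg]

/-- Euler's reflection formula at iy, after Γ(1 + iy) = iy Γ(iy). -/
lemma norm_Gamma_one_add_mul_I_sq (y : ℝ) (hy : y ≠ 0) :
    ‖Complex.Gamma (1 + (y : ℂ) * Complex.I)‖ ^ 2 = Real.pi * y / Real.sinh (Real.pi * y) := by
  have h := normSq_Gamma_one_add_mul_I y
  have hyI : (y : ℂ) * Complex.I ≠ 0 := by simp [hy]
  rw [add_comm, Complex.Gamma_add_one _ hyI, mul_assoc (_ * _) (Complex.Gamma _),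
    Complex.Gamma_mul_Gamma_one_sub, ← mul_assoc, Complex.sin_mul_I] at h
  rw [add_comm]
  have hs : Real.sinh (Real.pi * y) ≠ 0 := by
    simp [Real.sinh_eq_zero, hy, Real.pi_ne_zero]
  have hs' : Complex.sinh (Real.pi * y) ≠ 0 := by
    intro h0; apply hs; exact_mod_cast h0
  apply Complex.ofReal_injective
  rw [Complex.Gamma_add_one _ hyI, h]
  push_cast
  field_simp

/-- In sinh x = 2 sinh(x/2) cosh(x/2) the first factor supplies x, which cancels the numerator πy of
|Γ(1 + iy)|², and the second supplies the exponential. -/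
lemma self_mul_exp_le_sinh {x : ℝ} (hx : 0 ≤ x) : x * Real.exp (x / 2) / 2 ≤ Real.sinh x := by
  have h1 : Real.sinh x = 2 * Real.sinh (x / 2) * Real.cosh (x / 2) := by
    rw [← Real.sinh_two_mul]; congr 1; ring
  have h2 : x / 2 ≤ Real.sinh (x / 2) := Real.self_le_sinh_iff.2 (by linarith)
  have h3 : Real.exp (x / 2) / 2 ≤ Real.cosh (x / 2) := by
    rw [Real.cosh_eq]; have := Real.exp_pos (-(x / 2)); linarith
  rw [h1]
  have := Real.exp_pos (x / 2)
  calc x * Real.exp (x / 2) / 2 = 2 * (x / 2) * (Real.exp (x / 2) / 2) := by ring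
    _ ≤ _ := by gcongr

lemma norm_Gamma_one_add_mul_I_sq_le (y : ℝ) :
    ‖Complex.Gamma (1 + (y : ℂ) * Complex.I)‖ ^ 2 ≤ 2 * Real.exp (-(Real.pi * |y| / 2)) := by
  rcases eq_or_ne y 0 with rfl | hy
  · simp
  have h : Real.pi * y / Real.sinh (Real.pi * y) =
      Real.pi * |y| / Real.sinh (Real.pi * |y|) := by
    rcases abs_choice y with h | h <;> rw [h]
    rw [mul_neg, Real.sinh_neg, neg_div_neg_eq]
  rw [norm_Gamma_one_add_mul_I_sq y hy, h]
  have hx : 0 < Real.pi * |y| := by have := Real.pi_pos; have := abs_pos.2 hy; positivity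
  have := self_mul_exp_le_sinh hx.le
  have hs : 0 < Real.sinh (Real.pi * |y|) := Real.sinh_pos_iff.2 hx
  rw [div_le_iff₀ hs, Real.exp_neg]
  have he := Real.exp_pos (Real.pi * |y| / 2)
  rw [← div_eq_mul_inv, div_mul_eq_mul_div, le_div_iff₀ he]
  linarith

/-- Exponential decay beats ω⁴ through exp x ≥ x⁴/24. The weight 1 + ω² on the left is what makes
the second moment finite, as the Hessian formulas require. -/
lemma sechDensity_le (ω : ℝ) : sechDensity ω * (1 + ω ^ 2) ≤ 10000 * (1 + ω ^ 2)⁻¹ := by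
  set x := Real.pi * |ω / 2| / 2 with hx
  have hpi := Real.pi_gt_three
  have hG := norm_Gamma_one_add_mul_I_sq_le (ω / 2)
  rw [← hx] at hG
  have hxω : |ω| / 2 ≤ x := by
    rw [hx, abs_div, abs_two]; nlinarith [abs_nonneg ω]
  have h4 : x ^ 4 / 24 ≤ Real.exp x := by
    have := Real.pow_div_factorial_le_exp (x := x) (by linarith [abs_nonneg ω]) 4
    simpa [Nat.factorial] using this
  have h1 : 1 ≤ Real.exp x := Real.one_le_exp (by linarith [abs_nonneg ω])
  have h5 : ω ^ 4 / 16 ≤ x ^ 4 := by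
    have : (|ω| / 2) ^ 4 ≤ x ^ 4 := by gcongr
    have e : (|ω| / 2) ^ 4 = ω ^ 4 / 16 := by
      rw [div_pow, (by norm_num : (4 : ℕ) = 2 * 2), pow_mul, sq_abs]; ring
    linarith
  have hd : sechDensity ω ≤ 2 * Real.exp (-x) := by
    unfold sechDensity
    have : 1 / Real.pi ≤ 1 := by rw [div_le_one (by linarith)]; linarith
    have h0 := sq_nonneg ‖Complex.Gamma (1 + (ω / 2 : ℝ) * Complex.I)‖
    calc _ ≤ 1 * ‖Complex.Gamma (1 + (ω / 2 : ℝ) * Complex.I)‖ ^ 2 := by gcongr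
      _ ≤ _ := by rw [one_mul]; exact hG
  rw [← div_eq_mul_inv, le_div_iff₀ (by positivity)]
  have he : Real.exp (-x) * Real.exp x = 1 := by rw [← Real.exp_add]; simp
  have hen := Real.exp_pos (-x)
  calc sechDensity ω * (1 + ω ^ 2) * (1 + ω ^ 2)
      = sechDensity ω * (1 + ω ^ 2) ^ 2 := by ring
    _ ≤ (2 * Real.exp (-x)) * (2 * (1 + ω ^ 4)) := by
        gcongr
        nlinarith [sq_nonneg (ω ^ 2 - 1)]
    _ ≤ (2 * Real.exp (-x)) * (2 * (400 * Real.exp x)) := by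
        gcongr
        nlinarith
    _ = 1600 * (Real.exp (-x) * Real.exp x) := by ring
    _ ≤ 10000 := by rw [he]; norm_num

lemma integrable_sechDensity_mul :
    Integrable fun ω : ℝ => sechDensity ω * (1 + ω ^ 2) := by
  refine (integrable_inv_one_add_sq.const_mul 10000).mono'
    ((continuous_sechDensity.mul (by fun_prop)).aestronglyMeasurable) ?_
  filter_upwards with ω
  rw [Real.norm_of_nonneg (mul_nonneg (sechDensity_pos ω).le (by positivity))]
  exact sechDensity_le ω

lemma integrable_sechDensity : Integrable sechDensity := by
  refine integrable_sechDensity_mul.mono' continuous_sechDensity.aestronglyMeasurable ?_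
  filter_upwards with ω
  rw [Real.norm_of_nonneg (sechDensity_pos ω).le]
  nlinarith [sechDensity_pos ω, mul_nonneg (sechDensity_pos ω).le (sq_nonneg ω)]

lemma half_one_add_tanh (z : ℝ) : (1 + Real.tanh z) / 2 = Real.exp z / (2 * Real.cosh z) := by
  have := (Real.cosh_pos z).ne'
  rw [Real.tanh_eq_sinh_div_cosh, ← Real.cosh_add_sinh]
  field_simp

lemma half_one_sub_tanh (z : ℝ) :
    1 - (1 + Real.tanh z) / 2 = Real.exp (-z) / (2 * Real.cosh z) := by
  have := (Real.cosh_pos z).ne'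
  rw [Real.tanh_eq_sinh_div_cosh, ← Real.cosh_sub_sinh]
  field_simp
  ring

/-- The substitution x = (1 + tanh z)/2 carries the line onto (0, 1) with Jacobian sech²/2, and
turns the Fourier integral of sech² into a Beta integral. -/
lemma hasDerivAt_half_one_add_tanh (z : ℝ) :
    HasDerivAt (fun z => (1 + Real.tanh z) / 2) (sechSq z / 2) z :=
  ((hasDerivAt_tanh z).const_add 1).div_const 2

lemma injective_half_one_add_tanh : Function.Injective fun z => (1 + Real.tanh z) / 2 := by
  intro a b h
  apply Real.tanh_injective
  simp only at h
  linarith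

lemma range_half_one_add_tanh : Set.range (fun z => (1 + Real.tanh z) / 2) = Set.Ioo 0 1 := by
  ext x
  constructor
  · rintro ⟨z, rfl⟩
    have h1 := Real.tanh_lt_one z
    have h2 := Real.neg_one_lt_tanh z
    constructor <;> simp only <;> linarith
  · rintro ⟨h0, h1⟩
    refine ⟨Real.artanh (2 * x - 1), ?_⟩
    simp only
    rw [Real.tanh_artanh ⟨by linarith, by linarith⟩]
    ring

lemma integrable_sechSq : Integrable sechSq := by
  have h := (integrableOn_image_iff_integrableOn_abs_deriv_smul (s := Set.univ)
    MeasurableSet.univ (fun z _ => (hasDerivAt_half_one_add_tanh z).hasDerivWithinAt)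
    injective_half_one_add_tanh.injOn (fun _ => (1 : ℝ))).1 (by
      rw [Set.image_univ, range_half_one_add_tanh]
      exact integrableOn_const (by simp) )
  rw [integrableOn_univ] at h
  refine (h.const_mul 2).congr ?_
  filter_upwards with z
  rw [abs_of_pos (half_pos (sechSq_pos z)), smul_eq_mul]
  ring

/-- With x = (1 + tanh z)/2 one has x/(1 - x) = exp(2z), so x^(iω/2) (1 - x)^(-iω/2) = exp(iωz). The
integral is then 2B(1 + iω/2, 1 - iω/2), and the two arguments sum to 2, where Γ = 1. -/
lemma integral_sechSq_mul_cexp (ω : ℝ) :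
    ∫ z : ℝ, (sechSq z : ℂ) * Complex.exp (ω * z * Complex.I) =
      2 * Real.pi * sechDensity ω := by
  have h := integral_image_eq_integral_abs_deriv_smul (s := Set.univ)
    MeasurableSet.univ (fun z _ => (hasDerivAt_half_one_add_tanh z).hasDerivWithinAt)
    injective_half_one_add_tanh.injOn
    (fun x : ℝ => (x : ℂ) ^ ((ω / 2 : ℝ) * Complex.I) *
      (1 - (x : ℂ)) ^ (-((ω / 2 : ℝ) * Complex.I)))
  rw [Set.image_univ, range_half_one_add_tanh, ← integral_Ioc_eq_integral_Ioo,
    ← intervalIntegral.integral_of_le zero_le_one, Measure.restrict_univ] at h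
  have hb := Complex.betaIntegral_eq_Gamma_mul_div (1 + (ω / 2 : ℝ) * Complex.I)
    (1 - (ω / 2 : ℝ) * Complex.I) (by rw [one_add_mul_I_re]; norm_num) (by simp)
  rw [← normSq_Gamma_one_add_mul_I] at hb
  have e2 : (1 : ℂ) + (ω / 2 : ℝ) * Complex.I + (1 - (ω / 2 : ℝ) * Complex.I) = 1 + 1 := by ring
  rw [e2, Complex.Gamma_add_one _ one_ne_zero, Complex.Gamma_one] at hb
  unfold Complex.betaIntegral at hb
  rw [show (1 : ℂ) + (ω / 2 : ℝ) * Complex.I - 1 = (ω / 2 : ℝ) * Complex.I by ring,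
    show (1 : ℂ) - (ω / 2 : ℝ) * Complex.I - 1 = -((ω / 2 : ℝ) * Complex.I) by ring, h] at hb
  have hpt : ∀ z : ℝ, |sechSq z / 2| • (((((1 + Real.tanh z) / 2 : ℝ) : ℂ)) ^
      ((ω / 2 : ℝ) * Complex.I) * (1 - (((1 + Real.tanh z) / 2 : ℝ) : ℂ)) ^
        (-((ω / 2 : ℝ) * Complex.I))) =
      (1 / 2 : ℂ) * ((sechSq z : ℂ) * Complex.exp (ω * z * Complex.I)) := by
    intro z
    have hc := Real.cosh_pos z
    have hx : (0 : ℝ) < (1 + Real.tanh z) / 2 := by rw [half_one_add_tanh]; positivity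
    have hx' : (0 : ℝ) < 1 - (1 + Real.tanh z) / 2 := by rw [half_one_sub_tanh]; positivity
    have e3 : (1 : ℂ) - (((1 + Real.tanh z) / 2 : ℝ) : ℂ) =
        ((1 - (1 + Real.tanh z) / 2 : ℝ) : ℂ) := by push_cast; ring
    rw [e3, Complex.cpow_def_of_ne_zero (by exact_mod_cast hx.ne'),
      Complex.cpow_def_of_ne_zero (by exact_mod_cast hx'.ne'), ← Complex.ofReal_log hx.le,
      ← Complex.ofReal_log hx'.le, ← Complex.exp_add, abs_of_pos (half_pos (sechSq_pos z)),
      half_one_sub_tanh, half_one_add_tanh, Real.log_div (Real.exp_ne_zero _) (by positivity),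
      Real.log_div (Real.exp_ne_zero _) (by positivity), Real.log_exp, Real.log_exp,
      Complex.real_smul]
    push_cast
    rw [show ∀ L : ℂ, ((z : ℂ) - L) * (ω / 2 * Complex.I) + (-z - L) * -(ω / 2 * Complex.I)
      = ω * z * Complex.I from fun L => by ring]
    ring
  simp_rw [hpt] at hb
  rw [integral_const_mul] at hb
  have hpi : (Real.pi : ℂ) ≠ 0 := by exact_mod_cast Real.pi_ne_zero
  unfold sechDensity
  push_cast at hb ⊢
  rw [show (2 : ℂ) * Real.pi * (1 / Real.pi * ‖Complex.Gamma (1 + ω / 2 * Complex.I)‖ ^ 2) =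
    2 * ‖Complex.Gamma (1 + ω / 2 * Complex.I)‖ ^ 2 * (Real.pi / Real.pi) by ring, div_self hpi]
  linear_combination 2 * hb

open FourierTransform in
/-- `sechSq` is the cosine transform of `sechDensity`. -/
lemma sechSq_eq_integral (z : ℝ) : sechSq z = ∫ ω, sechDensity ω * Real.cos (ω * z) := by
  have hpi := Real.pi_pos
  -- The Fourier kernel is exp(-2πi vξ), so the frequency ω of the cosine transform is -2πξ.
  have hF : 𝓕 (fun z => (sechSq z : ℂ)) =
      fun ξ => ((2 * Real.pi * sechDensity (-2 * Real.pi * ξ) : ℝ) : ℂ) := by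
    ext ξ
    rw [Real.fourier_real_eq_integral_exp_smul]
    have := integral_sechSq_mul_cexp (-2 * Real.pi * ξ)
    push_cast at this ⊢
    rw [← this]
    congr 1
    ext v
    rw [smul_eq_mul, mul_comm]
    congr 2
    ring
  have hc : Continuous (fun z => (sechSq z : ℂ)) :=
    Complex.continuous_ofReal.comp continuous_sechSq
  have hFi : Integrable (𝓕 (fun z => (sechSq z : ℂ))) := by
    rw [hF]
    exact ((integrable_sechDensity.comp_mul_left' (by simp [hpi.ne'])).const_mul _).ofReal
  have h := congrFun (hc.fourierInv_fourier_eq integrable_sechSq.ofReal hFi) z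
  rw [Real.fourierInv_eq', hF] at h
  set G : ℝ → ℂ := fun v => Complex.exp ((2 * Real.pi * inner ℝ v z : ℝ) * Complex.I) •
    ((2 * Real.pi * sechDensity (-2 * Real.pi * v) : ℝ) : ℂ) with hG
  have hGc : Continuous G := by
    have := continuous_sechDensity
    rw [hG]; fun_prop
  have hGi : Integrable G := by
    rw [hF] at hFi
    refine Integrable.mono' (g := fun ξ => 2 * Real.pi * sechDensity (-2 * Real.pi * ξ))
      ((integrable_sechDensity.comp_mul_left' (by simp [hpi.ne'])).const_mul _)
      hGc.aestronglyMeasurable ?_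
    filter_upwards with v
    have := sechDensity_pos (-2 * Real.pi * v)
    rw [hG]
    simp only [norm_smul, Complex.norm_exp_ofReal_mul_I, one_mul, Complex.norm_real]
    rw [Real.norm_of_nonneg (by positivity)]
  have hre := Complex.reCLM.integral_comp_comm hGi
  rw [h] at hre
  simp only [Complex.reCLM_apply, Complex.ofReal_re] at hre
  rw [← hre]
  have hGre : ∀ v, (G v).re =
      2 * Real.pi * (sechDensity (-2 * Real.pi * v) * Real.cos ((-2 * Real.pi * v) * z)) := by
    intro v
    simp only [hG, smul_eq_mul, Complex.re_mul_ofReal, Complex.exp_ofReal_mul_I_re]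
    rw [← Real.cos_neg (2 * Real.pi * inner ℝ v z)]
    simp only [RCLike.inner_apply, conj_trivial]
    rw [show -(2 * Real.pi * (z * v)) = -2 * Real.pi * v * z by ring]
    ring
  simp_rw [hGre]
  rw [integral_const_mul,
    Measure.integral_comp_mul_left (fun ω => sechDensity ω * Real.cos (ω * z)) (-2 * Real.pi),
    smul_eq_mul, abs_inv, abs_mul, abs_neg, abs_two, abs_of_pos hpi, ← mul_assoc,
    mul_inv_cancel₀ (by positivity), one_mul]

/-- `tanh` is the sine transform of `ω ↦ sechDensity ω / ω`. -/
lemma tanh_eq_integral (z : ℝ) :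
    Real.tanh z = ∫ ω, sechDensity ω * (Real.sin (ω * z) / ω) := by
  have h1 : Real.tanh z = ∫ t in (0 : ℝ)..z, sechSq t := by
    rw [intervalIntegral.integral_eq_sub_of_hasDerivAt (fun t _ => hasDerivAt_tanh t)
      (continuous_sechSq.intervalIntegrable _ _)]
    simp
  simp_rw [h1, sechSq_eq_integral]
  have hswap := intervalIntegral_integral_swap (a := 0) (b := z) (μ := volume)
    (f := fun t ω => sechDensity ω * Real.cos (ω * t)) ?_
  · rw [hswap]
    refine integral_congr_ae ?_
    -- At ω = 0 the quotient sin(ωz)/ω takes the default value 0 instead of z; a single point is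
    -- negligible.
    filter_upwards [compl_mem_ae_iff.2 (measure_singleton (0 : ℝ))] with ω hω
    have hω' : ω ≠ 0 := hω
    rw [intervalIntegral.integral_const_mul]
    congr 1
    rw [intervalIntegral.integral_comp_mul_left (fun x => Real.cos x) hω', integral_cos]
    simp
    field_simp
  · have : IsFiniteMeasure (volume.restrict (Set.uIoc 0 z)) := ⟨by simp [Set.uIoc]⟩
    have hb := Integrable.mul_prod (f := fun _ : ℝ => (1 : ℝ)) (g := sechDensity)
      (μ := volume.restrict (Set.uIoc 0 z)) (ν := volume) (integrable_const 1)
      integrable_sechDensity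
    refine hb.mono' (Continuous.aestronglyMeasurable ?_) ?_
    · have := continuous_sechDensity
      simp only [Function.uncurry_def]
      fun_prop
    · filter_upwards with x
      simp only [Function.uncurry_def, norm_mul, one_mul]
      rw [Real.norm_of_nonneg (sechDensity_pos _).le]
      exact mul_le_of_le_one_right (sechDensity_pos _).le (Real.abs_cos_le_one _)

lemma integral_sechDensity : ∫ ω, sechDensity ω = 1 := by
  have := sechSq_eq_integral 0
  simpa [sechSq] using this.symm

/-! ### The Bernoulli-Gaussian law -/

lemma bernoulliGaussian_eq (θ : unitInterval) :
    bernoulliGaussian θ = unitInterval.toNNReal θ • gaussianReal 0 1 +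
      unitInterval.toNNReal (unitInterval.symm θ) • Measure.dirac (0 : ℝ) := by
  unfold bernoulliGaussian
  rw [bernoulliMeasure_def, Measure.add_prod, Measure.map_add _ _ (by fun_prop),
    Measure.prod_smul_left, Measure.prod_smul_left, Measure.dirac_prod, Measure.dirac_prod,
    Measure.map_smul, Measure.map_smul, Measure.map_map (by fun_prop) (by fun_prop),
    Measure.map_map (by fun_prop) (by fun_prop)]
  congr 2
  · simp [Function.comp_def]
  · simp [Function.comp_def]

instance (θ : unitInterval) : IsProbabilityMeasure (bernoulliGaussian θ) := by
  unfold bernoulliGaussian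
  exact Measure.isProbabilityMeasure_map (by fun_prop)

lemma integrable_bernoulliGaussian {E : Type*} [NormedAddCommGroup E] (θ : unitInterval)
    {F : ℝ → E} (hF : Integrable F (gaussianReal 0 1)) : Integrable F (bernoulliGaussian θ) := by
  rw [bernoulliGaussian_eq]
  refine Integrable.add_measure (hF.smul_measure_nnreal) ?_
  exact (integrable_dirac (by simp)).smul_measure_nnreal

lemma integral_bernoulliGaussian {E : Type*} [NormedAddCommGroup E] [NormedSpace ℝ E]
    [CompleteSpace E] (θ : unitInterval) {F : ℝ → E} (hF : Integrable F (gaussianReal 0 1)) :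
    ∫ x, F x ∂bernoulliGaussian θ = (θ : ℝ) • ∫ x, F x ∂gaussianReal 0 1 + (1 - θ : ℝ) • F 0 := by
  rw [bernoulliGaussian_eq, integral_add_measure hF.smul_measure_nnreal
    (integrable_dirac (by simp)).smul_measure_nnreal, integral_smul_nnreal_measure,
    integral_smul_nnreal_measure, integral_dirac]
  rfl

/-- The exponent 1/4 is half of that in the Gaussian density, so a Gaussian remains. All tail
estimates below rest on this exponential moment. -/
lemma integrable_exp_sq_gaussianReal :
    Integrable (fun x : ℝ => Real.exp (x ^ 2 / 4)) (gaussianReal 0 1) := by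
  rw [gaussianReal_of_var_ne_zero _ one_ne_zero,
    integrable_withDensity_iff_integrable_smul' (measurable_gaussianPDF _ _)
      (by simp [gaussianPDF])]
  have h := (integrable_exp_neg_mul_sq (b := 1 / 4) (by norm_num)).const_mul
    ((√(2 * Real.pi))⁻¹)
  refine h.congr ?_
  filter_upwards with x
  simp only [toReal_gaussianPDF, gaussianPDFReal_def, smul_eq_mul, NNReal.coe_one, mul_one,
    sub_zero]
  rw [mul_assoc, ← Real.exp_add]
  congr 2
  ring

lemma integral_exp_sq_gaussianReal :
    ∫ x : ℝ, Real.exp (x ^ 2 / 4) ∂gaussianReal 0 1 = √2 := by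
  rw [integral_gaussianReal_eq_integral_smul one_ne_zero]
  have h := integral_gaussian (1 / 4)
  have e : ∀ x : ℝ, gaussianPDFReal 0 1 x • Real.exp (x ^ 2 / 4) =
      (√(2 * Real.pi))⁻¹ * Real.exp (-(1 / 4) * x ^ 2) := by
    intro x
    simp only [gaussianPDFReal_def, smul_eq_mul, NNReal.coe_one, mul_one, sub_zero]
    rw [mul_assoc, ← Real.exp_add]
    congr 2
    ring
  simp_rw [e]
  rw [integral_const_mul, h, ← Real.sqrt_inv, ← Real.sqrt_mul (by positivity)]
  congr 1
  have := Real.pi_ne_zero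
  field_simp
  norm_num

lemma integrable_exp_sq_bernoulliGaussian (θ : unitInterval) :
    Integrable (fun x : ℝ => Real.exp (x ^ 2 / 4)) (bernoulliGaussian θ) :=
  integrable_bernoulliGaussian θ integrable_exp_sq_gaussianReal

lemma integral_exp_sq_bernoulliGaussian_le (θ : unitInterval) :
    ∫ x : ℝ, Real.exp (x ^ 2 / 4) ∂bernoulliGaussian θ ≤ 2 := by
  rw [integral_bernoulliGaussian θ integrable_exp_sq_gaussianReal, integral_exp_sq_gaussianReal]
  have h2 : √2 ≤ 2 := by rw [Real.sqrt_le_left (by norm_num)]; norm_num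
  have h0 := θ.2.1
  have h1 := θ.2.2
  simp only [smul_eq_mul]
  norm_num
  nlinarith

lemma integrable_pow_mul_cexp_gaussianReal (m : ℕ) (t : ℝ) :
    Integrable (fun x : ℝ => (x : ℂ) ^ m * Complex.exp (t * x * Complex.I)) (gaussianReal 0 1) := by
  have h : Integrable (fun x : ℝ => |x| ^ m) (gaussianReal 0 1) := by
    have := integrable_pow_abs_of_mem_interior_integrableExpSet (X := id)
      (μ := gaussianReal 0 1) (by simp) m
    simpa using this
  refine h.mono' (Continuous.aestronglyMeasurable (by fun_prop)) ?_
  filter_upwards with x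
  rw [norm_mul, norm_pow, Complex.norm_real, ← Complex.ofReal_mul,
    Complex.norm_exp_ofReal_mul_I, mul_one, Real.norm_eq_abs]

/-- Moments come from differentiating the complex moment generating function exp(z²/2) in two ways,
under the integral and explicitly, and setting z = it. -/
lemma integral_pow_mul_cexp_gaussianReal (t : ℝ) :
    (∫ x : ℝ, Complex.exp (t * x * Complex.I) ∂gaussianReal 0 1 = Real.exp (-t ^ 2 / 2)) ∧
    (∫ x : ℝ, (x : ℂ) * Complex.exp (t * x * Complex.I) ∂gaussianReal 0 1 =
      t * Complex.I * Real.exp (-t ^ 2 / 2)) ∧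
    (∫ x : ℝ, (x : ℂ) ^ 2 * Complex.exp (t * x * Complex.I) ∂gaussianReal 0 1 =
      (1 - t ^ 2) * Real.exp (-t ^ 2 / 2)) := by
  have hz : ∀ z : ℂ, z.re ∈ interior (integrableExpSet id (gaussianReal 0 1)) := by simp
  have h0 : ∀ z : ℂ, ∫ x : ℝ, Complex.exp (z * x) ∂gaussianReal 0 1 = Complex.exp (z ^ 2 / 2) := by
    intro z
    have := complexMGF_id_gaussianReal (μ := 0) (v := 1) z
    simpa [complexMGF] using this
  have h1 : ∀ z : ℂ, ∫ x : ℝ, (x : ℂ) * Complex.exp (z * x) ∂gaussianReal 0 1 =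
      z * Complex.exp (z ^ 2 / 2) := by
    intro z
    have a := hasDerivAt_integral_pow_mul_exp (hz z) 0
    simp only [id, pow_zero, one_mul, h0, zero_add, pow_one] at a
    have b : HasDerivAt (fun z : ℂ => Complex.exp (z ^ 2 / 2)) (z * Complex.exp (z ^ 2 / 2)) z := by
      have := ((hasDerivAt_pow 2 z).div_const 2).cexp
      refine this.congr_deriv ?_
      push_cast
      ring
    exact a.unique b
  have h2 : ∀ z : ℂ, ∫ x : ℝ, (x : ℂ) ^ 2 * Complex.exp (z * x) ∂gaussianReal 0 1 =
      (1 + z ^ 2) * Complex.exp (z ^ 2 / 2) := by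
    intro z
    have a := hasDerivAt_integral_pow_mul_exp (hz z) 1
    simp only [id, pow_one, h1] at a
    have b : HasDerivAt (fun z : ℂ => z * Complex.exp (z ^ 2 / 2))
        ((1 + z ^ 2) * Complex.exp (z ^ 2 / 2)) z := by
      have := (hasDerivAt_id z).mul ((hasDerivAt_pow 2 z).div_const 2).cexp
      refine this.congr_deriv ?_
      push_cast
      simp
      ring
    exact a.unique b
  have e : ∀ x : ℝ, (t : ℂ) * x * Complex.I = (t * Complex.I) * x := fun x => by ring
  have e2 : ((t : ℂ) * Complex.I) ^ 2 = -t ^ 2 := by rw [mul_pow, Complex.I_sq]; ring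
  simp_rw [e, h0, h1, h2, e2]
  push_cast
  refine ⟨rfl, rfl, by ring⟩

/-- The characteristic function of the standard Gaussian law. -/
noncomputable def gaussChar (t : ℝ) : ℝ := Real.exp (-t ^ 2 / 2)

/-- The characteristic function of the Bernoulli-Gaussian law. -/
noncomputable def bgChar (θ t : ℝ) : ℝ := 1 - θ + θ * gaussChar t

lemma gaussChar_pos (t : ℝ) : 0 < gaussChar t := Real.exp_pos _

lemma gaussChar_le_one (t : ℝ) : gaussChar t ≤ 1 := by
  unfold gaussChar; rw [Real.exp_le_one_iff]; nlinarith [sq_nonneg t]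

lemma integral_cexp_bernoulliGaussian (θ : unitInterval) (t : ℝ) :
    ∫ x : ℝ, Complex.exp (t * x * Complex.I) ∂bernoulliGaussian θ = bgChar θ t := by
  have := integrable_pow_mul_cexp_gaussianReal 0 t
  simp only [pow_zero, one_mul] at this
  rw [integral_bernoulliGaussian θ this, (integral_pow_mul_cexp_gaussianReal t).1]
  simp [bgChar, gaussChar]
  ring

lemma integral_mul_cexp_bernoulliGaussian (θ : unitInterval) (t : ℝ) :
    ∫ x : ℝ, (x : ℂ) * Complex.exp (t * x * Complex.I) ∂bernoulliGaussian θ =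
      (θ * t * gaussChar t : ℝ) * Complex.I := by
  have := integrable_pow_mul_cexp_gaussianReal 1 t
  simp only [pow_one] at this
  rw [integral_bernoulliGaussian θ this, (integral_pow_mul_cexp_gaussianReal t).2.1]
  simp [gaussChar]
  ring

lemma integral_sq_mul_cexp_bernoulliGaussian (θ : unitInterval) (t : ℝ) :
    ∫ x : ℝ, (x : ℂ) ^ 2 * Complex.exp (t * x * Complex.I) ∂bernoulliGaussian θ =
      (θ * (1 - t ^ 2) * gaussChar t : ℝ) := by
  rw [integral_bernoulliGaussian θ (integrable_pow_mul_cexp_gaussianReal 2 t),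
    (integral_pow_mul_cexp_gaussianReal t).2.2]
  simp [gaussChar]
  ring

/-! ### Trigonometric moments of a Bernoulli-Gaussian vector -/

/-- The law of a vector with `n` independent Bernoulli-Gaussian entries. -/
noncomputable abbrev bgVec (θ : unitInterval) (n : ℕ) : Measure (Fin n → ℝ) :=
  Measure.pi fun _ => bernoulliGaussian θ

section
variable {n : ℕ} (θ : unitInterval)

lemma integrable_exp_sq_bgVec (i : Fin n) :
    Integrable (fun x => Real.exp (x i ^ 2 / 4)) (bgVec θ n) :=
  integrable_comp_eval (μ := fun _ : Fin n => bernoulliGaussian θ) (i := i)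
    (integrable_exp_sq_bernoulliGaussian θ)

lemma integral_exp_sq_bgVec_le (i : Fin n) :
    ∫ x, Real.exp (x i ^ 2 / 4) ∂bgVec θ n ≤ 2 := by
  have := integral_comp_eval (μ := fun _ : Fin n => bernoulliGaussian θ) (i := i)
    (integrable_exp_sq_bernoulliGaussian θ).aestronglyMeasurable
  rw [this]
  exact integral_exp_sq_bernoulliGaussian_le θ

lemma le_exp_sq_div (a : ℝ) : a ^ 2 ≤ 4 * Real.exp (a ^ 2 / 4) := by
  have := Real.add_one_le_exp (a ^ 2 / 4)
  linarith

lemma integrable_mul_bgVec (i j : Fin n) : Integrable (fun x => x i * x j) (bgVec θ n) := by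
  refine (((integrable_exp_sq_bgVec θ i).add (integrable_exp_sq_bgVec θ j)).const_mul 4).mono'
    (Continuous.aestronglyMeasurable (by fun_prop)) ?_
  filter_upwards with x
  have h1 := le_exp_sq_div (x i)
  have h2 := le_exp_sq_div (x j)
  rw [Real.norm_eq_abs, abs_le]
  simp only [Pi.add_apply]
  constructor <;> nlinarith [sq_nonneg (x i + x j), sq_nonneg (x i - x j)]

lemma integrable_sum_mul_bgVec (q : Fin n → ℝ) (j : Fin n) :
    Integrable (fun x => (∑ l, q l * x l) * x j) (bgVec θ n) := by
  simp_rw [Finset.sum_mul, mul_assoc]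
  exact integrable_finsetSum _ fun l _ => (integrable_mul_bgVec θ l j).const_mul _

lemma integrable_prod_pow_mul_cexp (m : Fin n → ℕ) (t : Fin n → ℝ) :
    Integrable (fun x : Fin n → ℝ =>
      ∏ l, ((x l : ℂ) ^ m l * Complex.exp (t l * x l * Complex.I))) (bgVec θ n) :=
  Integrable.fintype_prod (f := fun l (y : ℝ) => (y : ℂ) ^ m l * Complex.exp (t l * y * Complex.I))
    fun l => integrable_bernoulliGaussian θ (integrable_pow_mul_cexp_gaussianReal (m l) (t l))

lemma prod_pow_mul_cexp (m : Fin n → ℕ) (t x : Fin n → ℝ) :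
    ∏ l, ((x l : ℂ) ^ m l * Complex.exp (t l * x l * Complex.I)) =
      ((∏ l, x l ^ m l : ℝ) : ℂ) * (Real.cos (∑ l, t l * x l) +
        Real.sin (∑ l, t l * x l) * Complex.I) := by
  rw [Finset.prod_mul_distrib, ← Complex.exp_sum, ← Finset.sum_mul]
  push_cast
  rw [Complex.exp_mul_I]

/-- The complex exponential of a sum factorizes over independent coordinates; the cosine is
recovered as its real part. -/
lemma integral_prod_pow_mul_cos (m : Fin n → ℕ) (t : Fin n → ℝ) :
    ∫ x, (∏ l, x l ^ m l) * Real.cos (∑ l, t l * x l) ∂bgVec θ n =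
      (∏ l, ∫ y : ℝ, (y : ℂ) ^ m l * Complex.exp (t l * y * Complex.I)
        ∂bernoulliGaussian θ).re := by
  rw [← integral_fintype_prod_eq_prod
    (fun l (y : ℝ) => (y : ℂ) ^ m l * Complex.exp (t l * y * Complex.I))]
  have := Complex.reCLM.integral_comp_comm (integrable_prod_pow_mul_cexp θ m t)
  rw [Complex.reCLM_apply] at this
  rw [← this]
  refine integral_congr_ae ?_
  filter_upwards with x
  rw [prod_pow_mul_cexp]
  simp [-Complex.ofReal_prod, -Complex.ofReal_cos, -Complex.ofReal_sin, -Complex.ofReal_sum]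

lemma integral_prod_pow_mul_sin (m : Fin n → ℕ) (t : Fin n → ℝ) :
    ∫ x, (∏ l, x l ^ m l) * Real.sin (∑ l, t l * x l) ∂bgVec θ n =
      (∏ l, ∫ y : ℝ, (y : ℂ) ^ m l * Complex.exp (t l * y * Complex.I)
        ∂bernoulliGaussian θ).im := by
  rw [← integral_fintype_prod_eq_prod
    (fun l (y : ℝ) => (y : ℂ) ^ m l * Complex.exp (t l * y * Complex.I))]
  have := Complex.imCLM.integral_comp_comm (integrable_prod_pow_mul_cexp θ m t)
  rw [Complex.imCLM_apply] at this
  rw [← this]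
  refine integral_congr_ae ?_
  filter_upwards with x
  rw [prod_pow_mul_cexp]
  simp [-Complex.ofReal_prod, -Complex.ofReal_cos, -Complex.ofReal_sin, -Complex.ofReal_sum]

lemma prod_single_pow (j : Fin n) (a : ℕ) (x : Fin n → ℝ) :
    ∏ l, x l ^ (Pi.single j a : Fin n → ℕ) l = x j ^ a := by
  rw [← Finset.mul_prod_erase _ _ (Finset.mem_univ j), Finset.prod_eq_one]
  · simp
  · intro l hl
    simp [Finset.ne_of_mem_erase hl]

lemma prod_integral_single (j : Fin n) (a : ℕ) (t : Fin n → ℝ) :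
    ∏ l, ∫ y : ℝ, (y : ℂ) ^ (Pi.single j a : Fin n → ℕ) l * Complex.exp (t l * y * Complex.I)
        ∂bernoulliGaussian θ =
      (∫ y : ℝ, (y : ℂ) ^ a * Complex.exp (t j * y * Complex.I) ∂bernoulliGaussian θ) *
        ((∏ l ∈ Finset.univ.erase j, bgChar θ (t l) : ℝ) : ℂ) := by
  rw [← Finset.mul_prod_erase _ _ (Finset.mem_univ j)]
  congr 1
  · simp
  · push_cast
    refine Finset.prod_congr rfl fun l hl => ?_
    simp [Finset.ne_of_mem_erase hl, integral_cexp_bernoulliGaussian]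

lemma integral_eval_mul_sin (j : Fin n) (t : Fin n → ℝ) :
    ∫ x, x j * Real.sin (∑ l, t l * x l) ∂bgVec θ n =
      θ * t j * gaussChar (t j) * ∏ l ∈ Finset.univ.erase j, bgChar θ (t l) := by
  have h := integral_prod_pow_mul_sin θ (Pi.single j 1) t
  simp_rw [prod_single_pow, prod_integral_single, pow_one] at h
  rw [h, integral_mul_cexp_bernoulliGaussian]
  simp [-Complex.ofReal_prod, -Complex.ofReal_mul]

lemma integral_sq_mul_cos (j : Fin n) (t : Fin n → ℝ) :
    ∫ x, x j ^ 2 * Real.cos (∑ l, t l * x l) ∂bgVec θ n =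
      θ * (1 - t j ^ 2) * gaussChar (t j) * ∏ l ∈ Finset.univ.erase j, bgChar θ (t l) := by
  have h := integral_prod_pow_mul_cos θ (Pi.single j 2) t
  simp_rw [prod_single_pow, prod_integral_single] at h
  rw [h, integral_sq_mul_cexp_bernoulliGaussian]
  simp [-Complex.ofReal_prod, -Complex.ofReal_mul]

/-- Each first moment contributes a factor i, and i² = -1 is the origin of the sign. -/
lemma integral_mul_mul_cos {i j : Fin n} (hij : i ≠ j) (t : Fin n → ℝ) :
    ∫ x, x i * x j * Real.cos (∑ l, t l * x l) ∂bgVec θ n =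
      -(θ ^ 2 * t i * t j * gaussChar (t i) * gaussChar (t j) *
        ∏ l ∈ (Finset.univ.erase i).erase j, bgChar θ (t l)) := by
  have h := integral_prod_pow_mul_cos θ (Pi.single i 1 + Pi.single j 1) t
  have e1 : ∀ x : Fin n → ℝ, ∏ l, x l ^ (Pi.single i 1 + Pi.single j 1 : Fin n → ℕ) l
      = x i * x j := by
    intro x
    simp_rw [Pi.add_apply, pow_add, Finset.prod_mul_distrib, prod_single_pow, pow_one]
  have hj : j ∈ Finset.univ.erase i := Finset.mem_erase.2 ⟨hij.symm, Finset.mem_univ _⟩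
  simp_rw [e1] at h
  rw [h, ← Finset.mul_prod_erase _ _ (Finset.mem_univ i), ← Finset.mul_prod_erase _ _ hj]
  have e2 : ∏ l ∈ (Finset.univ.erase i).erase j, ∫ y : ℝ, (y : ℂ) ^
      (Pi.single i 1 + Pi.single j 1 : Fin n → ℕ) l * Complex.exp (t l * y * Complex.I)
        ∂bernoulliGaussian θ = ((∏ l ∈ (Finset.univ.erase i).erase j, bgChar θ (t l) : ℝ) : ℂ) := by
    push_cast
    refine Finset.prod_congr rfl fun l hl => ?_
    have h1 := Finset.ne_of_mem_erase hl
    have h2 := Finset.ne_of_mem_erase (Finset.mem_of_mem_erase hl)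
    simp [h1, h2, integral_cexp_bernoulliGaussian]
  rw [e2]
  simp only [Pi.add_apply, Pi.single_eq_same, Pi.single_eq_of_ne hij, Pi.single_eq_of_ne hij.symm,
    add_zero, zero_add, pow_one, integral_mul_cexp_bernoulliGaussian]
  set P := ∏ l ∈ (Finset.univ.erase i).erase j, bgChar θ (t l)
  have : ((θ * t i * gaussChar (t i) : ℝ) : ℂ) * Complex.I *
      (((θ * t j * gaussChar (t j) : ℝ) : ℂ) * Complex.I * (P : ℂ)) =
      ((-(θ ^ 2 * t i * t j * gaussChar (t i) * gaussChar (t j) * P) : ℝ) : ℂ) := by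
    push_cast
    linear_combination (θ * t i * gaussChar (t i) * (θ * t j * gaussChar (t j) * P) : ℂ) *
      Complex.I_sq
  rw [this, Complex.ofReal_re]

lemma integral_sq_bgVec (j : Fin n) : ∫ x, x j ^ 2 ∂bgVec θ n = θ := by
  have := integral_sq_mul_cos θ j 0
  simpa [gaussChar, bgChar] using this

/-! ### Population gradient and Hessian of the objective -/

variable (μ : ℝ) (q : Fin n → ℝ)

/-- The expectation of the `j`-th partial derivative of the objective at `q`. -/
noncomputable def popGrad (j : Fin n) : ℝ :=
  ∫ x, Real.tanh ((∑ l, q l * x l) / μ) * x j ∂bgVec θ n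

/-- The expectation of `μ` times the `(i, j)` entry of the Hessian of the objective at `q`. -/
noncomputable def popHess (i j : Fin n) : ℝ :=
  ∫ x, sechSq ((∑ l, q l * x l) / μ) * (x i * x j) ∂bgVec θ n

lemma mul_sum_div (ω : ℝ) (x : Fin n → ℝ) :
    ω * ((∑ l, q l * x l) / μ) = ∑ l, ω / μ * q l * x l := by
  rw [Finset.sum_div, Finset.mul_sum]
  refine Finset.sum_congr rfl fun l _ => ?_
  ring

lemma abs_sin_mul_div_le (ω z : ℝ) : |Real.sin (ω * z) / ω| ≤ |z| := by
  rcases eq_or_ne ω 0 with rfl | h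
  · simp
  rw [abs_div, div_le_iff₀ (abs_pos.2 h), mul_comm, ← abs_mul]
  exact Real.abs_sin_le_abs

/-- Fubini applies because |sin(ωz)/ω| ≤ |z|. The frequency ω produced by the first moment cancels
the denominator of the sine transform. -/
lemma popGrad_eq (j : Fin n) :
    popGrad θ μ q j = ∫ ω, sechDensity ω * (θ * (q j / μ) * gaussChar (ω / μ * q j) *
      ∏ l ∈ Finset.univ.erase j, bgChar θ (ω / μ * q l)) := by
  unfold popGrad
  simp_rw [tanh_eq_integral, ← integral_mul_const]
  rw [integral_integral_swap]
  · refine integral_congr_ae ?_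
    filter_upwards [compl_mem_ae_iff.2 (measure_singleton (0 : ℝ))] with ω hω
    have hω' : ω ≠ 0 := hω
    have h := integral_eval_mul_sin θ j (fun l => ω / μ * q l)
    simp only [← mul_sum_div] at h
    have e : ∀ x : Fin n → ℝ, sechDensity ω * (Real.sin (ω * ((∑ l, q l * x l) / μ)) / ω) * x j =
        sechDensity ω / ω * (x j * Real.sin (ω * ((∑ l, q l * x l) / μ))) := fun x => by ring
    simp_rw [e]
    rw [integral_const_mul, h]
    field_simp
  · have hb := Integrable.mul_prod (integrable_sum_mul_bgVec θ (fun l => q l / μ) j).norm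
      integrable_sechDensity
    refine hb.mono' ?_ ?_
    · refine Measurable.aestronglyMeasurable ?_
      have := continuous_sechDensity.measurable
      simp only [Function.uncurry_def]
      fun_prop
    · filter_upwards with z
      have h0 := (sechDensity_pos z.2).le
      have h1 := abs_sin_mul_div_le z.2 ((∑ l, q l * z.1 l) / μ)
      simp only [Function.uncurry_def, norm_mul, Real.norm_of_nonneg h0]
      rw [Finset.sum_div] at h1 ⊢
      simp only [Real.norm_eq_abs]
      have e : ∀ l, q l / μ * z.1 l = q l * z.1 l / μ := fun l => by ring
      simp_rw [e]
      calc _ ≤ sechDensity z.2 * |∑ l, q l * z.1 l / μ| * |z.1 j| := by gcongr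
        _ = _ := by ring

lemma popHess_eq_integral (i j : Fin n) :
    popHess θ μ q i j = ∫ ω, sechDensity ω *
      ∫ x, x i * x j * Real.cos (∑ l, ω / μ * q l * x l) ∂bgVec θ n := by
  unfold popHess
  simp_rw [sechSq_eq_integral, ← integral_mul_const]
  rw [integral_integral_swap]
  · congr 1
    ext ω
    rw [← integral_const_mul]
    congr 1
    ext x
    rw [mul_sum_div]
    ring
  · have hb := Integrable.mul_prod (integrable_mul_bgVec θ i j).norm integrable_sechDensity
    refine hb.mono' ?_ ?_
    · refine Measurable.aestronglyMeasurable ?_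
      have := continuous_sechDensity.measurable
      simp only [Function.uncurry_def]
      fun_prop
    · filter_upwards with z
      have h0 := (sechDensity_pos z.2).le
      have h1 := Real.abs_cos_le_one (z.2 * ((∑ l, q l * z.1 l) / μ))
      simp only [Function.uncurry_def, norm_mul, Real.norm_of_nonneg h0, Real.norm_eq_abs]
      calc _ ≤ sechDensity z.2 * 1 * (|z.1 i| * |z.1 j|) := by gcongr
        _ = _ := by ring

lemma popHess_self_eq (j : Fin n) :
    popHess θ μ q j j = ∫ ω, sechDensity ω * (θ * (1 - (ω / μ * q j) ^ 2) *
      gaussChar (ω / μ * q j) * ∏ l ∈ Finset.univ.erase j, bgChar θ (ω / μ * q l)) := by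
  rw [popHess_eq_integral]
  congr 1
  ext ω
  rw [← integral_sq_mul_cos θ j fun l => ω / μ * q l]
  simp only [pow_two]

lemma popHess_eq {i j : Fin n} (hij : i ≠ j) :
    popHess θ μ q i j = ∫ ω, sechDensity ω * -(θ ^ 2 * (ω / μ * q i) * (ω / μ * q j) *
      gaussChar (ω / μ * q i) * gaussChar (ω / μ * q j) *
        ∏ l ∈ (Finset.univ.erase i).erase j, bgChar θ (ω / μ * q l)) := by
  rw [popHess_eq_integral]
  congr 1
  ext ω
  rw [← integral_mul_mul_cos θ hij fun l => ω / μ * q l]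

end

/-! ### Lower bounds on the population gradient and curvature -/

attribute [fun_prop] continuous_sechDensity continuous_sechSq continuous_tanh

@[fun_prop]
lemma continuous_gaussChar : Continuous gaussChar := by unfold gaussChar; fun_prop

@[fun_prop]
lemma continuous_bgChar (θ : ℝ) : Continuous (bgChar θ) := by unfold bgChar; fun_prop

/-- The right side is a convex combination of 1 and the left side. In products this gives a lower
bound free of θ that depends only on the sum of squares. -/
lemma gaussChar_le_bgChar {θ : ℝ} (h1 : θ ≤ 1) (t : ℝ) : gaussChar t ≤ bgChar θ t := by
  have := gaussChar_le_one t
  unfold bgChar; nlinarith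

lemma bgChar_le_one {θ : ℝ} (h0 : 0 ≤ θ) (t : ℝ) : bgChar θ t ≤ 1 := by
  have := gaussChar_le_one t
  unfold bgChar; nlinarith

lemma bgChar_pos {θ : ℝ} (h1 : θ ≤ 1) (t : ℝ) : 0 < bgChar θ t :=
  (gaussChar_pos t).trans_le (gaussChar_le_bgChar h1 t)

lemma prod_gaussChar {ι : Type*} (s : Finset ι) (w : ℝ) (q : ι → ℝ) :
    ∏ l ∈ s, gaussChar (w * q l) = Real.exp (-(w ^ 2 * ∑ l ∈ s, q l ^ 2) / 2) := by
  unfold gaussChar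
  rw [← Real.exp_sum]
  congr 1
  rw [Finset.mul_sum, ← Finset.sum_neg_distrib, Finset.sum_div]
  refine Finset.sum_congr rfl fun l _ => ?_
  ring

lemma prod_gaussChar_le_prod_bgChar {ι : Type*} (s : Finset ι) {θ : ℝ} (h1 : θ ≤ 1)
    (w : ℝ) (q : ι → ℝ) :
    Real.exp (-(w ^ 2 * ∑ l ∈ s, q l ^ 2) / 2) ≤ ∏ l ∈ s, bgChar θ (w * q l) := by
  rw [← prod_gaussChar]
  exact Finset.prod_le_prod (fun l _ => (gaussChar_pos _).le)
    fun l _ => gaussChar_le_bgChar h1 _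

lemma prod_bgChar_nonneg {ι : Type*} (s : Finset ι) {θ : ℝ} (h1 : θ ≤ 1)
    (w : ℝ) (q : ι → ℝ) : 0 ≤ ∏ l ∈ s, bgChar θ (w * q l) :=
  Finset.prod_nonneg fun _ _ => (bgChar_pos h1 _).le

lemma prod_bgChar_le_one {ι : Type*} (s : Finset ι) {θ : ℝ} (h0 : 0 ≤ θ) (h1 : θ ≤ 1)
    (w : ℝ) (q : ι → ℝ) : ∏ l ∈ s, bgChar θ (w * q l) ≤ 1 :=
  Finset.prod_le_one (fun _ _ => (bgChar_pos h1 _).le) fun _ _ => bgChar_le_one h0 _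

lemma integrable_sechDensity_mul_of_le {G : ℝ → ℝ} (hG : Continuous G) (K : ℝ)
    (h : ∀ ω, |G ω| ≤ K * (1 + ω ^ 2)) : Integrable fun ω => sechDensity ω * G ω := by
  refine (integrable_sechDensity_mul.const_mul K).mono'
    (Continuous.aestronglyMeasurable (by fun_prop)) ?_
  filter_upwards with ω
  have h0 := sechDensity_pos ω
  rw [norm_mul, Real.norm_of_nonneg h0.le, Real.norm_eq_abs]
  calc sechDensity ω * |G ω| ≤ sechDensity ω * (K * (1 + ω ^ 2)) := by gcongr; exact h ω
    _ = _ := by ring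

/-- After ω = μw it suffices to integrate over w in [1, 2]. There μw stays in [0, 2] because μ ≤ 1,
so the minimum of the density on [0, 2] gives a constant independent of μ. -/
lemma exists_gaussian_mass_le :
    ∃ c : ℝ, 0 < c ∧ ∀ μ : ℝ, 0 < μ → μ ≤ 1 →
      μ * c ≤ ∫ ω, sechDensity ω * ((ω / μ) ^ 2 * gaussChar (ω / μ)) := by
  obtain ⟨x₀, -, hx₀⟩ := (isCompact_Icc (a := (0 : ℝ)) (b := 2)).exists_isMinOn
    ⟨0, by simp⟩ continuous_sechDensity.continuousOn
  have hm := sechDensity_pos x₀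
  refine ⟨sechDensity x₀ * Real.exp (-2), by positivity, fun μ hμ hμ1 => ?_⟩
  have h1 : ∫ ω, sechDensity ω * ((ω / μ) ^ 2 * gaussChar (ω / μ)) =
      μ * ∫ w, sechDensity (μ * w) * (w ^ 2 * gaussChar w) := by
    have := Measure.integral_comp_mul_left
      (fun ω => sechDensity ω * ((ω / μ) ^ 2 * gaussChar (ω / μ))) μ
    rw [abs_of_pos (inv_pos.2 hμ), smul_eq_mul] at this
    have e : ∀ w : ℝ, μ * w / μ = w := fun w => by field_simp
    simp_rw [e] at this
    rw [this]
    field_simp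
  have hint : Integrable fun w => sechDensity (μ * w) * (w ^ 2 * gaussChar w) := by
    have h := integrable_sechDensity_mul_of_le (G := fun ω => (ω / μ) ^ 2 * gaussChar (ω / μ))
      (by fun_prop) (1 / μ ^ 2) fun ω => by
        have h0 := gaussChar_pos (ω / μ)
        have h1 := gaussChar_le_one (ω / μ)
        rw [abs_of_nonneg (by positivity)]
        calc (ω / μ) ^ 2 * gaussChar (ω / μ) ≤ (ω / μ) ^ 2 * 1 := by gcongr
          _ = 1 / μ ^ 2 * ω ^ 2 := by field_simp
          _ ≤ _ := by gcongr; linarith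
    have := h.comp_mul_left' hμ.ne'
    refine this.congr ?_
    filter_upwards with w
    have e : μ * w / μ = w := by field_simp
    simp only [e]
  rw [h1]
  refine mul_le_mul_of_nonneg_left ?_ hμ.le
  calc sechDensity x₀ * Real.exp (-2)
      = ∫ w in Set.Icc (1 : ℝ) 2, sechDensity x₀ * Real.exp (-2) := by
        rw [setIntegral_const]; norm_num
    _ ≤ ∫ w in Set.Icc (1 : ℝ) 2, sechDensity (μ * w) * (w ^ 2 * gaussChar w) := by
        refine setIntegral_mono_on continuous_const.integrableOn_Icc hint.integrableOn measurableSet_Icc fun w hw => ?_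
        have h2 : sechDensity x₀ ≤ sechDensity (μ * w) :=
          hx₀ ⟨by nlinarith [hw.1], by nlinarith [hw.1, hw.2]⟩
        have h3 : Real.exp (-2) ≤ gaussChar w := by
          unfold gaussChar
          rw [Real.exp_le_exp]
          nlinarith [hw.1, hw.2]
        have h4 : 1 ≤ w ^ 2 := by nlinarith [hw.1]
        have := Real.exp_pos (-2)
        have h5 := (sechDensity_pos (μ * w)).le
        calc sechDensity x₀ * Real.exp (-2) ≤ sechDensity (μ * w) * gaussChar w := by gcongr
          _ ≤ _ := by
            have : gaussChar w ≤ w ^ 2 * gaussChar w := by nlinarith [gaussChar_pos w]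
            have := sechDensity_pos (μ * w)
            gcongr
    _ ≤ _ := by
        refine setIntegral_le_integral hint ?_
        filter_upwards with w
        have := sechDensity_pos (μ * w)
        have := gaussChar_pos w
        simp only [Pi.zero_apply]
        positivity

/-- A lower bound for the Gaussian-weighted mass of `sechDensity` near the origin. -/
noncomputable def massConst : ℝ := exists_gaussian_mass_le.choose

lemma massConst_pos : 0 < massConst := exists_gaussian_mass_le.choose_spec.1

lemma massConst_le {μ : ℝ} (h0 : 0 < μ) (h1 : μ ≤ 1) :
    μ * massConst ≤ ∫ ω, sechDensity ω * ((ω / μ) ^ 2 * gaussChar (ω / μ)) :=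
  exists_gaussian_mass_le.choose_spec.2 μ h0 h1

/-- The ratio of the two values is exp((a² - b²)w²/2), and exp u ≥ 1 + u. No order between a and b
is assumed: the gradient bound and the curvature bound use opposite orders. -/
lemma gaussChar_sub_ge {a b w : ℝ} :
    gaussChar (w * a) * ((a ^ 2 - b ^ 2) * w ^ 2 / 2) ≤ gaussChar (w * b) - gaussChar (w * a) := by
  have h := Real.add_one_le_exp ((a ^ 2 - b ^ 2) * w ^ 2 / 2)
  have e : gaussChar (w * b) = gaussChar (w * a) * Real.exp ((a ^ 2 - b ^ 2) * w ^ 2 / 2) := by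
    unfold gaussChar
    rw [← Real.exp_add]
    congr 1
    ring
  rw [e]
  nlinarith [gaussChar_pos (w * a)]

lemma sum_erase_erase_add {n : ℕ} {i j : Fin n} (hij : i ≠ j) (f : Fin n → ℝ) :
    ∑ l ∈ (Finset.univ.erase i).erase j, f l + f i + f j = ∑ l, f l := by
  rw [← Finset.add_sum_erase _ _ (Finset.mem_univ i), ← Finset.add_sum_erase _ _
    (Finset.mem_erase.2 ⟨hij.symm, Finset.mem_univ j⟩)]
  ring

lemma prod_erase_eq {n : ℕ} {i j : Fin n} (hij : i ≠ j) (f : Fin n → ℝ) :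
    ∏ l ∈ Finset.univ.erase j, f l = f i * ∏ l ∈ (Finset.univ.erase i).erase j, f l := by
  rw [← Finset.mul_prod_erase _ _ (Finset.mem_erase.2 ⟨hij, Finset.mem_univ i⟩),
    Finset.erase_right_comm]

section
variable {n : ℕ} (θ : unitInterval) {μ : ℝ} {q : Fin n → ℝ} {i j : Fin n}

/-- Replacing each `bgChar` by `gaussChar` leaves exp(-w²(1 - q_i²)/2), since the squares sum to
one. The resulting bound does not depend on q. -/
lemma gaussChar_le_prod_mul (hq : ∑ l, q l ^ 2 = 1) (hij : i ≠ j) (w : ℝ) :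
    gaussChar w ≤ (∏ l ∈ (Finset.univ.erase i).erase j, bgChar θ (w * q l)) *
      gaussChar (w * q j) := by
  have h := prod_gaussChar_le_prod_bgChar ((Finset.univ.erase i).erase j) θ.2.2 w q
  have hs := sum_erase_erase_add hij fun l => q l ^ 2
  rw [hq] at hs
  refine le_trans ?_ (mul_le_mul_of_nonneg_right h (gaussChar_pos _).le)
  unfold gaussChar
  rw [← Real.exp_add, Real.exp_le_exp]
  have : (∑ l ∈ (Finset.univ.erase i).erase j, q l ^ 2) = 1 - q i ^ 2 - q j ^ 2 := by linarith
  rw [this]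
  nlinarith [mul_nonneg (sq_nonneg w) (sq_nonneg (q i))]

lemma gaussChar_le_prod_mul' (hq : ∑ l, q l ^ 2 = 1) (hij : i ≠ j) (w : ℝ) :
    gaussChar w ≤ (∏ l ∈ (Finset.univ.erase i).erase j, bgChar θ (w * q l)) *
      gaussChar (w * q i) := by
  rw [Finset.erase_right_comm]
  exact gaussChar_le_prod_mul θ hq hij.symm w

lemma abs_mul_le_one {a b : ℝ} (ha0 : 0 ≤ a) (ha : a ≤ 1) (hb0 : 0 ≤ b) (hb : b ≤ 1) :
    |a * b| ≤ 1 := by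
  rw [abs_of_nonneg (by positivity)]
  nlinarith

lemma le_one_mul_one_add_sq (ω : ℝ) : 1 ≤ 1 * (1 + ω ^ 2) := by nlinarith [sq_nonneg ω]

lemma integrable_gaussChar_mul_prod (s : Finset (Fin n)) :
    Integrable fun ω => sechDensity ω *
      (gaussChar (ω / μ * q j) * ∏ l ∈ s, bgChar θ (ω / μ * q l)) :=
  integrable_sechDensity_mul_of_le (by fun_prop) 1 fun ω =>
    (abs_mul_le_one (gaussChar_pos _).le (gaussChar_le_one _) (prod_bgChar_nonneg s θ.2.2 _ _)
      (prod_bgChar_le_one s θ.2.1 θ.2.2 _ _)).trans (le_one_mul_one_add_sq ω)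

/-- The population gradient along the rotation of coordinates `i` and `j`. -/
lemma popGrad_rotation_eq (hij : i ≠ j) :
    q i * popGrad θ μ q j - q j * popGrad θ μ q i =
      q i * q j * (θ * (1 - θ) / μ * ∫ ω, sechDensity ω *
        ((∏ l ∈ (Finset.univ.erase i).erase j, bgChar θ (ω / μ * q l)) *
          (gaussChar (ω / μ * q j) - gaussChar (ω / μ * q i)))) := by
  rw [popGrad_eq, popGrad_eq, ← integral_const_mul, ← integral_const_mul, ← integral_const_mul,
    ← integral_const_mul, ← integral_sub]
  · refine integral_congr_ae ?_
    filter_upwards with ω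
    -- Splitting off the other coordinate's factor 1 - θ + θg makes the terms with g_i g_j cancel,
    -- leaving (1 - θ)(g_j - g_i).
    rw [prod_erase_eq hij, prod_erase_eq hij.symm, Finset.erase_right_comm]
    unfold bgChar
    ring
  · refine ((integrable_gaussChar_mul_prod (μ := μ) (q := q) (j := j) θ
      (Finset.univ.erase j)).const_mul (q i * θ * (q j / μ))).congr ?_
    filter_upwards with ω
    ring
  · refine ((integrable_gaussChar_mul_prod (μ := μ) (q := q) (j := i) θ
      (Finset.univ.erase i)).const_mul (q j * θ * (q i / μ))).congr ?_
    filter_upwards with ω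
    ring

/-- The integrand is nonnegative because the Gaussian characteristic function decreases in |q|. The
factor μ in the mass bound cancels the 1/μ of the formula, and 1 - θ ≥ 1/2. -/
lemma le_popGrad_rotation (hμ : 0 < μ) (hμ1 : μ ≤ 1) (hθ : (θ : ℝ) ≤ 1 / 2)
    (hq : ∑ l, q l ^ 2 = 1) (hij : i ≠ j) (hle : q j ^ 2 ≤ q i ^ 2) :
    ∃ S, θ * massConst * (q i ^ 2 - q j ^ 2) / 4 ≤ S ∧
      q i * popGrad θ μ q j - q j * popGrad θ μ q i = q i * q j * S := by
  refine ⟨_, ?_, popGrad_rotation_eq θ hij⟩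
  have hθ0 := θ.2.1
  set I := ∫ ω, sechDensity ω *
        ((∏ l ∈ (Finset.univ.erase i).erase j, bgChar θ (ω / μ * q l)) *
          (gaussChar (ω / μ * q j) - gaussChar (ω / μ * q i))) with hI
  have key : (q i ^ 2 - q j ^ 2) / 2 * (μ * massConst) ≤ I := by
    refine (mul_le_mul_of_nonneg_left (massConst_le hμ hμ1) (by linarith)).trans ?_
    rw [hI, ← integral_const_mul]
    refine integral_mono ?_ ?_ fun ω => ?_
    · refine Integrable.const_mul ?_ _
      refine integrable_sechDensity_mul_of_le (by fun_prop) (1 / μ ^ 2) fun ω => ?_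
      have h0 := gaussChar_pos (ω / μ)
      have h1 := gaussChar_le_one (ω / μ)
      rw [abs_of_nonneg (by positivity)]
      calc (ω / μ) ^ 2 * gaussChar (ω / μ) ≤ (ω / μ) ^ 2 * 1 := by gcongr
        _ = 1 / μ ^ 2 * ω ^ 2 := by field_simp
        _ ≤ _ := by gcongr; linarith
    · have h1 := integrable_gaussChar_mul_prod (μ := μ) (q := q) (j := j) θ
        ((Finset.univ.erase i).erase j)
      have h2 := integrable_gaussChar_mul_prod (μ := μ) (q := q) (j := i) θ
        ((Finset.univ.erase i).erase j)
      refine (h1.sub h2).congr ?_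
      filter_upwards with ω
      simp only [Pi.sub_apply]
      ring
    · have h1 := gaussChar_sub_ge (a := q i) (b := q j) (w := ω / μ)
      have h2 := gaussChar_le_prod_mul' θ hq hij (ω / μ)
      have h3 := prod_bgChar_nonneg ((Finset.univ.erase i).erase j) θ.2.2 (ω / μ) q
      have h4 : 0 ≤ (q i ^ 2 - q j ^ 2) * (ω / μ) ^ 2 / 2 := by
        have : 0 ≤ q i ^ 2 - q j ^ 2 := by linarith
        positivity
      have h5 := (sechDensity_pos ω).le
      calc (q i ^ 2 - q j ^ 2) / 2 * (sechDensity ω * ((ω / μ) ^ 2 * gaussChar (ω / μ)))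
          = sechDensity ω * (((q i ^ 2 - q j ^ 2) * (ω / μ) ^ 2 / 2) * gaussChar (ω / μ)) := by
            ring
        _ ≤ sechDensity ω * (((q i ^ 2 - q j ^ 2) * (ω / μ) ^ 2 / 2) *
            ((∏ l ∈ (Finset.univ.erase i).erase j, bgChar θ (ω / μ * q l)) *
              gaussChar (ω / μ * q i))) := by gcongr
        _ = sechDensity ω * ((∏ l ∈ (Finset.univ.erase i).erase j, bgChar θ (ω / μ * q l)) *
              (gaussChar (ω / μ * q i) * ((q i ^ 2 - q j ^ 2) * (ω / μ) ^ 2 / 2))) := by ring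
        _ ≤ _ := by gcongr
  have hm := massConst_pos
  have h6 : 0 ≤ q i ^ 2 - q j ^ 2 := by linarith
  calc θ * massConst * (q i ^ 2 - q j ^ 2) / 4
      = θ * (1 / 2) / μ * ((q i ^ 2 - q j ^ 2) / 2 * (μ * massConst)) := by field_simp; ring
    _ ≤ θ * (1 - θ) / μ * ((q i ^ 2 - q j ^ 2) / 2 * (μ * massConst)) := by
        gcongr; linarith
    _ ≤ _ := by
        have : 0 ≤ 1 - (θ : ℝ) := by linarith
        gcongr

lemma integral_rotation_combination {f₁ f₂ f₃ f₄ f₅ : ℝ → ℝ} (h₁ : Integrable f₁)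
    (h₂ : Integrable f₂) (h₃ : Integrable f₃) (h₄ : Integrable f₄) (h₅ : Integrable f₅)
    (c₁ c₂ c₃ m c₄ c₅ : ℝ) :
    Integrable (fun ω => (c₁ * f₁ ω - c₂ * f₂ ω + c₃ * f₃ ω) / m - (c₄ * f₄ ω + c₅ * f₅ ω)) ∧
    ∫ ω, ((c₁ * f₁ ω - c₂ * f₂ ω + c₃ * f₃ ω) / m - (c₄ * f₄ ω + c₅ * f₅ ω)) =
      (c₁ * (∫ ω, f₁ ω) - c₂ * (∫ ω, f₂ ω) + c₃ * ∫ ω, f₃ ω) / m -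
        (c₄ * (∫ ω, f₄ ω) + c₅ * ∫ ω, f₅ ω) := by
  have i₁ := h₁.const_mul c₁
  have i₂ := h₂.const_mul c₂
  have i₃ := h₃.const_mul c₃
  have i₄ := h₄.const_mul c₄
  have i₅ := h₅.const_mul c₅
  have i₁₂ : Integrable fun ω => c₁ * f₁ ω - c₂ * f₂ ω := i₁.sub i₂
  have i₁₂₃ : Integrable fun ω => c₁ * f₁ ω - c₂ * f₂ ω + c₃ * f₃ ω := i₁₂.add i₃
  have i₄₅ : Integrable fun ω => c₄ * f₄ ω + c₅ * f₅ ω := i₄.add i₅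
  refine ⟨(i₁₂₃.div_const m).sub i₄₅, ?_⟩
  rw [integral_sub (i₁₂₃.div_const m) i₄₅, integral_div, integral_add i₁₂ i₃, integral_sub i₁ i₂,
    integral_add i₄ i₅]
  simp only [integral_const_mul]

/-- All terms collapse to a positive weight times (a² - b²)(B - A) - w²a²b²(A + B). The first part
is at most (a² - b²)²w²B/2, and a² ≤ 2b² lets the second part win. The worst case b² = a²/2 gives
3/8, and 1 - t ≥ 1/2 turns it into 3/16. -/
lemma rotation_integrand_le {a b A B P w m t s g : ℝ} (hm : 0 < m) (ht : 0 ≤ t) (ht' : t ≤ 1 / 2)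
    (hle : b ^ 2 ≤ a ^ 2) (hle' : a ^ 2 ≤ 2 * b ^ 2) (hs : 0 ≤ s) (hA : 0 ≤ A) (hB : 0 ≤ B)
    (hP : 0 ≤ P) (hg : 0 ≤ g) (hBA : B * ((b ^ 2 - a ^ 2) * w ^ 2 / 2) ≤ A - B)
    (hPB : g ≤ P * B) :
    (a ^ 2 * (s * (t * (1 - (w * b) ^ 2) * B * ((1 - t + t * A) * P))) -
      2 * (a * b) * (s * -(t ^ 2 * (w * a) * (w * b) * A * B * P)) +
      b ^ 2 * (s * (t * (1 - (w * a) ^ 2) * A * ((1 - t + t * B) * P)))) / m -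
      (a * (s * (t * (a / m) * A * ((1 - t + t * B) * P))) +
      b * (s * (t * (b / m) * B * ((1 - t + t * A) * P)))) ≤
    -(3 / 16 * t * a ^ 4 / m) * (s * (w ^ 2 * g)) := by
  have e : (a ^ 2 * (s * (t * (1 - (w * b) ^ 2) * B * ((1 - t + t * A) * P))) -
      2 * (a * b) * (s * -(t ^ 2 * (w * a) * (w * b) * A * B * P)) +
      b ^ 2 * (s * (t * (1 - (w * a) ^ 2) * A * ((1 - t + t * B) * P)))) / m -
      (a * (s * (t * (a / m) * A * ((1 - t + t * B) * P))) +
      b * (s * (t * (b / m) * B * ((1 - t + t * A) * P)))) =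
      t * (1 - t) / m * s * P *
        ((a ^ 2 - b ^ 2) * (B - A) - w ^ 2 * a ^ 2 * b ^ 2 * (A + B)) := by
    ring
  rw [e]
  have h1 : (a ^ 2 - b ^ 2) * (B - A) - w ^ 2 * a ^ 2 * b ^ 2 * (A + B) ≤
      -(3 / 8 * a ^ 4 * (w ^ 2 * B)) := by
    have i0 : B - A ≤ B * ((a ^ 2 - b ^ 2) * w ^ 2 / 2) := by linarith
    have i1 : (a ^ 2 - b ^ 2) * (B - A) ≤
        (a ^ 2 - b ^ 2) * (B * ((a ^ 2 - b ^ 2) * w ^ 2 / 2)) :=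
      mul_le_mul_of_nonneg_left i0 (by linarith)
    have i2 : 0 ≤ w ^ 2 * a ^ 2 * b ^ 2 * A := by positivity
    have i3 : (a ^ 2 - b ^ 2) ^ 2 / 2 - a ^ 2 * b ^ 2 ≤ -(3 / 8 * a ^ 4) := by nlinarith
    have i4 : 0 ≤ w ^ 2 * B := by positivity
    have i5 := mul_le_mul_of_nonneg_right i3 i4
    linarith
  have ht1 : 0 ≤ 1 - t := by linarith
  have hc : 0 ≤ t * (1 - t) / m * s * P := by positivity
  refine (mul_le_mul_of_nonneg_left h1 hc).trans ?_
  have h2 : t * (1 / 2) / m * s * (3 / 8 * a ^ 4 * w ^ 2) * g ≤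
      t * (1 - t) / m * s * (3 / 8 * a ^ 4 * w ^ 2) * (P * B) := by
    gcongr
    linarith
  calc _ = -(t * (1 - t) / m * s * (3 / 8 * a ^ 4 * w ^ 2) * (P * B)) := by ring
    _ ≤ -(t * (1 / 2) / m * s * (3 / 8 * a ^ 4 * w ^ 2) * g) := neg_le_neg h2
    _ = _ := by ring

/-- The population curvature along the rotation of two large coordinates is negative. -/
lemma popHess_rotation_le (hμ : 0 < μ) (hμ1 : μ ≤ 1) (hθ : (θ : ℝ) ≤ 1 / 2)
    (hq : ∑ l, q l ^ 2 = 1) (hij : i ≠ j) (hle : q j ^ 2 ≤ q i ^ 2)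
    (hle' : q i ^ 2 ≤ 2 * q j ^ 2) :
    (q i ^ 2 * popHess θ μ q j j - 2 * (q i * q j) * popHess θ μ q i j +
        q j ^ 2 * popHess θ μ q i i) / μ -
      (q i * popGrad θ μ q i + q j * popGrad θ μ q j) ≤ -(3 / 16 * θ * massConst * q i ^ 4) := by
  set P : ℝ → ℝ := fun ω => ∏ l ∈ (Finset.univ.erase i).erase j, bgChar θ (ω / μ * q l) with hP
  set A : ℝ → ℝ := fun ω => gaussChar (ω / μ * q i) with hA
  set B : ℝ → ℝ := fun ω => gaussChar (ω / μ * q j) with hB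
  have hPc : Continuous P := by fun_prop
  have hAc : Continuous A := by fun_prop
  have hBc : Continuous B := by fun_prop
  have hA0 : ∀ ω, 0 < A ω := fun ω => gaussChar_pos _
  have hB0 : ∀ ω, 0 < B ω := fun ω => gaussChar_pos _
  have hA1 : ∀ ω, A ω ≤ 1 := fun ω => gaussChar_le_one _
  have hB1 : ∀ ω, B ω ≤ 1 := fun ω => gaussChar_le_one _
  have hP0 : ∀ ω, 0 ≤ P ω := fun ω => prod_bgChar_nonneg _ θ.2.2 _ _
  have hP1 : ∀ ω, P ω ≤ 1 := fun ω => prod_bgChar_le_one _ θ.2.1 θ.2.2 _ _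
  have hθ0 := θ.2.1
  have hθ1 := θ.2.2
  have hI : ∀ (c d : ℝ) (Y : ℝ → ℝ), Continuous Y → (∀ ω, 0 ≤ Y ω) → (∀ ω, Y ω ≤ 1) →
      Integrable fun ω => sechDensity ω * ((c + d * ω ^ 2) * (Y ω * P ω)) := by
    intro c d Y hY h0 h1
    refine integrable_sechDensity_mul_of_le (by fun_prop) (|c| + |d|) fun ω => ?_
    rw [abs_mul]
    calc |c + d * ω ^ 2| * |Y ω * P ω| ≤ (|c| + |d| * ω ^ 2) * 1 := by
          gcongr
          · refine (abs_add_le _ _).trans ?_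
            rw [abs_mul, abs_of_nonneg (sq_nonneg ω)]
          · exact abs_mul_le_one (h0 ω) (h1 ω) (hP0 ω) (hP1 ω)
      _ ≤ _ := by nlinarith [abs_nonneg c, abs_nonneg d, sq_nonneg ω,
          mul_nonneg (abs_nonneg c) (sq_nonneg ω)]
  have e_ii : popHess θ μ q i i = ∫ ω, sechDensity ω * (θ * (1 - (ω / μ * q i) ^ 2) *
      A ω * ((1 - θ + θ * B ω) * P ω)) := by
    rw [popHess_self_eq]
    congr 1; ext ω
    rw [prod_erase_eq hij.symm, Finset.erase_right_comm]
    rfl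
  have e_jj : popHess θ μ q j j = ∫ ω, sechDensity ω * (θ * (1 - (ω / μ * q j) ^ 2) *
      B ω * ((1 - θ + θ * A ω) * P ω)) := by
    rw [popHess_self_eq]
    congr 1; ext ω
    rw [prod_erase_eq hij]
    rfl
  have e_ij : popHess θ μ q i j = ∫ ω, sechDensity ω * -(θ ^ 2 * (ω / μ * q i) * (ω / μ * q j) *
      A ω * B ω * P ω) := popHess_eq θ μ q hij
  have g_i : popGrad θ μ q i = ∫ ω, sechDensity ω * (θ * (q i / μ) * A ω *
      ((1 - θ + θ * B ω) * P ω)) := by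
    rw [popGrad_eq]
    congr 1; ext ω
    rw [prod_erase_eq hij.symm, Finset.erase_right_comm]
    rfl
  have g_j : popGrad θ μ q j = ∫ ω, sechDensity ω * (θ * (q j / μ) * B ω *
      ((1 - θ + θ * A ω) * P ω)) := by
    rw [popGrad_eq]
    congr 1; ext ω
    rw [prod_erase_eq hij]
    rfl
  have hY : ∀ Z : ℝ → ℝ, (∀ ω, 0 < Z ω) → (∀ ω, Z ω ≤ 1) →
      (∀ ω, 0 ≤ 1 - (θ : ℝ) + θ * Z ω) ∧ ∀ ω, 1 - (θ : ℝ) + θ * Z ω ≤ 1 := by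
    intro Z h0 h1
    constructor <;> intro ω <;> nlinarith [h0 ω, h1 ω, mul_nonneg hθ0 (h0 ω).le]
  have hYB := hY B hB0 hB1
  have hYA := hY A hA0 hA1
  have mul1 : ∀ {a b : ℝ}, 0 ≤ a → a ≤ 1 → 0 ≤ b → b ≤ 1 → a * b ≤ 1 := by
    intro a b h0 h1 h2 h3; nlinarith
  have i_ii : Integrable fun ω => sechDensity ω * (θ * (1 - (ω / μ * q i) ^ 2) *
      A ω * ((1 - θ + θ * B ω) * P ω)) := by
    refine (hI θ (-θ * (q i / μ) ^ 2) (fun ω => A ω * (1 - θ + θ * B ω)) (by fun_prop)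
      (fun ω => mul_nonneg (hA0 ω).le (hYB.1 ω))
      (fun ω => mul1 (hA0 ω).le (hA1 ω) (hYB.1 ω) (hYB.2 ω))).congr ?_
    filter_upwards with ω
    ring
  have i_jj : Integrable fun ω => sechDensity ω * (θ * (1 - (ω / μ * q j) ^ 2) *
      B ω * ((1 - θ + θ * A ω) * P ω)) := by
    refine (hI θ (-θ * (q j / μ) ^ 2) (fun ω => B ω * (1 - θ + θ * A ω)) (by fun_prop)
      (fun ω => mul_nonneg (hB0 ω).le (hYA.1 ω))
      (fun ω => mul1 (hB0 ω).le (hB1 ω) (hYA.1 ω) (hYA.2 ω))).congr ?_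
    filter_upwards with ω
    ring
  have i_ij : Integrable fun ω => sechDensity ω * -(θ ^ 2 * (ω / μ * q i) * (ω / μ * q j) *
      A ω * B ω * P ω) := by
    refine (hI 0 (-θ ^ 2 * (q i / μ) * (q j / μ)) (fun ω => A ω * B ω) (by fun_prop)
      (fun ω => mul_nonneg (hA0 ω).le (hB0 ω).le)
      (fun ω => mul1 (hA0 ω).le (hA1 ω) (hB0 ω).le (hB1 ω))).congr ?_
    filter_upwards with ω
    ring
  have j_i : Integrable fun ω => sechDensity ω * (θ * (q i / μ) * A ω *
      ((1 - θ + θ * B ω) * P ω)) := by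
    refine (hI (θ * (q i / μ)) 0 (fun ω => A ω * (1 - θ + θ * B ω)) (by fun_prop)
      (fun ω => mul_nonneg (hA0 ω).le (hYB.1 ω))
      (fun ω => mul1 (hA0 ω).le (hA1 ω) (hYB.1 ω) (hYB.2 ω))).congr ?_
    filter_upwards with ω
    ring
  have j_j : Integrable fun ω => sechDensity ω * (θ * (q j / μ) * B ω *
      ((1 - θ + θ * A ω) * P ω)) := by
    refine (hI (θ * (q j / μ)) 0 (fun ω => B ω * (1 - θ + θ * A ω)) (by fun_prop)
      (fun ω => mul_nonneg (hB0 ω).le (hYA.1 ω))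
      (fun ω => mul1 (hB0 ω).le (hB1 ω) (hYA.1 ω) (hYA.2 ω))).congr ?_
    filter_upwards with ω
    ring
  have hmass : Integrable fun ω => sechDensity ω * ((ω / μ) ^ 2 * gaussChar (ω / μ)) := by
    refine integrable_sechDensity_mul_of_le (by fun_prop) (1 / μ ^ 2) fun ω => ?_
    have h0 := gaussChar_pos (ω / μ)
    have h1 := gaussChar_le_one (ω / μ)
    rw [abs_of_nonneg (by positivity)]
    calc (ω / μ) ^ 2 * gaussChar (ω / μ) ≤ (ω / μ) ^ 2 * 1 := by gcongr
      _ = 1 / μ ^ 2 * ω ^ 2 := by field_simp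
      _ ≤ _ := by gcongr; linarith
  have hm := massConst_le hμ hμ1
  have hpos := massConst_pos
  obtain ⟨hint, heq⟩ := integral_rotation_combination i_jj i_ij i_ii j_i j_j
    (q i ^ 2) (2 * (q i * q j)) (q j ^ 2) μ (q i) (q j)
  rw [e_ii, e_jj, e_ij, g_i, g_j, ← heq]
  calc _ ≤ ∫ ω, -(3 / 16 * θ * q i ^ 4 / μ) *
        (sechDensity ω * ((ω / μ) ^ 2 * gaussChar (ω / μ))) := by
        refine integral_mono hint (hmass.const_mul _) fun ω => ?_
        have hBA := gaussChar_sub_ge (a := q j) (b := q i) (w := ω / μ)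
        exact rotation_integrand_le hμ hθ0 hθ hle hle' (sechDensity_pos ω).le (hA0 ω).le (hB0 ω).le
          (hP0 ω) (gaussChar_pos (ω / μ)).le hBA (gaussChar_le_prod_mul θ hq hij (ω / μ))
    _ = -(3 / 16 * θ * q i ^ 4 / μ) * ∫ ω, sechDensity ω * ((ω / μ) ^ 2 * gaussChar (ω / μ)) := by
        rw [integral_const_mul]
    _ ≤ _ := by
        have h4 : 0 ≤ 3 / 16 * θ * q i ^ 4 / μ := by positivity
        have := mul_le_mul_of_nonneg_left hm h4
        have e : 3 / 16 * θ * q i ^ 4 / μ * (μ * massConst) =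
          3 / 16 * θ * massConst * q i ^ 4 := by field_simp
        linarith

end

/-! ### The population Hessian near a basis vector -/

/-- The second moment of `sechDensity`. -/
noncomputable def hessConst : ℝ := ∫ ω, sechDensity ω * ω ^ 2

lemma integrable_sechDensity_mul_sq : Integrable fun ω => sechDensity ω * ω ^ 2 :=
  integrable_sechDensity_mul_of_le (by fun_prop) 1 fun ω => by
    rw [abs_of_nonneg (sq_nonneg ω)]; nlinarith

lemma hessConst_nonneg : 0 ≤ hessConst :=
  integral_nonneg fun ω => mul_nonneg (sechDensity_pos ω).le (sq_nonneg ω)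

section
variable {n : ℕ} (θ : unitInterval) (μ : ℝ) (q : Fin n → ℝ)

/-- The formula carries the factor q_j. At a basis vector the off-axis gradient is therefore
centred, and can be bounded at the scale of pure noise. -/
lemma popGrad_eq_zero {j : Fin n} (h : q j = 0) : popGrad θ μ q j = 0 := by
  rw [popGrad_eq]; simp [h]

lemma abs_popGrad_le (j : Fin n) : |popGrad θ μ q j| ≤ 1 := by
  have hi : Integrable (fun x : Fin n → ℝ => (1 + x j ^ 2) / 2) (bgVec θ n) := by
    have := integrable_mul_bgVec θ j j
    simp_rw [← pow_two] at this
    exact ((integrable_const 1).add this).div_const 2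
  unfold popGrad
  rw [← Real.norm_eq_abs]
  refine (norm_integral_le_of_norm_le hi ?_).trans ?_
  · filter_upwards with x
    rw [norm_mul, Real.norm_eq_abs, Real.norm_eq_abs]
    have h1 := (Real.abs_tanh_lt_one ((∑ l, q l * x l) / μ)).le
    have h2 := abs_nonneg (x j)
    have h3 := sq_abs (x j)
    nlinarith [sq_nonneg (|x j| - 1), mul_le_mul_of_nonneg_right h1 h2]
  · have := integrable_mul_bgVec θ j j
    simp_rw [← pow_two] at this
    rw [integral_div, integral_add (integrable_const 1) this, integral_sq_bgVec]
    have := θ.2.2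
    simp
    linarith

lemma integral_sq_add_sq_div_two (i j : Fin n) :
    Integrable (fun x : Fin n → ℝ => (x i ^ 2 + x j ^ 2) / 2) (bgVec θ n) ∧
      ∫ x, (x i ^ 2 + x j ^ 2) / 2 ∂bgVec θ n = (θ : ℝ) := by
  have h : ∀ l : Fin n, Integrable (fun x : Fin n → ℝ => x l ^ 2) (bgVec θ n) := fun l => by
    simpa only [pow_two] using integrable_mul_bgVec θ l l
  have hs : Integrable (fun x : Fin n → ℝ => x i ^ 2 + x j ^ 2) (bgVec θ n) := (h i).add (h j)
  refine ⟨hs.div_const 2, ?_⟩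
  rw [integral_div, integral_add (h i) (h j), integral_sq_bgVec, integral_sq_bgVec]
  ring

lemma abs_popHess_le (i j : Fin n) : |popHess θ μ q i j| ≤ θ := by
  unfold popHess
  rw [← Real.norm_eq_abs, ← (integral_sq_add_sq_div_two θ i j).2]
  refine norm_integral_le_of_norm_le (integral_sq_add_sq_div_two θ i j).1 ?_
  filter_upwards with x
  rw [norm_mul, Real.norm_of_nonneg (sechSq_pos _).le, Real.norm_eq_abs]
  have h1 := sechSq_le_one ((∑ l, q l * x l) / μ)
  have h2 := abs_nonneg (x i * x j)
  have h3 : |x i * x j| ≤ (x i ^ 2 + x j ^ 2) / 2 := by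
    rw [abs_le]
    constructor <;> nlinarith [sq_nonneg (x i + x j), sq_nonneg (x i - x j)]
  nlinarith [mul_le_mul_of_nonneg_right h1 h2]

lemma popHess_self_nonneg (i : Fin n) : 0 ≤ popHess θ μ q i i :=
  integral_nonneg fun _ => mul_nonneg (sechSq_pos _).le (mul_self_nonneg _)

variable {θ μ q}

/-- Off-diagonal entries carry the factor ω² q_i q_j / μ², which is integrated against the second
moment of the density. -/
lemma abs_popHess_le_of_small {r : ℝ} {i j : Fin n} (hij : i ≠ j)
    (hi : |q i / μ| ≤ r) (hj : |q j / μ| ≤ r) :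
    |popHess θ μ q i j| ≤ θ * (r ^ 2 * hessConst) := by
  have hr : 0 ≤ r := (abs_nonneg _).trans hi
  rw [popHess_eq θ μ q hij, ← Real.norm_eq_abs]
  have e : θ * (r ^ 2 * hessConst) = ∫ ω, (θ * r ^ 2) * (sechDensity ω * ω ^ 2) := by
    rw [integral_const_mul, hessConst]; ring
  rw [e]
  refine norm_integral_le_of_norm_le (integrable_sechDensity_mul_sq.const_mul _) ?_
  filter_upwards with ω
  have hθ0 := θ.2.1
  have hθ1 := θ.2.2
  have hS := (sechDensity_pos ω).le
  have h1 := gaussChar_le_one (ω / μ * q i)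
  have h2 := gaussChar_le_one (ω / μ * q j)
  have h1' := (gaussChar_pos (ω / μ * q i)).le
  have h2' := (gaussChar_pos (ω / μ * q j)).le
  have h3 := prod_bgChar_le_one ((Finset.univ.erase i).erase j) hθ0 hθ1 (ω / μ) q
  have h3' := prod_bgChar_nonneg ((Finset.univ.erase i).erase j) hθ1 (ω / μ) q
  set P := ∏ l ∈ (Finset.univ.erase i).erase j, bgChar θ (ω / μ * q l)
  have e2 : sechDensity ω * -(θ ^ 2 * (ω / μ * q i) * (ω / μ * q j) *
      gaussChar (ω / μ * q i) * gaussChar (ω / μ * q j) * P) =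
      -(sechDensity ω * ω ^ 2 * θ ^ 2 * ((q i / μ) * (q j / μ)) *
        (gaussChar (ω / μ * q i) * gaussChar (ω / μ * q j) * P)) := by ring
  rw [e2, norm_neg, norm_mul, norm_mul, Real.norm_of_nonneg (by positivity : 0 ≤
    sechDensity ω * ω ^ 2 * (θ : ℝ) ^ 2), Real.norm_of_nonneg (by positivity : 0 ≤
    gaussChar (ω / μ * q i) * gaussChar (ω / μ * q j) * P), Real.norm_eq_abs, abs_mul]
  calc sechDensity ω * ω ^ 2 * (θ : ℝ) ^ 2 * (|q i / μ| * |q j / μ|) *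
        (gaussChar (ω / μ * q i) * gaussChar (ω / μ * q j) * P)
      ≤ sechDensity ω * ω ^ 2 * (θ : ℝ) ^ 2 * (r * r) * (1 * 1 * 1) := by gcongr
    _ ≤ sechDensity ω * ω ^ 2 * (θ * 1) * (r * r) * (1 * 1 * 1) := by
        rw [pow_two (θ : ℝ)]; gcongr
    _ = _ := by ring

/-- The factor of coordinate i, on whose size nothing is assumed, is still at least 1 - θ ≥ 1/2. The
remaining coordinates are small and cost at most nr²ω²/2. Integration leaves 1/2 minus (5/4)(1/10) =
1/8. -/
lemma popHess_self_ge_of_small {r : ℝ} {i j : Fin n} (hij : i ≠ j) (hθ : (θ : ℝ) ≤ 1 / 2)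
    (hr1 : n * r ^ 2 * hessConst ≤ 1 / 10) (h : ∀ l ≠ i, |q l / μ| ≤ r) :
    3 / 8 * θ ≤ popHess θ μ q j j := by
  have hθ0 := θ.2.1
  have hθ1 := θ.2.2
  have hn : (1 : ℝ) ≤ n := by exact_mod_cast Fin.pos i
  rw [popHess_self_eq]
  have hC := hessConst_nonneg
  have hrr : r ^ 2 * hessConst ≤ n * r ^ 2 * hessConst := by
    have := mul_nonneg (sq_nonneg r) hC
    nlinarith
  have hmono : ∫ ω, (θ / 2 * sechDensity ω -
      θ * (n * r ^ 2 / 4 + r ^ 2) * (sechDensity ω * ω ^ 2)) ≤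
      ∫ ω, sechDensity ω * (θ * (1 - (ω / μ * q j) ^ 2) *
      gaussChar (ω / μ * q j) * ∏ l ∈ Finset.univ.erase j, bgChar θ (ω / μ * q l)) := by
    have hint : Integrable fun ω => sechDensity ω * (θ * (1 - (ω / μ * q j) ^ 2) *
      gaussChar (ω / μ * q j) * ∏ l ∈ Finset.univ.erase j, bgChar θ (ω / μ * q l)) := by
      refine integrable_sechDensity_mul_of_le (by fun_prop) (1 + (q j / μ) ^ 2) fun ω => ?_
      rw [mul_assoc, abs_mul]
      have h1 := abs_mul_le_one (gaussChar_pos (ω / μ * q j)).le (gaussChar_le_one _)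
        (prod_bgChar_nonneg (Finset.univ.erase j) hθ1 (ω / μ) q)
        (prod_bgChar_le_one (Finset.univ.erase j) hθ0 hθ1 (ω / μ) q)
      have h2 : |θ * (1 - (ω / μ * q j) ^ 2)| ≤ 1 + (ω / μ * q j) ^ 2 := by
        rw [abs_mul, abs_of_nonneg hθ0]
        have : |1 - (ω / μ * q j) ^ 2| ≤ 1 + (ω / μ * q j) ^ 2 := by
          rw [abs_le]; constructor <;> nlinarith [sq_nonneg (ω / μ * q j)]
        nlinarith [abs_nonneg (1 - (ω / μ * q j) ^ 2)]
      calc _ ≤ (1 + (ω / μ * q j) ^ 2) * 1 := by gcongr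
        _ = 1 + (q j / μ) ^ 2 * ω ^ 2 := by ring
        _ ≤ _ := by nlinarith [sq_nonneg (q j / μ), sq_nonneg ω]
    refine integral_mono ((integrable_sechDensity.const_mul _).sub
      (integrable_sechDensity_mul_sq.const_mul _)) hint fun ω => ?_
    simp only
    have hS := (sechDensity_pos ω).le
    have hprod : (1 / 2) * (1 - n * r ^ 2 * ω ^ 2 / 2) ≤
        gaussChar (ω / μ * q j) * ∏ l ∈ Finset.univ.erase j, bgChar θ (ω / μ * q l) := by
      rw [prod_erase_eq hij]
      have h1 : 1 / 2 ≤ bgChar θ (ω / μ * q i) := by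
        have := gaussChar_pos (ω / μ * q i)
        unfold bgChar; nlinarith
      have h2 := prod_gaussChar_le_prod_bgChar ((Finset.univ.erase i).erase j) hθ1 (ω / μ) q
      have h3 : gaussChar (ω / μ * q j) * Real.exp (-((ω / μ) ^ 2 *
          ∑ l ∈ (Finset.univ.erase i).erase j, q l ^ 2) / 2) =
          Real.exp (-((ω / μ) ^ 2 * ∑ l ∈ Finset.univ.erase i, q l ^ 2) / 2) := by
        rw [← Finset.add_sum_erase (Finset.univ.erase i) (fun l => q l ^ 2)
          (Finset.mem_erase.2 ⟨hij.symm, Finset.mem_univ j⟩)]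
        unfold gaussChar
        rw [← Real.exp_add]
        congr 1
        ring
      have h4 : (ω / μ) ^ 2 * ∑ l ∈ Finset.univ.erase i, q l ^ 2 ≤ n * r ^ 2 * ω ^ 2 := by
        have : ∀ l ∈ Finset.univ.erase i, (q l / μ) ^ 2 ≤ r ^ 2 := fun l hl =>
          sq_le_sq' (by linarith [neg_abs_le (q l / μ), h l (Finset.ne_of_mem_erase hl)])
            ((le_abs_self _).trans (h l (Finset.ne_of_mem_erase hl)))
        have h5 := Finset.sum_le_card_nsmul _ _ _ this
        have hc : ((Finset.univ.erase i).card : ℝ) ≤ n := by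
          have := Finset.card_le_univ (Finset.univ.erase i)
          rw [Fintype.card_fin] at this
          exact_mod_cast this
        rw [nsmul_eq_mul] at h5
        calc (ω / μ) ^ 2 * ∑ l ∈ Finset.univ.erase i, q l ^ 2
            = ω ^ 2 * ∑ l ∈ Finset.univ.erase i, (q l / μ) ^ 2 := by
              rw [Finset.mul_sum, Finset.mul_sum]
              refine Finset.sum_congr rfl fun l _ => ?_
              ring
          _ ≤ ω ^ 2 * (n * r ^ 2) := by
              gcongr
              exact h5.trans (by gcongr)
          _ = _ := by ring
      have h6 : 1 - n * r ^ 2 * ω ^ 2 / 2 ≤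
          Real.exp (-((ω / μ) ^ 2 * ∑ l ∈ Finset.univ.erase i, q l ^ 2) / 2) := by
        have := Real.add_one_le_exp (-((ω / μ) ^ 2 * ∑ l ∈ Finset.univ.erase i, q l ^ 2) / 2)
        linarith
      have h7 := Real.exp_pos (-((ω / μ) ^ 2 * ∑ l ∈ Finset.univ.erase i, q l ^ 2) / 2)
      have h8 := (gaussChar_pos (ω / μ * q j)).le
      calc (1 / 2) * (1 - n * r ^ 2 * ω ^ 2 / 2) ≤ (1 / 2) *
            (gaussChar (ω / μ * q j) * Real.exp (-((ω / μ) ^ 2 *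
          ∑ l ∈ (Finset.univ.erase i).erase j, q l ^ 2) / 2)) := by rw [h3]; linarith
        _ ≤ bgChar θ (ω / μ * q i) * (gaussChar (ω / μ * q j) *
            ∏ l ∈ (Finset.univ.erase i).erase j, bgChar θ (ω / μ * q l)) := by
            gcongr
        _ = _ := by ring
    have hle1 : gaussChar (ω / μ * q j) * ∏ l ∈ Finset.univ.erase j, bgChar θ (ω / μ * q l) ≤ 1 :=
      (le_abs_self _).trans (abs_mul_le_one (gaussChar_pos (ω / μ * q j)).le (gaussChar_le_one _)
        (prod_bgChar_nonneg (Finset.univ.erase j) hθ1 (ω / μ) q)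
        (prod_bgChar_le_one (Finset.univ.erase j) hθ0 hθ1 (ω / μ) q))
    set Y := gaussChar (ω / μ * q j) * ∏ l ∈ Finset.univ.erase j, bgChar θ (ω / μ * q l)
    have ht : (ω / μ * q j) ^ 2 ≤ r ^ 2 * ω ^ 2 := by
      have : (q j / μ) ^ 2 ≤ r ^ 2 := sq_le_sq'
        (by linarith [neg_abs_le (q j / μ), h j hij.symm]) ((le_abs_self _).trans (h j hij.symm))
      calc (ω / μ * q j) ^ 2 = (q j / μ) ^ 2 * ω ^ 2 := by ring
        _ ≤ _ := by gcongr
    have hY : 1 / 2 - (n * r ^ 2 / 4 + r ^ 2) * ω ^ 2 ≤ (1 - (ω / μ * q j) ^ 2) * Y := by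
      have : (ω / μ * q j) ^ 2 * Y ≤ (ω / μ * q j) ^ 2 * 1 :=
        mul_le_mul_of_nonneg_left hle1 (sq_nonneg _)
      nlinarith
    calc _ = (θ * sechDensity ω) * (1 / 2 - (n * r ^ 2 / 4 + r ^ 2) * ω ^ 2) := by ring
      _ ≤ (θ * sechDensity ω) * ((1 - (ω / μ * q j) ^ 2) * Y) := by gcongr
      _ = _ := by ring
  refine le_trans ?_ hmono
  rw [integral_sub (integrable_sechDensity.const_mul _)
    (integrable_sechDensity_mul_sq.const_mul _), integral_const_mul, integral_const_mul,
    integral_sechDensity]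
  change _ ≤ (θ : ℝ) / 2 * 1 - θ * ((n : ℝ) * r ^ 2 / 4 + r ^ 2) * hessConst
  have : (n * r ^ 2 / 4 + r ^ 2) * hessConst ≤ 1 / 8 := by linarith
  nlinarith

/-- Near the basis vector `eᵢ` the population Hessian is positive definite on directions which are
almost orthogonal to `eᵢ`. -/
lemma popHess_quadratic_ge {r : ℝ} (i : Fin n) (hθ : (θ : ℝ) ≤ 1 / 2)
    (hr1 : n * r ^ 2 * hessConst ≤ 1 / 10) (h : ∀ l ≠ i, |q l / μ| ≤ r) (d : Fin n → ℝ)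
    (hd : |d i| * ∑ j ∈ Finset.univ.erase i, |d j| ≤
      1 / 40 * ∑ j ∈ Finset.univ.erase i, d j ^ 2) :
    θ / 8 * ∑ j ∈ Finset.univ.erase i, d j ^ 2 ≤ ∑ j, ∑ l, popHess θ μ q j l * (d j * d l) := by
  have hθ0 := θ.2.1
  set e : Fin n → ℝ := fun j => if j = i then 0 else |d j| with he
  set K := θ * (r ^ 2 * hessConst) with hK
  have hC := hessConst_nonneg
  have hK0 : 0 ≤ K := by positivity
  have he0 : ∀ j, 0 ≤ e j := fun j => by rw [he]; dsimp only; split_ifs <;> positivity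
  have hei : e i = 0 := by simp [he]
  have hej : ∀ j ≠ i, e j = |d j| := fun j hj => by simp [he, hj]
  -- Entry by entry: 3θ/8 on the diagonal, the small bound K off it, and only the trivial bound θ in
  -- row and column i. After summation the losses are θ/10 (Cauchy–Schwarz) and 2θ/40 (`hd`), which
  -- leaves more than θ/8.
  have hentry : ∀ j l, (if j = l then 3 / 8 * θ * e j ^ 2 else 0) - K * (e j * e l) -
      θ * |d i| * ((if j = i then e l else 0) + (if l = i then e j else 0)) ≤
      popHess θ μ q j l * (d j * d l) := by
    intro j l
    by_cases hj : j = i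
    · by_cases hl : l = i
      · subst hj; subst hl
        simp only [hei, if_true]
        have := mul_nonneg (popHess_self_nonneg θ μ q l) (mul_self_nonneg (d l))
        linarith
      · subst hj
        have h1 := abs_popHess_le θ μ q j l
        have h2 : |popHess θ μ q j l * (d j * d l)| ≤ θ * (|d j| * |d l|) := by
          rw [abs_mul, abs_mul]; gcongr
        rw [if_neg (fun h => hl h.symm), if_pos rfl, if_neg hl, hei, hej l hl]
        have := neg_abs_le (popHess θ μ q j l * (d j * d l))
        linarith
    · by_cases hl : l = i
      · subst hl
        have h1 := abs_popHess_le θ μ q j l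
        have h2 : |popHess θ μ q j l * (d j * d l)| ≤ θ * (|d j| * |d l|) := by
          rw [abs_mul, abs_mul]; gcongr
        rw [if_neg hj, if_neg hj, if_pos rfl, hei, hej j hj]
        have := neg_abs_le (popHess θ μ q j l * (d j * d l))
        linarith
      · rw [if_neg hj, if_neg hl, hej j hj, hej l hl]
        by_cases hjl : j = l
        · subst hjl
          rw [if_pos rfl, sq_abs]
          have h1 := popHess_self_ge_of_small (Ne.symm hj) hθ hr1 h
          have h2 : 0 ≤ K * (|d j| * |d j|) := by positivity
          nlinarith [mul_le_mul_of_nonneg_right h1 (sq_nonneg (d j))]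
        · rw [if_neg hjl]
          have h1 := abs_popHess_le_of_small (θ := θ) hjl (h j hj) (h l hl)
          have h2 : |popHess θ μ q j l * (d j * d l)| ≤ K * (|d j| * |d l|) := by
            rw [abs_mul, abs_mul]; gcongr
          have := neg_abs_le (popHess θ μ q j l * (d j * d l))
          linarith
  have hsum := Finset.sum_le_sum fun j (_ : j ∈ Finset.univ) =>
    Finset.sum_le_sum fun l (_ : l ∈ Finset.univ) => hentry j l
  refine le_trans ?_ hsum
  have s1 : ∑ j, e j ^ 2 = ∑ j ∈ Finset.univ.erase i, d j ^ 2 := by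
    rw [← Finset.add_sum_erase _ _ (Finset.mem_univ i), hei]
    simp only [ne_eq, OfNat.ofNat_ne_zero, not_false_eq_true, zero_pow, zero_add]
    refine Finset.sum_congr rfl fun j hj => ?_
    rw [hej j (Finset.ne_of_mem_erase hj), sq_abs]
  have s2 : ∑ j, e j = ∑ j ∈ Finset.univ.erase i, |d j| := by
    rw [← Finset.add_sum_erase _ _ (Finset.mem_univ i), hei, zero_add]
    refine Finset.sum_congr rfl fun j hj => ?_
    rw [hej j (Finset.ne_of_mem_erase hj)]
  have s3 : (∑ j, e j) ^ 2 ≤ n * ∑ j, e j ^ 2 := by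
    have := sq_sum_le_card_mul_sum_sq (s := Finset.univ) (f := e)
    simpa using this
  have total : ∑ j, ∑ l, ((if j = l then 3 / 8 * θ * e j ^ 2 else 0) - K * (e j * e l) -
      θ * |d i| * ((if j = i then e l else 0) + (if l = i then e j else 0))) =
      3 / 8 * θ * ∑ j, e j ^ 2 - K * (∑ j, e j) ^ 2 - θ * |d i| * (2 * ∑ j, e j) := by
    simp only [Finset.sum_sub_distrib, ← Finset.mul_sum, Finset.sum_add_distrib]
    simp only [Finset.sum_ite_eq, Finset.mem_univ, if_true, ← Finset.mul_sum]
    have a1 : ∑ j, ∑ l, (if j = i then e l else 0) = ∑ j, e j := by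
      rw [Finset.sum_comm]; simp
    have a2 : ∑ j, ∑ l, (if l = i then e j else 0) = ∑ j, e j := by simp
    rw [a1, a2, ← Finset.sum_mul]
    ring
  rw [total]
  rw [← s2, ← s1] at hd
  rw [← s1]
  have hKn : K * (∑ j, e j) ^ 2 ≤ θ * (1 / 10) * ∑ j, e j ^ 2 := by
    have hS : 0 ≤ ∑ j, e j ^ 2 := Finset.sum_nonneg fun j _ => sq_nonneg _
    calc K * (∑ j, e j) ^ 2 ≤ K * (n * ∑ j, e j ^ 2) := by gcongr
      _ = θ * (n * r ^ 2 * hessConst) * ∑ j, e j ^ 2 := by rw [hK]; ring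
      _ ≤ _ := by gcongr
  have h9 := mul_le_mul_of_nonneg_left hd hθ0
  have hS : 0 ≤ θ * ∑ j, e j ^ 2 := mul_nonneg hθ0 (Finset.sum_nonneg fun j _ => sq_nonneg _)
  linarith

end

/-! ### Exponential concentration for functions of the columns -/

section
variable {Ω : Type*} [MeasurableSpace Ω] {P : Measure Ω} [IsProbabilityMeasure P] {n p : ℕ}
  {θ : unitInterval}

/-- The joint law of the entries is a product over pairs; currying it exhibits a product over
columns of products over rows. -/
lemma columns_of_iid {X : Ω → Fin n → Fin p → ℝ}
    (hasLaw : ∀ i k, HasLaw (fun ω => X ω i k) (bernoulliGaussian θ) P)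
    (indep : iIndepFun (fun (e : Fin n × Fin p) ω => X ω e.1 e.2) P) :
    iIndepFun (fun (k : Fin p) ω (i : Fin n) => X ω i k) P ∧
      ∀ k, HasLaw (fun ω (i : Fin n) => X ω i k) (bgVec θ n) P := by
  have hm : ∀ i k, AEMeasurable (fun ω => X ω i k) P := fun i k => (hasLaw i k).aemeasurable
  have hcol : ∀ k : Fin p, AEMeasurable (fun ω (i : Fin n) => X ω i k) P := fun k =>
    aemeasurable_pi_lambda _ fun i => hm i k
  have hlaw : ∀ k, P.map (fun ω (i : Fin n) => X ω i k) = bgVec θ n := by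
    intro k
    have h1 : iIndepFun (fun (i : Fin n) ω => X ω i k) P :=
      indep.precomp (g := fun i => (i, k)) fun a b hab => (Prod.ext_iff.1 hab).1
    rw [iIndepFun_iff_map_fun_eq_pi_map fun i => hm i k] at h1
    rw [h1]
    congr 1
    ext1 i
    exact (hasLaw i k).map_eq
  refine ⟨?_, fun k => ⟨hcol k, hlaw k⟩⟩
  rw [iIndepFun_iff_map_fun_eq_pi_map hcol]
  simp_rw [hlaw]
  have h2 : iIndepFun (fun (s : (_ : Fin p) × Fin n) ω => X ω s.2 s.1) P :=
    indep.precomp (g := fun s : (_ : Fin p) × Fin n => (s.2, s.1)) fun a b hab => by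
      have := Prod.ext_iff.1 hab
      exact Sigma.ext this.2 (heq_of_eq this.1)
  have h3 : AEMeasurable (fun ω (s : (_ : Fin p) × Fin n) => X ω s.2 s.1) P :=
    aemeasurable_pi_lambda _ fun s => hm s.2 s.1
  have h4 := h2.map_fun_eq_infinitePi_map₀ h3
  have h5 : ∀ s : (_ : Fin p) × Fin n, P.map (fun ω => X ω s.2 s.1) = bernoulliGaussian θ :=
    fun s => (hasLaw s.2 s.1).map_eq
  replace h4 : P.map (fun ω (s : (_ : Fin p) × Fin n) => X ω s.2 s.1) =
      Measure.infinitePi fun _ => bernoulliGaussian θ :=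
    h4.trans (congrArg _ (funext fun s => h5 s))
  have h6 := Measure.infinitePi_map_piCurry (ι := Fin p) (κ := fun _ => Fin n)
    (X := fun _ _ => ℝ) fun _ _ => bernoulliGaussian θ
  rw [← h4, AEMeasurable.map_map_of_aemeasurable (MeasurableEquiv.measurable _).aemeasurable h3]
    at h6
  have h7 : (fun _ : Fin p => Measure.infinitePi fun _ : Fin n => bernoulliGaussian θ) =
      fun _ => bgVec θ n := funext fun _ => Measure.infinitePi_eq_pi _
  rw [h7, Measure.infinitePi_eq_pi] at h6
  exact h6

lemma IsIIDBernoulliGaussian.columns {X : Ω → Matrix (Fin n) (Fin p) ℝ}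
    (h : IsIIDBernoulliGaussian X θ P) :
    iIndepFun (fun (k : Fin p) ω (i : Fin n) => X ω i k) P ∧
      ∀ k, HasLaw (fun ω (i : Fin n) => X ω i k) (bgVec θ n) P :=
  columns_of_iid (X := X) h.hasLaw h.indep

variable {col : Fin p → Ω → Fin n → ℝ}

lemma measure_sum_ge_le (hind : iIndepFun col P) (hlaw : ∀ k, HasLaw (col k) (bgVec θ n) P)
    {F : (Fin n → ℝ) → ℝ} (hF : Measurable F) {s : ℝ} (hs : 0 ≤ s)
    (hint : Integrable (fun x => Real.exp (s * F x)) (bgVec θ n)) (t : ℝ) :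
    P.real {ω | t ≤ ∑ k, F (col k ω)} ≤
      Real.exp (-s * t) * (∫ x, Real.exp (s * F x) ∂bgVec θ n) ^ p := by
  have hm : ∀ k, AEMeasurable (col k) P := fun k => (hlaw k).aemeasurable
  have hY : iIndepFun (fun k ω => F (col k ω)) P :=
    hind.comp₀ (fun _ => F) hm fun _ => hF.aemeasurable
  have hYm : ∀ k, AEMeasurable (fun ω => F (col k ω)) P := fun k => hF.comp_aemeasurable (hm k)
  have hmgf : ∀ k, mgf (fun ω => F (col k ω)) P s = ∫ x, Real.exp (s * F x) ∂bgVec θ n := by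
    intro k
    rw [← (hlaw k).map_eq, integral_map (hm k) (by fun_prop)]
    rfl
  have h1 := hY.mgf_sum₀ (t := s) hYm Finset.univ
  simp_rw [hmgf] at h1
  rw [Finset.prod_const, Finset.card_univ, Fintype.card_fin] at h1
  have hpos : 0 < mgf (∑ k, fun ω => F (col k ω)) P s := by
    rw [h1]; exact pow_pos (integral_exp_pos hint) p
  have h2 := measure_ge_le_exp_mul_mgf (μ := P) (X := ∑ k, fun ω => F (col k ω)) t hs
    (mgf_pos_iff.1 hpos)
  rw [h1] at h2
  simpa using h2

lemma exp_le_one_add_add_sq (u : ℝ) : Real.exp u ≤ 1 + u + u ^ 2 * Real.exp |u| := by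
  have h := Complex.norm_exp_sub_sum_le_norm_mul_exp (u : ℂ) 2
  have e : Complex.exp u - ∑ m ∈ Finset.range 2, (u : ℂ) ^ m / m.factorial =
      ((Real.exp u - (1 + u) : ℝ) : ℂ) := by
    simp [Finset.sum_range_succ]
  rw [e, Complex.norm_real, Complex.norm_real, Real.norm_eq_abs, Real.norm_eq_abs, sq_abs] at h
  linarith [le_abs_self (Real.exp u - (1 + u))]

/-- For |s| ≤ 1/8 the remainder of the second order expansion of exp(sF) is dominated by s²V²
exp(V/8), so K plays the role of a variance. -/
lemma integral_exp_mul_le {F V : (Fin n → ℝ) → ℝ} (hF : Measurable F) (hFV : ∀ x, |F x| ≤ V x)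
    {K : ℝ} (hV : Integrable (fun x => V x ^ 2 * Real.exp (V x / 8)) (bgVec θ n))
    (hK : ∫ x, V x ^ 2 * Real.exp (V x / 8) ∂bgVec θ n ≤ K) (hFi : Integrable F (bgVec θ n))
    {s : ℝ} (hs : |s| ≤ 1 / 8) :
    Integrable (fun x => Real.exp (s * F x)) (bgVec θ n) ∧
      ∫ x, Real.exp (s * F x) ∂bgVec θ n ≤
        Real.exp (s * ∫ x, F x ∂bgVec θ n + s ^ 2 * K) := by
  have hpt : ∀ x, Real.exp (s * F x) ≤
      1 + s * F x + s ^ 2 * (V x ^ 2 * Real.exp (V x / 8)) := by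
    intro x
    have h1 := exp_le_one_add_add_sq (s * F x)
    have h2 : |s * F x| ≤ V x / 8 := by
      rw [abs_mul]
      have := hFV x
      have h0 := abs_nonneg (F x)
      calc |s| * |F x| ≤ 1 / 8 * V x := by gcongr
        _ = _ := by ring
    have h3 : F x ^ 2 ≤ V x ^ 2 := sq_le_sq' (by linarith [neg_abs_le (F x), hFV x])
      ((le_abs_self _).trans (hFV x))
    refine h1.trans ?_
    have : (s * F x) ^ 2 * Real.exp |s * F x| ≤ s ^ 2 * (V x ^ 2 * Real.exp (V x / 8)) := by
      rw [mul_pow, mul_assoc]; gcongr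
    linarith
  have hi1 : Integrable (fun x => 1 + s * F x) (bgVec θ n) :=
    (integrable_const 1).add (hFi.const_mul s)
  have hi : Integrable (fun x => 1 + s * F x + s ^ 2 * (V x ^ 2 * Real.exp (V x / 8)))
      (bgVec θ n) := hi1.add (hV.const_mul _)
  have hexp : Integrable (fun x => Real.exp (s * F x)) (bgVec θ n) := by
    refine hi.mono' (by fun_prop) ?_
    filter_upwards with x
    rw [Real.norm_of_nonneg (Real.exp_pos _).le]
    exact hpt x
  refine ⟨hexp, ?_⟩
  calc _ ≤ ∫ x, (1 + s * F x + s ^ 2 * (V x ^ 2 * Real.exp (V x / 8))) ∂bgVec θ n :=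
        integral_mono hexp hi hpt
    _ = 1 + s * ∫ x, F x ∂bgVec θ n +
        s ^ 2 * ∫ x, V x ^ 2 * Real.exp (V x / 8) ∂bgVec θ n := by
        rw [integral_add hi1 (hV.const_mul _), integral_add (integrable_const 1)
          (hFi.const_mul s), integral_const_mul, integral_const_mul]
        simp
    _ ≤ s * ∫ x, F x ∂bgVec θ n + s ^ 2 * K + 1 := by
        have := mul_le_mul_of_nonneg_left hK (sq_nonneg s)
        linarith
    _ ≤ _ := Real.add_one_le_exp _

/-- One-sided **Bernstein inequality** for functions with an exponentially integrable envelope. -/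
lemma measure_sum_sub_ge_le (hind : iIndepFun col P) (hlaw : ∀ k, HasLaw (col k) (bgVec θ n) P)
    {F V : (Fin n → ℝ) → ℝ} (hF : Measurable F) (hFV : ∀ x, |F x| ≤ V x)
    {K : ℝ} (hV : Integrable (fun x => V x ^ 2 * Real.exp (V x / 8)) (bgVec θ n))
    (hK : ∫ x, V x ^ 2 * Real.exp (V x / 8) ∂bgVec θ n ≤ K) (hK4 : 4 ≤ K)
    (hFi : Integrable F (bgVec θ n)) {t : ℝ} (ht : 0 ≤ t) (ht1 : t ≤ 1) :
    P.real {ω | p * t ≤ ∑ k, F (col k ω) - p * ∫ x, F x ∂bgVec θ n} ≤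
      Real.exp (-(p * t ^ 2 / (4 * K))) := by
  set m := ∫ x, F x ∂bgVec θ n with hm
  -- This minimizes s²K - st. The conditions t ≤ 1 and K ≥ 4 keep s ≤ 1/8.
  set s := t / (2 * K) with hs
  have hK0 : 0 < K := by linarith
  have hs0 : 0 ≤ s := by positivity
  have hs8 : |s| ≤ 1 / 8 := by
    rw [abs_of_nonneg hs0, hs, div_le_iff₀ (by positivity)]; linarith
  obtain ⟨hint, hle⟩ := integral_exp_mul_le hF hFV hV hK hFi hs8
  have h := measure_sum_ge_le hind hlaw hF hs0 hint (p * t + p * m)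
  have e : {ω | p * t ≤ ∑ k, F (col k ω) - p * m} = {ω | p * t + p * m ≤ ∑ k, F (col k ω)} := by
    ext ω; simp only [Set.mem_ofPred_eq]; constructor <;> intro h <;> linarith
  rw [e]
  refine h.trans ?_
  have h0 : 0 ≤ ∫ x, Real.exp (s * F x) ∂bgVec θ n := integral_nonneg fun _ => (Real.exp_pos _).le
  calc _ ≤ Real.exp (-s * (p * t + p * m)) * (Real.exp (s * m + s ^ 2 * K)) ^ p := by gcongr
    _ = Real.exp (-(p * t ^ 2 / (4 * K))) := by
      rw [← Real.exp_nat_mul, ← Real.exp_add]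
      congr 1
      rw [hs]
      field_simp
      ring

/-- Two-sided **Bernstein inequality**. -/
lemma measure_abs_sum_sub_ge_le (hind : iIndepFun col P)
    (hlaw : ∀ k, HasLaw (col k) (bgVec θ n) P)
    {F V : (Fin n → ℝ) → ℝ} (hF : Measurable F) (hFV : ∀ x, |F x| ≤ V x)
    {K : ℝ} (hV : Integrable (fun x => V x ^ 2 * Real.exp (V x / 8)) (bgVec θ n))
    (hK : ∫ x, V x ^ 2 * Real.exp (V x / 8) ∂bgVec θ n ≤ K) (hK4 : 4 ≤ K)
    (hFi : Integrable F (bgVec θ n)) {t : ℝ} (ht : 0 ≤ t) (ht1 : t ≤ 1) :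
    P.real {ω | p * t ≤ |∑ k, F (col k ω) - p * ∫ x, F x ∂bgVec θ n|} ≤
      2 * Real.exp (-(p * t ^ 2 / (4 * K))) := by
  have h1 := measure_sum_sub_ge_le hind hlaw hF hFV hV hK hK4 hFi ht ht1
  have h2 := measure_sum_sub_ge_le hind hlaw hF.neg (fun x => by simpa using hFV x) hV hK hK4
    hFi.neg ht ht1
  have hsub : {ω | p * t ≤ |∑ k, F (col k ω) - p * ∫ x, F x ∂bgVec θ n|} ⊆
      {ω | p * t ≤ ∑ k, F (col k ω) - p * ∫ x, F x ∂bgVec θ n} ∪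
      {ω | p * t ≤ ∑ k, (-F) (col k ω) - p * ∫ x, (-F) x ∂bgVec θ n} := by
    intro ω hω
    simp only [Set.mem_ofPred_eq, Set.mem_union, Pi.neg_apply, integral_neg,
      Finset.sum_neg_distrib] at hω ⊢
    rcases le_abs.1 hω with h | h
    · exact Or.inl h
    · right; linarith
  refine (measureReal_mono hsub).trans ((measureReal_union_le _ _).trans ?_)
  linarith

end

/-! ### The quadratic envelope -/

/-- An envelope for the monomials `xᵢ` and `xᵢ xⱼ`. -/
noncomputable def envelope {n : ℕ} (i j : Fin n) (x : Fin n → ℝ) : ℝ := 1 + (x i ^ 2 + x j ^ 2) / 2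

section
variable {n : ℕ} (θ : unitInterval) (i j l : Fin n)

lemma one_le_envelope (x : Fin n → ℝ) : 1 ≤ envelope i j x := by
  unfold envelope; linarith [sq_nonneg (x i), sq_nonneg (x j)]

@[fun_prop]
lemma continuous_envelope : Continuous (envelope i j) := by unfold envelope; fun_prop

lemma abs_eval_le_envelope (x : Fin n → ℝ) : |x i| ≤ envelope i i x := by
  unfold envelope
  rw [abs_le]
  constructor <;> nlinarith [sq_nonneg (x i + 1), sq_nonneg (x i - 1)]

lemma abs_mul_le_envelope (x : Fin n → ℝ) : |x i * x j| ≤ envelope i j x := by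
  unfold envelope
  rw [abs_le]
  constructor <;> nlinarith [sq_nonneg (x i + x j), sq_nonneg (x i - x j)]

/-- The additive 1 of the envelope costs exp(1/4) ≤ 2, which is exactly what 2ab ≤ a² + b² allows.
-/
lemma exp_envelope_div_four_le (x : Fin n → ℝ) :
    Real.exp (envelope i j x / 4) ≤ Real.exp (x i ^ 2 / 4) + Real.exp (x j ^ 2 / 4) := by
  have h1 : Real.exp (envelope i j x / 4) =
      Real.exp (1 / 4) * (Real.exp (x i ^ 2 / 8) * Real.exp (x j ^ 2 / 8)) := by
    rw [← Real.exp_add, ← Real.exp_add]; unfold envelope; congr 1; ring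
  have h2 : ∀ a : ℝ, Real.exp (a ^ 2 / 4) = Real.exp (a ^ 2 / 8) ^ 2 := by
    intro a; rw [← Real.exp_nat_mul]; congr 1; push_cast; ring
  have h3 : Real.exp (1 / 4) ≤ 2 := by
    have e : Real.exp 1 = Real.exp (1 / 4) ^ 4 := by
      rw [← Real.exp_nat_mul]; congr 1; norm_num
    have h := Real.exp_one_lt_d9
    by_contra hc
    push Not at hc
    have : (2 : ℝ) ^ 4 < Real.exp (1 / 4) ^ 4 := by gcongr
    rw [← e] at this
    norm_num at this
    linarith
  rw [h1, h2, h2]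
  have ha := Real.exp_pos (x i ^ 2 / 8)
  have hb := Real.exp_pos (x j ^ 2 / 8)
  nlinarith [sq_nonneg (Real.exp (x i ^ 2 / 8) - Real.exp (x j ^ 2 / 8)), mul_pos ha hb]

lemma sq_mul_exp_div_eight_le {v : ℝ} (hv : 0 ≤ v) :
    v ^ 2 * Real.exp (v / 8) ≤ 128 * Real.exp (v / 4) := by
  have h1 := Real.pow_div_factorial_le_exp (x := v / 8) (by positivity) 2
  have h2 : Real.exp (v / 4) = Real.exp (v / 8) * Real.exp (v / 8) := by
    rw [← Real.exp_add]; congr 1; ring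
  have h3 := Real.exp_pos (v / 8)
  simp only [Nat.factorial] at h1
  norm_num at h1
  rw [h2]
  nlinarith

lemma integrable_envelope_sq_mul_exp :
    Integrable (fun x => envelope i j x ^ 2 * Real.exp (envelope i j x / 8)) (bgVec θ n) := by
  refine (((integrable_exp_sq_bgVec θ i).add (integrable_exp_sq_bgVec θ j)).const_mul 128).mono'
    (Continuous.aestronglyMeasurable (by fun_prop)) ?_
  filter_upwards with x
  have h0 := one_le_envelope i j x
  rw [Real.norm_of_nonneg (by positivity)]
  refine (sq_mul_exp_div_eight_le (by linarith)).trans ?_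
  have := exp_envelope_div_four_le i j x
  simp only [Pi.add_apply]
  linarith

lemma integral_envelope_sq_mul_exp_le :
    ∫ x, envelope i j x ^ 2 * Real.exp (envelope i j x / 8) ∂bgVec θ n ≤ 512 := by
  have hi := integrable_exp_sq_bgVec θ i
  have hj := integrable_exp_sq_bgVec θ j
  have hij : Integrable (fun x => Real.exp (x i ^ 2 / 4) + Real.exp (x j ^ 2 / 4)) (bgVec θ n) :=
    hi.add hj
  calc _ ≤ ∫ x, 128 * (Real.exp (x i ^ 2 / 4) + Real.exp (x j ^ 2 / 4)) ∂bgVec θ n := by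
        refine integral_mono (integrable_envelope_sq_mul_exp θ i j) (hij.const_mul _) fun x => ?_
        have h0 := one_le_envelope i j x
        refine (sq_mul_exp_div_eight_le (by linarith)).trans ?_
        have := exp_envelope_div_four_le i j x
        linarith
    _ = 128 * (∫ x, Real.exp (x i ^ 2 / 4) ∂bgVec θ n +
        ∫ x, Real.exp (x j ^ 2 / 4) ∂bgVec θ n) := by
        rw [integral_const_mul, integral_add hi hj]
    _ ≤ _ := by
        have h1 := integral_exp_sq_bgVec_le θ i
        have h2 := integral_exp_sq_bgVec_le θ j
        linarith

/-- The oscillation over a cell multiplies the envelope by a sum of the |x_l|. Two applications of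
AM–GM separate |x_l| from the envelope and its exponential. -/
lemma abs_mul_envelope_mul_exp_le (x : Fin n → ℝ) :
    |x l| * envelope i j x * Real.exp (envelope i j x / 8) ≤
      4 * Real.exp (x l ^ 2 / 4) + 68 * (Real.exp (x i ^ 2 / 4) + Real.exp (x j ^ 2 / 4)) := by
  set v := envelope i j x with hv
  have h0 : 1 ≤ v := one_le_envelope i j x
  have h1 := sq_mul_exp_div_eight_le (v := v) (by linarith)
  have h2 := exp_envelope_div_four_le i j x
  rw [← hv] at h2
  have h3 : |x l| * v ≤ (x l ^ 2 + v ^ 2) / 2 := by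
    have := sq_abs (x l); nlinarith [sq_nonneg (|x l| - v)]
  have h4 : x l ^ 2 * Real.exp (v / 8) ≤ 4 * (Real.exp (x l ^ 2 / 4) + Real.exp (v / 4)) := by
    have a1 := Real.add_one_le_exp (x l ^ 2 / 8)
    have a2 : Real.exp (x l ^ 2 / 4) = Real.exp (x l ^ 2 / 8) ^ 2 := by
      rw [← Real.exp_nat_mul]; congr 1; push_cast; ring
    have a3 : Real.exp (v / 4) = Real.exp (v / 8) ^ 2 := by
      rw [← Real.exp_nat_mul]; congr 1; push_cast; ring
    have a4 := Real.exp_pos (v / 8)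
    have a5 : x l ^ 2 * Real.exp (v / 8) ≤ 8 * Real.exp (x l ^ 2 / 8) * Real.exp (v / 8) := by
      gcongr; linarith
    rw [a2, a3]
    nlinarith [sq_nonneg (Real.exp (x l ^ 2 / 8) - Real.exp (v / 8))]
  have h5 := Real.exp_pos (v / 8)
  have h6 := Real.exp_pos (x l ^ 2 / 4)
  have h7 := Real.exp_pos (x i ^ 2 / 4)
  have h8 := Real.exp_pos (x j ^ 2 / 4)
  calc |x l| * v * Real.exp (v / 8) ≤ (x l ^ 2 + v ^ 2) / 2 * Real.exp (v / 8) := by gcongr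
    _ = (x l ^ 2 * Real.exp (v / 8) + v ^ 2 * Real.exp (v / 8)) / 2 := by ring
    _ ≤ _ := by linarith

lemma integrable_abs_mul_envelope_mul_exp :
    Integrable (fun x => |x l| * envelope i j x * Real.exp (envelope i j x / 8)) (bgVec θ n) := by
  refine (((integrable_exp_sq_bgVec θ l).const_mul 4).add (((integrable_exp_sq_bgVec θ i).add
    (integrable_exp_sq_bgVec θ j)).const_mul 68)).mono'
    (Continuous.aestronglyMeasurable (by fun_prop)) ?_
  filter_upwards with x
  have h0 := one_le_envelope i j x
  rw [Real.norm_of_nonneg (by positivity)]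
  exact abs_mul_envelope_mul_exp_le i j l x

lemma integral_abs_mul_envelope_mul_exp_le :
    ∫ x, |x l| * envelope i j x * Real.exp (envelope i j x / 8) ∂bgVec θ n ≤ 512 := by
  have hl := integrable_exp_sq_bgVec θ l
  have hi := integrable_exp_sq_bgVec θ i
  have hj := integrable_exp_sq_bgVec θ j
  have hij : Integrable (fun x => Real.exp (x i ^ 2 / 4) + Real.exp (x j ^ 2 / 4)) (bgVec θ n) :=
    hi.add hj
  calc _ ≤ ∫ x, (4 * Real.exp (x l ^ 2 / 4) +
        68 * (Real.exp (x i ^ 2 / 4) + Real.exp (x j ^ 2 / 4))) ∂bgVec θ n :=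
        integral_mono (integrable_abs_mul_envelope_mul_exp θ i j l)
          ((hl.const_mul 4).add (hij.const_mul 68)) (abs_mul_envelope_mul_exp_le i j l)
    _ = 4 * ∫ x, Real.exp (x l ^ 2 / 4) ∂bgVec θ n + 68 * (∫ x, Real.exp (x i ^ 2 / 4) ∂bgVec θ n +
        ∫ x, Real.exp (x j ^ 2 / 4) ∂bgVec θ n) := by
        rw [integral_add (hl.const_mul 4) (hij.const_mul 68), integral_const_mul,
          integral_const_mul, integral_add hi hj]
    _ ≤ _ := by
        have h1 := integral_exp_sq_bgVec_le θ i
        have h2 := integral_exp_sq_bgVec_le θ j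
        have h3 := integral_exp_sq_bgVec_le θ l
        linarith

/-- A bound for the oscillation of `q ↦ g (qᵀx / μ) W x` over a cell of side `δ μ`. -/
noncomputable def oscBound (δ : ℝ) (x : Fin n → ℝ) : ℝ :=
  2 * min 1 (δ * ∑ l, |x l|) * envelope i j x

@[fun_prop]
lemma continuous_oscBound (δ : ℝ) : Continuous (oscBound i j δ) := by unfold oscBound; fun_prop

variable {δ : ℝ}

lemma oscBound_nonneg (hδ : 0 ≤ δ) (x : Fin n → ℝ) : 0 ≤ oscBound i j δ x := by
  have h0 := one_le_envelope i j x
  have : 0 ≤ ∑ l, |x l| := Finset.sum_nonneg fun l _ => abs_nonneg _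
  unfold oscBound; positivity

lemma oscBound_le (x : Fin n → ℝ) : oscBound i j δ x ≤ 2 * envelope i j x := by
  have h0 := one_le_envelope i j x
  unfold oscBound
  have := min_le_left 1 (δ * ∑ l, |x l|)
  nlinarith

lemma oscBound_le_sum (x : Fin n → ℝ) :
    oscBound i j δ x * Real.exp (envelope i j x / 8) ≤
      2 * δ * ∑ l, |x l| * envelope i j x * Real.exp (envelope i j x / 8) := by
  have h0 := one_le_envelope i j x
  have h1 := min_le_right 1 (δ * ∑ l, |x l|)
  have h2 := Real.exp_pos (envelope i j x / 8)
  rw [← Finset.sum_mul, ← Finset.sum_mul]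
  unfold oscBound
  calc _ ≤ 2 * (δ * ∑ l, |x l|) * envelope i j x * Real.exp (envelope i j x / 8) := by gcongr
    _ = _ := by ring

lemma integrable_oscBound_mul_exp (hδ : 0 ≤ δ) :
    Integrable (fun x => oscBound i j δ x * Real.exp (envelope i j x / 8)) (bgVec θ n) := by
  refine ((integrable_finsetSum Finset.univ fun l _ =>
    integrable_abs_mul_envelope_mul_exp θ i j l).const_mul (2 * δ)).mono'
    (Continuous.aestronglyMeasurable (by fun_prop)) ?_
  filter_upwards with x
  have h0 := oscBound_nonneg i j hδ x
  rw [Real.norm_of_nonneg (by positivity)]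
  exact oscBound_le_sum i j x

lemma integral_oscBound_mul_exp_le (hδ : 0 ≤ δ) :
    ∫ x, oscBound i j δ x * Real.exp (envelope i j x / 8) ∂bgVec θ n ≤ 1024 * n * δ := by
  have hi := integrable_finsetSum Finset.univ fun l (_ : l ∈ Finset.univ) =>
    integrable_abs_mul_envelope_mul_exp θ i j l
  calc _ ≤ ∫ x, 2 * δ * ∑ l, |x l| * envelope i j x * Real.exp (envelope i j x / 8) ∂bgVec θ n :=
        integral_mono (integrable_oscBound_mul_exp θ i j hδ) (hi.const_mul _)
          (oscBound_le_sum i j)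
    _ = 2 * δ * ∑ l, ∫ x, |x l| * envelope i j x * Real.exp (envelope i j x / 8) ∂bgVec θ n := by
        rw [integral_const_mul, integral_finsetSum _ fun l _ =>
          integrable_abs_mul_envelope_mul_exp θ i j l]
    _ ≤ 2 * δ * ∑ _l : Fin n, 512 := by
        gcongr with l
        exact integral_abs_mul_envelope_mul_exp_le θ i j l
    _ = _ := by simp; ring

lemma oscBound_le_mul_exp (hδ : 0 ≤ δ) (x : Fin n → ℝ) :
    oscBound i j δ x ≤ oscBound i j δ x * Real.exp (envelope i j x / 8) := by
  have h0 := one_le_envelope i j x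
  exact le_mul_of_one_le_right (oscBound_nonneg i j hδ x) (Real.one_le_exp (by positivity))

lemma integrable_oscBound (hδ : 0 ≤ δ) : Integrable (oscBound i j δ) (bgVec θ n) := by
  refine (integrable_oscBound_mul_exp θ i j hδ).mono'
    (Continuous.aestronglyMeasurable (by fun_prop)) ?_
  filter_upwards with x
  rw [Real.norm_of_nonneg (oscBound_nonneg i j hδ x)]
  exact oscBound_le_mul_exp i j hδ x

lemma integral_oscBound_le (hδ : 0 ≤ δ) : ∫ x, oscBound i j δ x ∂bgVec θ n ≤ 1024 * n * δ :=
  (integral_mono (integrable_oscBound θ i j hδ) (integrable_oscBound_mul_exp θ i j hδ)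
    (oscBound_le_mul_exp i j hδ)).trans (integral_oscBound_mul_exp_le θ i j hδ)

/-- From exp u ≤ 1 + u exp u. The minimum with 1 in `oscBound` keeps u below envelope/8, so the
exponential moment is finite, and it tends to 1 with the mesh. -/
lemma integral_exp_oscBound_le (hδ : 0 ≤ δ) :
    Integrable (fun x => Real.exp (1 / 16 * oscBound i j δ x)) (bgVec θ n) ∧
      ∫ x, Real.exp (1 / 16 * oscBound i j δ x) ∂bgVec θ n ≤ Real.exp (64 * n * δ) := by
  have hpt : ∀ x, Real.exp (1 / 16 * oscBound i j δ x) ≤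
      1 + 1 / 16 * (oscBound i j δ x * Real.exp (envelope i j x / 8)) := by
    intro x
    set u := 1 / 16 * oscBound i j δ x with hu
    have h0 := oscBound_nonneg i j hδ x
    have h1 : Real.exp u ≤ 1 + u * Real.exp u := by
      have a := Real.one_sub_le_exp_neg u
      have b : Real.exp (-u) * Real.exp u = 1 := by rw [← Real.exp_add]; simp
      nlinarith [mul_le_mul_of_nonneg_right a (Real.exp_pos u).le]
    have h2 : Real.exp u ≤ Real.exp (envelope i j x / 8) := by
      rw [Real.exp_le_exp, hu]
      have := oscBound_le (δ := δ) i j x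
      linarith
    have hu0 : 0 ≤ u := by positivity
    have h3 := mul_le_mul_of_nonneg_left h2 hu0
    have h4 : u * Real.exp (envelope i j x / 8) =
      1 / 16 * (oscBound i j δ x * Real.exp (envelope i j x / 8)) := by rw [hu]; ring
    linarith
  have hi : Integrable (fun x => 1 + 1 / 16 * (oscBound i j δ x *
      Real.exp (envelope i j x / 8))) (bgVec θ n) :=
    (integrable_const 1).add ((integrable_oscBound_mul_exp θ i j hδ).const_mul _)
  have hexp : Integrable (fun x => Real.exp (1 / 16 * oscBound i j δ x)) (bgVec θ n) := by
    refine hi.mono' (Continuous.aestronglyMeasurable (by fun_prop)) ?_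
    filter_upwards with x
    rw [Real.norm_of_nonneg (Real.exp_pos _).le]
    exact hpt x
  refine ⟨hexp, (integral_mono hexp hi hpt).trans ?_⟩
  rw [integral_add (integrable_const 1) ((integrable_oscBound_mul_exp θ i j hδ).const_mul _),
    integral_const_mul]
  have := integral_oscBound_mul_exp_le θ i j hδ
  have h2 := Real.add_one_le_exp (64 * n * δ)
  simp
  linarith

end

/-! ### Uniform concentration over the cube -/

/-- The points of a grid of mesh `1 / N` in the cube `[-1, 1]ⁿ`. -/
noncomputable def gridPoint {n : ℕ} (N : ℕ) (a : Fin n → Fin (2 * N + 1)) (l : Fin n) : ℝ :=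
  ((a l : ℕ) - N) / N

lemma exists_gridPoint {n N : ℕ} (hN : 0 < N) (q : Fin n → ℝ) (hq : ∀ l, |q l| ≤ 1) :
    ∃ a, ∀ l, |q l - gridPoint N a l| ≤ 1 / N := by
  have hN' : (0 : ℝ) < N := by exact_mod_cast hN
  have hlt : ∀ l, ⌊(q l + 1) * N⌋₊ < 2 * N + 1 := by
    intro l
    rw [Nat.lt_succ_iff]
    refine Nat.floor_le_of_le ?_
    push_cast
    have := (abs_le.1 (hq l)).2
    nlinarith
  refine ⟨fun l => ⟨⌊(q l + 1) * N⌋₊, hlt l⟩, fun l => ?_⟩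
  have h0 : 0 ≤ (q l + 1) * N := by
    have := (abs_le.1 (hq l)).1
    have : 0 ≤ q l + 1 := by linarith
    positivity
  have h1 := Nat.floor_le h0
  have h2 := Nat.lt_floor_add_one ((q l + 1) * N)
  have e : q l - gridPoint N (fun l => ⟨⌊(q l + 1) * N⌋₊, hlt l⟩) l =
      ((q l + 1) * N - ⌊(q l + 1) * N⌋₊) / N := by
    unfold gridPoint; field_simp; ring
  rw [e, abs_of_nonneg (div_nonneg (by linarith) hN'.le)]
  gcongr
  linarith

/-- The function `x ↦ g (qᵀx / μ) W x`. -/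
noncomputable def ridgeFun {n : ℕ} (μ : ℝ) (g : ℝ → ℝ) (W : (Fin n → ℝ) → ℝ) (q x : Fin n → ℝ) :
    ℝ :=
  g ((∑ l, q l * x l) / μ) * W x

section
variable {Ω : Type*} [MeasurableSpace Ω] {P : Measure Ω} [IsProbabilityMeasure P] {n p : ℕ}
  {θ : unitInterval} {μ : ℝ} {g : ℝ → ℝ} {W : (Fin n → ℝ) → ℝ} {i j : Fin n}

lemma continuous_ridgeFun (hg : Continuous g) (hW : Continuous W) (q : Fin n → ℝ) :
    Continuous (ridgeFun μ g W q) := by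
  unfold ridgeFun; fun_prop

lemma abs_ridgeFun_le (hg1 : ∀ z, |g z| ≤ 1) (hWV : ∀ x, |W x| ≤ envelope i j x)
    (q x : Fin n → ℝ) : |ridgeFun μ g W q x| ≤ envelope i j x := by
  unfold ridgeFun
  rw [abs_mul]
  have h1 := hg1 ((∑ l, q l * x l) / μ)
  have h2 := hWV x
  have h3 := abs_nonneg (W x)
  nlinarith

lemma integrable_envelope : Integrable (envelope i j) (bgVec θ n) := by
  have h := integrable_mul_bgVec θ i i
  have h' := integrable_mul_bgVec θ j j
  simp_rw [← pow_two] at h h'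
  exact (integrable_const 1).add ((h.add h').div_const 2)

lemma integrable_ridgeFun (hg : Continuous g) (hW : Continuous W) (hg1 : ∀ z, |g z| ≤ 1)
    (hWV : ∀ x, |W x| ≤ envelope i j x) (q : Fin n → ℝ) :
    Integrable (ridgeFun μ g W q) (bgVec θ n) := by
  refine (integrable_envelope (i := i) (j := j)).mono'
    (continuous_ridgeFun hg hW q).aestronglyMeasurable ?_
  filter_upwards with x
  exact abs_ridgeFun_le hg1 hWV q x

lemma abs_ridgeFun_sub_le (hμ : 0 < μ) (hg1 : ∀ z, |g z| ≤ 1)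
    (hgL : ∀ a b, |g a - g b| ≤ 2 * |a - b|) (hWV : ∀ x, |W x| ≤ envelope i j x)
    {η : ℝ} {q q' : Fin n → ℝ} (hqq' : ∀ l, |q l - q' l| ≤ η) (x : Fin n → ℝ) :
    |ridgeFun μ g W q x - ridgeFun μ g W q' x| ≤ oscBound i j (η / μ) x := by
  unfold ridgeFun oscBound
  rw [← sub_mul, abs_mul]
  set a := (∑ l, q l * x l) / μ with ha
  set b := (∑ l, q' l * x l) / μ with hb
  have h1 : |a - b| ≤ η / μ * ∑ l, |x l| := by
    have e : a - b = (∑ l, (q l - q' l) * x l) / μ := by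
      rw [ha, hb, ← sub_div, ← Finset.sum_sub_distrib]
      congr 1
      exact Finset.sum_congr rfl fun l _ => by ring
    rw [e, abs_div, abs_of_pos hμ, div_mul_eq_mul_div]
    gcongr
    rw [Finset.mul_sum]
    refine (Finset.abs_sum_le_sum_abs _ _).trans (Finset.sum_le_sum fun l _ => ?_)
    rw [abs_mul]
    exact mul_le_mul_of_nonneg_right (hqq' l) (abs_nonneg _)
  have h2 : |g a - g b| ≤ 2 * min 1 (η / μ * ∑ l, |x l|) := by
    rcases le_total 1 (η / μ * ∑ l, |x l|) with h | h
    · rw [min_eq_left h]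
      have := abs_sub (g a) (g b)
      linarith [hg1 a, hg1 b]
    · rw [min_eq_right h]
      linarith [hgL a b]
  exact mul_le_mul h2 (hWV x) (abs_nonneg _) ((abs_nonneg _).trans h2)

/-- Uniform concentration of empirical means of ridge functions. -/
lemma measure_exists_ridgeFun_deviation_le {col : Fin p → Ω → Fin n → ℝ}
    (hind : iIndepFun col P) (hlaw : ∀ k, HasLaw (col k) (bgVec θ n) P)
    (hμ : 0 < μ) (hg : Continuous g) (hW : Continuous W) (hg1 : ∀ z, |g z| ≤ 1)
    (hgL : ∀ a b, |g a - g b| ≤ 2 * |a - b|) (hWV : ∀ x, |W x| ≤ envelope i j x)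
    {ε : ℝ} (hε : 0 < ε) (hε1 : ε ≤ 1) {N : ℕ} (hN : 6144 * n ≤ ε * μ * N) (hp : 0 < p) :
    P.real {ω | ∃ q : Fin n → ℝ, (∀ l, |q l| ≤ 1) ∧
      ε < |1 / p * ∑ k, ridgeFun μ g W q (col k ω) - ∫ x, ridgeFun μ g W q x ∂bgVec θ n|} ≤
      (2 * (2 * N + 1) ^ n + 1) * Real.exp (-(p * ε ^ 2 / 18432)) := by
  have hn : 0 < n := Fin.pos i
  have hn' : (0 : ℝ) < n := by exact_mod_cast hn
  have hp' : (0 : ℝ) < p := by exact_mod_cast hp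
  have hN0 : (0 : ℝ) < N := by
    by_contra hc
    have : (N : ℝ) = 0 := le_antisymm (not_lt.1 hc) (Nat.cast_nonneg _)
    rw [this] at hN
    nlinarith
  have hN0' : 0 < N := by exact_mod_cast hN0
  set δ : ℝ := 1 / N / μ with hδ
  have hδ0 : 0 ≤ δ := by positivity
  -- The constant serves two purposes: the mean oscillation 1024nδ is at most ε/6, and 64nδ ≤ ε/96
  -- is half of the Chernoff gain ε/48.
  have hnδ : n * δ ≤ ε / 6144 := by
    rw [hδ, div_div, mul_one_div, div_le_div_iff₀ (by positivity) (by norm_num)]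
    linarith
  set grid : (Fin n → Fin (2 * N + 1)) → Set Ω := fun a =>
    {ω | p * (ε / 3) ≤ |∑ k, ridgeFun μ g W (gridPoint N a) (col k ω) -
      p * ∫ x, ridgeFun μ g W (gridPoint N a) x ∂bgVec θ n|} with hgrid
  set osc : Set Ω := {ω | p * (ε / 3) ≤ ∑ k, oscBound i j δ (col k ω)} with hosc
  -- A deviation at q splits into the deviation at a nearby grid point, the empirical oscillation
  -- and the mean oscillation, with ε/3 allowed for each. The bound `oscBound` does not depend on
  -- the cell, so a single event `osc` serves all of them.
  have hsub : {ω | ∃ q : Fin n → ℝ, (∀ l, |q l| ≤ 1) ∧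
      ε < |1 / p * ∑ k, ridgeFun μ g W q (col k ω) - ∫ x, ridgeFun μ g W q x ∂bgVec θ n|} ⊆
      (⋃ a, grid a) ∪ osc := by
    intro ω hω
    by_contra hc
    simp only [Set.mem_union, Set.mem_iUnion, not_or, not_exists] at hc
    obtain ⟨q, hq, hlt⟩ := hω
    obtain ⟨a, ha⟩ := exists_gridPoint hN0' q hq
    have h1 := hc.1 a
    have h2 := hc.2
    simp only [hgrid, hosc, Set.mem_ofPred_eq, not_le] at h1 h2
    set S := ∑ k, ridgeFun μ g W q (col k ω)
    set S' := ∑ k, ridgeFun μ g W (gridPoint N a) (col k ω)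
    set m := ∫ x, ridgeFun μ g W q x ∂bgVec θ n
    set m' := ∫ x, ridgeFun μ g W (gridPoint N a) x ∂bgVec θ n
    have hS : |S - S'| < p * (ε / 3) := by
      refine lt_of_le_of_lt ?_ h2
      rw [← Finset.sum_sub_distrib]
      refine (Finset.abs_sum_le_sum_abs _ _).trans (Finset.sum_le_sum fun k _ => ?_)
      exact abs_ridgeFun_sub_le hμ hg1 hgL hWV ha _
    have hm : |m - m'| ≤ ε / 3 := by
      rw [← integral_sub (integrable_ridgeFun hg hW hg1 hWV q)
        (integrable_ridgeFun hg hW hg1 hWV _), ← Real.norm_eq_abs]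
      refine (norm_integral_le_of_norm_le (integrable_oscBound θ i j hδ0)
        (Filter.Eventually.of_forall fun x => ?_)).trans
        ((integral_oscBound_le θ i j hδ0).trans (by linarith))
      exact abs_ridgeFun_sub_le hμ hg1 hgL hWV ha _
    have e : 1 / p * S - m = (S - S') / p + (S' - p * m') / p - (m - m') := by
      field_simp; ring
    have h3 : |(S - S') / p| ≤ ε / 3 := by
      rw [abs_div, abs_of_pos hp', div_le_iff₀ hp']; linarith
    have h4 : |(S' - p * m') / p| ≤ ε / 3 := by
      rw [abs_div, abs_of_pos hp', div_le_iff₀ hp']; linarith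
    rw [e] at hlt
    have h5 := abs_sub ((S - S') / p + (S' - p * m') / p) (m - m')
    have h6 := abs_add_le ((S - S') / p) ((S' - p * m') / p)
    linarith
  have hgrid_le : ∀ a, P.real (grid a) ≤ 2 * Real.exp (-(p * ε ^ 2 / 18432)) := by
    intro a
    have h := measure_abs_sum_sub_ge_le hind hlaw
      (continuous_ridgeFun hg hW (gridPoint N a)).measurable (V := envelope i j)
      (abs_ridgeFun_le (μ := μ) hg1 hWV (gridPoint N a))
      (integrable_envelope_sq_mul_exp θ i j) (integral_envelope_sq_mul_exp_le θ i j)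
      (by norm_num) (integrable_ridgeFun hg hW hg1 hWV _) (t := ε / 3) (by positivity)
      (by linarith)
    -- 18432 = 4 · 512 · 3²: the Bernstein denominator with K = 512 and deviation ε/3.
    refine h.trans (le_of_eq ?_)
    congr 3
    ring
  have hosc_le : P.real osc ≤ Real.exp (-(p * ε ^ 2 / 18432)) := by
    obtain ⟨hi, hle⟩ := integral_exp_oscBound_le θ i j hδ0
    have h := measure_sum_ge_le hind hlaw (continuous_oscBound i j δ).measurable
      (s := 1 / 16) (by norm_num) hi (p * (ε / 3))
    refine h.trans ?_
    have h0 : 0 ≤ ∫ x, Real.exp (1 / 16 * oscBound i j δ x) ∂bgVec θ n :=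
      integral_nonneg fun _ => (Real.exp_pos _).le
    calc _ ≤ Real.exp (-(1 / 16) * (p * (ε / 3))) * Real.exp (64 * n * δ) ^ p := by gcongr
      _ = Real.exp (p * (-(ε / 48) + 64 * (n * δ))) := by
        rw [← Real.exp_nat_mul, ← Real.exp_add]; congr 1; ring
      _ ≤ _ := by
        rw [Real.exp_le_exp, ← mul_div_assoc', ← mul_neg]
        gcongr
        nlinarith
  calc _ ≤ P.real ((⋃ a, grid a) ∪ osc) := measureReal_mono hsub
    _ ≤ P.real (⋃ a, grid a) + P.real osc := measureReal_union_le _ _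
    _ ≤ ∑ a, P.real (grid a) + P.real osc := by gcongr; exact measureReal_iUnion_fintype_le _
    _ ≤ ∑ _a : Fin n → Fin (2 * N + 1), 2 * Real.exp (-(p * ε ^ 2 / 18432)) +
        Real.exp (-(p * ε ^ 2 / 18432)) := by
        gcongr with a
        exact hgrid_le a
    _ = _ := by
        simp only [Finset.sum_const, Finset.card_univ, Fintype.card_fun, Fintype.card_fin,
          nsmul_eq_mul]
        push_cast
        ring

end

/-! ### Lipschitz bounds for the gradient and Hessian profiles -/

lemma abs_tanh_sub_le (a b : ℝ) : |Real.tanh a - Real.tanh b| ≤ 2 * |a - b| := by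
  have h := Convex.norm_image_sub_le_of_norm_hasDerivWithin_le (s := Set.univ) (C := 2)
    (fun x _ => (hasDerivAt_tanh x).hasDerivWithinAt) (fun x _ => by
      rw [Real.norm_of_nonneg (sechSq_pos x).le]; linarith [sechSq_le_one x])
    convex_univ (Set.mem_univ b) (Set.mem_univ a)
  simpa using h

lemma sechSq_eq_one_sub (z : ℝ) : sechSq z = 1 - Real.tanh z ^ 2 := by
  have h := Real.cosh_sq_sub_sinh_sq z
  have hc := (Real.cosh_pos z).ne'
  rw [sechSq, Real.tanh_eq_sinh_div_cosh]
  field_simp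
  linarith

lemma hasDerivAt_sechSq (z : ℝ) : HasDerivAt sechSq (-(2 * Real.tanh z * sechSq z)) z := by
  have h := ((hasDerivAt_tanh z).pow 2).const_sub 1
  have e : sechSq = fun z => 1 - Real.tanh z ^ 2 := funext sechSq_eq_one_sub
  have e2 : HasDerivAt (fun z => 1 - Real.tanh z ^ 2) (-(2 * Real.tanh z * sechSq z)) z := by
    refine h.congr_deriv ?_
    norm_num
  rwa [← e] at e2

lemma abs_sechSq_sub_le (a b : ℝ) : |sechSq a - sechSq b| ≤ 2 * |a - b| := by
  have h := Convex.norm_image_sub_le_of_norm_hasDerivWithin_le (s := Set.univ) (C := 2)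
    (fun x _ => (hasDerivAt_sechSq x).hasDerivWithinAt) (fun x _ => by
      have h1 := (Real.abs_tanh_lt_one x).le
      have h2 := (sechSq_pos x).le
      have h3 := sechSq_le_one x
      rw [norm_neg, norm_mul, norm_mul, Real.norm_of_nonneg h2, Real.norm_eq_abs, Real.norm_eq_abs,
        abs_two]
      have := abs_nonneg (Real.tanh x)
      nlinarith)
    convex_univ (Set.mem_univ b) (Set.mem_univ a)
  simpa using h

/-! ### Geometry of a regular sample -/

/-- The relative size of the caps around the basis vectors. -/
noncomputable def capConst : ℝ := 1 / (80 * (1 + hessConst) * (1 + massConst))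

/-- The relative size of the admissible deviations. -/
noncomputable def devConst : ℝ := capConst * massConst / 32

lemma capConst_pos : 0 < capConst := by
  have := hessConst_nonneg
  have := massConst_pos
  unfold capConst; positivity

lemma devConst_pos : 0 < devConst := by
  have := capConst_pos
  have := massConst_pos
  unfold devConst; positivity

lemma capConst_le : capConst ≤ 1 / 80 := by
  have h1 := hessConst_nonneg
  have h2 := massConst_pos
  unfold capConst
  apply one_div_le_one_div_of_le (by norm_num)
  nlinarith [mul_nonneg h1 h2.le]

/-- The factor 1 + `hessConst` in `capConst` is there for this: it is the smallness that
`popHess_quadratic_ge` asks of a cap. -/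
lemma capConst_sq_mul_hessConst_le : capConst ^ 2 * hessConst ≤ 1 / 10 := by
  have h1 := hessConst_nonneg
  have h2 := massConst_pos
  have h3 : capConst * hessConst ≤ 1 := by
    unfold capConst
    rw [div_mul_eq_mul_div, div_le_one (by positivity)]
    nlinarith [mul_nonneg h1 h2.le]
  have h4 := capConst_le
  have h5 := capConst_pos
  nlinarith

/-- The factor 1 + `massConst` in `capConst` is there for this, and it gives `devConst` ≤ 1/2560. -/
lemma capConst_mul_massConst_le : capConst * massConst ≤ 1 / 80 := by
  have h1 := hessConst_nonneg
  have h2 := massConst_pos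
  unfold capConst
  rw [div_mul_eq_mul_div, div_le_div_iff₀ (by positivity) (by norm_num)]
  nlinarith [mul_nonneg h1 h2.le]

section
variable {n p : ℕ}

/-- The `j`-th partial derivative of the objective. -/
noncomputable def empGrad (μ : ℝ) (Y : Fin n → Fin p → ℝ) (q : Fin n → ℝ) (j : Fin n) : ℝ :=
  1 / p * ∑ k, Real.tanh ((∑ l, q l * Y l k) / μ) * Y j k

/-- The parameter `μ` times the `(i, j)` entry of the Hessian of the objective. -/
noncomputable def empHess (μ : ℝ) (Y : Fin n → Fin p → ℝ) (q : Fin n → ℝ) (i j : Fin n) : ℝ :=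
  1 / p * ∑ k, sechSq ((∑ l, q l * Y l k) / μ) * (Y i k * Y j k)

/-- The sample `Y` is regular: the empirical gradient and Hessian are uniformly close to their
expectations, with a sharper bound for the gradient at the basis vectors. -/
structure IsRegular (θ : unitInterval) (μ τ : ℝ) (Y : Fin n → Fin p → ℝ) : Prop where
  grad : ∀ (q : Fin n → ℝ) (j : Fin n), (∀ l, |q l| ≤ 1) →
    |empGrad μ Y q j - popGrad θ μ q j| ≤ devConst * μ * θ / n
  hess : ∀ (q : Fin n → ℝ) (i j : Fin n), (∀ l, |q l| ≤ 1) →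
    |empHess μ Y q i j - popHess θ μ q i j| ≤ devConst * μ * θ / n
  basis : ∀ i j : Fin n, i ≠ j → |empGrad μ Y (Pi.single i 1) j| ≤ τ

/-- Admissible ranges of the parameters. -/
structure Admissible (n : ℕ) (θ : unitInterval) (μ : ℝ) : Prop where
  theta_pos : 0 < (θ : ℝ)
  theta_le : (θ : ℝ) ≤ 1 / 2
  mu_pos : 0 < μ
  mu_lt : 128 * n * μ < θ

variable {θ : unitInterval} {μ τ : ℝ} {Y : Fin n → Fin p → ℝ} {q q' : Fin n → ℝ}

lemma Admissible.mul_mu_le_one (ha : Admissible n θ μ) : n * μ ≤ 1 := by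
  have := ha.mu_lt
  have := ha.theta_le
  linarith

lemma Admissible.mu_le_one (ha : Admissible n θ μ) (hn : 0 < n) : μ ≤ 1 := by
  have h1 : (1 : ℝ) ≤ n := by exact_mod_cast hn
  have := ha.mul_mu_le_one
  have := ha.mu_pos
  nlinarith

lemma Admissible.mul_sq_le_one (ha : Admissible n θ μ) (hn : 0 < n) : n * μ ^ 2 ≤ 1 := by
  have h2 := ha.mu_le_one hn
  have h3 := ha.mul_mu_le_one
  have := ha.mu_pos
  nlinarith

lemma abs_le_one_of_sum_sq (hq : ∑ l, q l ^ 2 = 1) (l : Fin n) : |q l| ≤ 1 := by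
  have := Finset.single_le_sum (fun l _ => sq_nonneg (q l)) (Finset.mem_univ l)
  rw [hq] at this
  exact abs_le_one_iff_mul_self_le_one.2 (by nlinarith)

lemma one_le_card_mul_sq (hq : ∑ l, q l ^ 2 = 1) {i : Fin n} (hi : ∀ l, |q l| ≤ |q i|) :
    1 ≤ n * q i ^ 2 := by
  have h := Finset.sum_le_card_nsmul Finset.univ (fun l => q l ^ 2) (q i ^ 2)
    fun l _ => sq_le_sq.2 (hi l)
  rw [hq] at h
  simpa using h

/-- The empirical gradient along a rotation has the sign of its expectation. -/
lemma IsRegular.abs_rotation_sub_le (hY : IsRegular θ μ τ Y) (hq : ∑ l, q l ^ 2 = 1)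
    {i j : Fin n} (hle : |q j| ≤ |q i|) :
    |(q i * empGrad μ Y q j - q j * empGrad μ Y q i) -
      (q i * popGrad θ μ q j - q j * popGrad θ μ q i)| ≤ |q i| * (2 * (devConst * μ * θ / n)) := by
  have h1 := hY.grad q j (abs_le_one_of_sum_sq hq)
  have h2 := hY.grad q i (abs_le_one_of_sum_sq hq)
  have e : (q i * empGrad μ Y q j - q j * empGrad μ Y q i) -
      (q i * popGrad θ μ q j - q j * popGrad θ μ q i) =
      q i * (empGrad μ Y q j - popGrad θ μ q j) - q j * (empGrad μ Y q i - popGrad θ μ q i) := by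
    ring
  rw [e]
  refine (abs_sub _ _).trans ?_
  rw [abs_mul, abs_mul]
  calc _ ≤ |q i| * (devConst * μ * θ / n) + |q i| * (devConst * μ * θ / n) := by gcongr
    _ = _ := by ring

/-- A critical point has no coordinates of intermediate size. -/
lemma IsRegular.abs_mul_sub_le (hY : IsRegular θ μ τ Y) (ha : Admissible n θ μ)
    (hq : ∑ l, q l ^ 2 = 1) {i j : Fin n} (hij : i ≠ j) (hi : q i ≠ 0) (hle : |q j| ≤ |q i|)
    (hc : q i * empGrad μ Y q j = q j * empGrad μ Y q i) :
    |q j| * (q i ^ 2 - q j ^ 2) ≤ capConst * μ / (4 * n) := by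
  have hn : 0 < n := Fin.pos i
  have hn' : (0 : ℝ) < n := by exact_mod_cast hn
  have hθ := ha.theta_pos
  have hμ := ha.mu_pos
  have hm := massConst_pos
  obtain ⟨S, hS, hpop⟩ := le_popGrad_rotation θ ha.mu_pos (ha.mu_le_one hn) ha.theta_le hq hij
    (sq_le_sq.2 hle)
  have h := hY.abs_rotation_sub_le hq hle
  rw [hpop, hc, sub_self, zero_sub, abs_neg, mul_assoc, abs_mul] at h
  have h1 := le_of_mul_le_mul_left h (abs_pos.2 hi)
  rw [abs_mul] at h1
  have h2 : |q j| * (θ * massConst * (q i ^ 2 - q j ^ 2) / 4) ≤ 2 * (devConst * μ * θ / n) :=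
    (mul_le_mul_of_nonneg_left (hS.trans (le_abs_self S)) (abs_nonneg _)).trans h1
  -- The 1/32 in `devConst` makes the noise on the right equal to `θ * massConst / 4` times the
  -- asserted bound.
  rw [devConst] at h2
  have h3 : (θ * massConst / 4) * (|q j| * (q i ^ 2 - q j ^ 2)) ≤
      (θ * massConst / 4) * (capConst * μ / (4 * n)) := by
    calc _ = |q j| * (θ * massConst * (q i ^ 2 - q j ^ 2) / 4) := by ring
      _ ≤ _ := h2
      _ = _ := by field_simp; ring
  exact le_of_mul_le_mul_left h3 (by positivity)

/-- The perturbation bookkeeping for the curvature along a rotation. -/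
lemma rotation_curvature_combine {a b μ h11 h12 h22 g1 g2 k11 k12 k22 l1 l2 A B C D : ℝ}
    (hpop : (a ^ 2 * h22 - 2 * (a * b) * h12 + b ^ 2 * h11) / μ - (a * g1 + b * g2) ≤ -D)
    (hh : (a ^ 2 * (k22 - h22) - 2 * (a * b) * (k12 - h12) + b ^ 2 * (k11 - h11)) / μ ≤ A)
    (h1 : -(a * (l1 - g1)) ≤ B) (h2 : -(b * (l2 - g2)) ≤ B) (hAB : A + 2 * B ≤ C) (hCD : C < D) :
    (a ^ 2 * k22 - 2 * (a * b) * k12 + b ^ 2 * k11) / μ - (a * l1 + b * l2) < 0 := by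
  have e : (a ^ 2 * k22 - 2 * (a * b) * k12 + b ^ 2 * k11) / μ - (a * l1 + b * l2) =
      ((a ^ 2 * h22 - 2 * (a * b) * h12 + b ^ 2 * h11) / μ - (a * g1 + b * g2)) +
      (a ^ 2 * (k22 - h22) - 2 * (a * b) * (k12 - h12) + b ^ 2 * (k11 - h11)) / μ +
      (-(a * (l1 - g1)) + -(b * (l2 - g2))) := by ring
  linarith

/-- The largest coordinate satisfies Na² ≥ 1, which trades the 1/N of the noise level for a². Noise
and curvature then both scale like a⁴, and only their constants compete. -/
lemma noise_le_curvature {N t μ a : ℝ} (hN : 0 < N) (ht : 0 < t) (hμ : 0 < μ) (hμa : μ ≤ |a|)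
    (hi1 : 1 ≤ N * a ^ 2) :
    4 * a ^ 2 * (devConst * μ * t / N) / μ + 2 * (|a| * (devConst * μ * t / N)) ≤
        6 * devConst * t * a ^ 4 ∧
      6 * devConst * t * a ^ 4 < 3 / 16 * t * massConst * a ^ 4 := by
  have hm := massConst_pos
  have hκ := capConst_pos
  have hd := devConst_pos
  constructor
  · have a1 : |a| * μ ≤ a ^ 2 := by rw [← sq_abs]; nlinarith [abs_nonneg a]
    have a2 : 4 * a ^ 2 * (devConst * μ * t / N) / μ + 2 * (|a| * (devConst * μ * t / N)) =
        devConst * t / N * (4 * a ^ 2 + 2 * (|a| * μ)) := by field_simp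
    rw [a2]
    calc _ ≤ devConst * t / N * (6 * a ^ 2 * (N * a ^ 2)) := by
          gcongr
          nlinarith [sq_nonneg a]
      _ = _ := by field_simp
  · have hq4 : 0 < a ^ 4 := by
      have := abs_pos.1 (hμ.trans_le hμa)
      positivity
    have hdm : 6 * devConst < 3 / 16 * massConst := by
      unfold devConst
      nlinarith [capConst_le]
    have : 0 < t * a ^ 4 := by positivity
    nlinarith

/-- At a regular sample the curvature along a rotation of two comparable large coordinates is
negative. -/
lemma IsRegular.curvature_neg (hY : IsRegular θ μ τ Y) (ha : Admissible n θ μ)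
    (hq : ∑ l, q l ^ 2 = 1) {i j : Fin n} (hij : i ≠ j) (hmax : ∀ l, |q l| ≤ |q i|)
    (hle' : q i ^ 2 ≤ 2 * q j ^ 2) :
    (q i ^ 2 * empHess μ Y q j j - 2 * (q i * q j) * empHess μ Y q i j +
        q j ^ 2 * empHess μ Y q i i) / μ -
      (q i * empGrad μ Y q i + q j * empGrad μ Y q j) < 0 := by
  have hn : 0 < n := Fin.pos i
  have hn' : (0 : ℝ) < n := by exact_mod_cast hn
  have hn1 : (1 : ℝ) ≤ n := by exact_mod_cast hn
  have hθ := ha.theta_pos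
  have hμ := ha.mu_pos
  have hm := massConst_pos
  have hκ := capConst_pos
  have hle := hmax j
  have hpop := popHess_rotation_le θ ha.mu_pos (ha.mu_le_one hn) ha.theta_le hq hij
    (sq_le_sq.2 hle) hle'
  have hb := abs_le_one_of_sum_sq hq
  have hi1 := one_le_card_mul_sq hq hmax
  have hμa : μ ≤ |q i| := by
    refine abs_le_of_sq_le_sq' ?_ (abs_nonneg _) |>.2
    rw [sq_abs]
    have h1 := ha.mul_mu_le_one
    have h2 := ha.mu_le_one hn
    have : n * μ ^ 2 ≤ n * q i ^ 2 := by nlinarith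
    exact le_of_mul_le_mul_left this hn'
  set ε := devConst * μ * θ / n with hε
  have hε0 : 0 ≤ ε := by have := devConst_pos; positivity
  have e_jj := hY.hess q j j hb
  have e_ij := hY.hess q i j hb
  have e_ii := hY.hess q i i hb
  have g_i := hY.grad q i hb
  have g_j := hY.grad q j hb
  rw [← hε] at e_jj e_ij e_ii g_i g_j
  have habs : |q i * q j| ≤ q i ^ 2 := by
    rw [abs_mul, ← sq_abs (q i)]; nlinarith [abs_nonneg (q i)]
  have hjj : q j ^ 2 ≤ q i ^ 2 := sq_le_sq.2 hle
  have n1 : q i ^ 2 * (empHess μ Y q j j - popHess θ μ q j j) ≤ q i ^ 2 * ε :=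
    mul_le_mul_of_nonneg_left ((le_abs_self _).trans e_jj) (sq_nonneg _)
  have n2 : q j ^ 2 * (empHess μ Y q i i - popHess θ μ q i i) ≤ q i ^ 2 * ε :=
    (mul_le_mul_of_nonneg_left ((le_abs_self _).trans e_ii) (sq_nonneg _)).trans (by gcongr)
  have n3 : -((q i * q j) * (empHess μ Y q i j - popHess θ μ q i j)) ≤ q i ^ 2 * ε := by
    refine (neg_le_abs _).trans ?_
    rw [abs_mul]; gcongr
  have n4 : -(q i * (empGrad μ Y q i - popGrad θ μ q i)) ≤ |q i| * ε := by
    refine (neg_le_abs _).trans ?_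
    rw [abs_mul]; gcongr
  have n5 : -(q j * (empGrad μ Y q j - popGrad θ μ q j)) ≤ |q i| * ε := by
    refine (neg_le_abs _).trans ?_
    rw [abs_mul]; gcongr
  have n6 : (q i ^ 2 * (empHess μ Y q j j - popHess θ μ q j j) -
      2 * (q i * q j) * (empHess μ Y q i j - popHess θ μ q i j) +
      q j ^ 2 * (empHess μ Y q i i - popHess θ μ q i i)) / μ ≤ 4 * q i ^ 2 * ε / μ := by
    gcongr; linarith
  obtain ⟨n7, n8⟩ := noise_le_curvature hn' hθ hμ hμa hi1
  exact rotation_curvature_combine hpop n6 n4 n5 n7 n8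

/-- The cap around the axis of `eᵢ`. -/
def InCap (μ : ℝ) (q : Fin n → ℝ) (i : Fin n) : Prop :=
  ∀ j ≠ i, |q j| ≤ capConst * μ / n

/-- The off-axis squares sum to at most nμ²/4 ≤ 1/4. The radius cμ is left free because the bound is
also needed with c = 1/2, before membership in the cap is known. -/
lemma InCap.sq_ge (ha : Admissible n θ μ) (hq : ∑ l, q l ^ 2 = 1) {i : Fin n}
    {c : ℝ} (hc : c ≤ 1 / 2) (h : ∀ j ≠ i, |q j| ≤ c * μ) : 3 / 4 ≤ q i ^ 2 := by
  have hn : 0 < n := Fin.pos i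
  have hμ := ha.mu_pos
  have h1 : ∀ j ∈ Finset.univ.erase i, q j ^ 2 ≤ μ ^ 2 / 4 := by
    intro j hj
    have h2 := h j (Finset.ne_of_mem_erase hj)
    rw [← sq_abs]
    have h3 : |q j| ≤ μ / 2 := by nlinarith
    nlinarith [abs_nonneg (q j)]
  have h2 := Finset.sum_le_card_nsmul _ _ _ h1
  have hcard : ((Finset.univ.erase i).card : ℝ) ≤ n := by
    have := Finset.card_le_univ (Finset.univ.erase i)
    rw [Fintype.card_fin] at this
    exact_mod_cast this
  rw [← Finset.add_sum_erase _ _ (Finset.mem_univ i)] at hq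
  rw [nsmul_eq_mul] at h2
  have h3 := ha.mul_sq_le_one hn
  have h4 : ((Finset.univ.erase i).card : ℝ) * (μ ^ 2 / 4) ≤ n * (μ ^ 2 / 4) := by gcongr
  linarith

lemma InCap.three_fourths_le (ha : Admissible n θ μ) (hq : ∑ l, q l ^ 2 = 1) {i : Fin n}
    (h : InCap μ q i) : 3 / 4 ≤ q i ^ 2 := by
  have hn : 0 < n := Fin.pos i
  have hn1 : (1 : ℝ) ≤ n := by exact_mod_cast hn
  have hκ := capConst_pos
  have hμ := ha.mu_pos
  refine InCap.sq_ge (c := capConst) ha hq (by linarith [capConst_le]) fun j hj => (h j hj).trans ?_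
  exact div_le_self (by positivity) hn1

lemma InCap.half_le_abs (ha : Admissible n θ μ) (hq : ∑ l, q l ^ 2 = 1) {i : Fin n}
    (h : InCap μ q i) : 1 / 2 ≤ |q i| := by
  have h1 := h.three_fourths_le ha hq
  rw [← sq_abs] at h1
  nlinarith [abs_nonneg (q i)]

/-- Second order stationary points lie in the caps around the signed basis vectors. -/
lemma IsRegular.exists_inCap (hY : IsRegular θ μ τ Y) (ha : Admissible n θ μ)
    (hn : 0 < n) (hq : ∑ l, q l ^ 2 = 1)
    (hc : ∀ i j, i ≠ j → q i * empGrad μ Y q j = q j * empGrad μ Y q i)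
    (hcurv : ∀ i j, i ≠ j → 0 ≤ (q i ^ 2 * empHess μ Y q j j -
      2 * (q i * q j) * empHess μ Y q i j + q j ^ 2 * empHess μ Y q i i) / μ -
      (q i * empGrad μ Y q i + q j * empGrad μ Y q j)) :
    ∃ i, InCap μ q i := by
  have hn' : (0 : ℝ) < n := by exact_mod_cast hn
  have hn1 : (1 : ℝ) ≤ n := by exact_mod_cast hn
  have hμ := ha.mu_pos
  have hκ := capConst_pos
  obtain ⟨i, -, hi⟩ := Finset.exists_max_image Finset.univ (fun l => |q l|)
    ⟨⟨0, hn⟩, Finset.mem_univ _⟩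
  have hmax : ∀ l, |q l| ≤ |q i| := fun l => hi l (Finset.mem_univ l)
  have hi1 := one_le_card_mul_sq hq hmax
  have hi0 : q i ≠ 0 := by
    rintro h
    rw [h] at hi1
    norm_num at hi1
  -- The second order condition excludes coordinates comparable to the largest one.
  have hsmall : ∀ j ≠ i, 2 * q j ^ 2 < q i ^ 2 := by
    intro j hj
    by_contra hcon
    exact absurd (hcurv i j hj.symm) (not_le.2
      (hY.curvature_neg ha hq hj.symm hmax (not_lt.1 hcon)))
  have hmul : ∀ j ≠ i, |q j| * (q i ^ 2 - q j ^ 2) ≤ capConst * μ / (4 * n) := fun j hj =>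
    hY.abs_mul_sub_le ha hq hj.symm hi0 (hmax j) (hc i j hj.symm)
  -- Bootstrap: the crude gap q_i² - q_j² ≥ 1/(2n) already yields |q_j| ≤ μ/2. Hence q_i² ≥ 3/4, the
  -- gap is at least 1/4, and the same inequality gives the full radius of the cap.
  have hfirst : ∀ j ≠ i, |q j| ≤ 1 / 2 * μ := by
    intro j hj
    have h1 := hmul j hj
    have h2 := hsmall j hj
    have h3 : |q j| * (1 / (2 * n)) ≤ |q j| * (q i ^ 2 - q j ^ 2) := by
      gcongr
      rw [div_le_iff₀ (by positivity)]
      nlinarith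
    have h4 : |q j| * (1 / (2 * n)) ≤ (capConst * μ / 2) * (1 / (2 * n)) :=
      (h3.trans h1).trans (le_of_eq (by field_simp; ring))
    have h5 := le_of_mul_le_mul_right h4 (by positivity)
    nlinarith [capConst_le]
  have hbig := InCap.sq_ge ha hq le_rfl hfirst
  refine ⟨i, fun j hj => ?_⟩
  have h1 := hmul j hj
  have h2 := hsmall j hj
  have hq1 := abs_le_one_of_sum_sq hq i
  have hq2 : q i ^ 2 ≤ 1 := by rw [← sq_abs]; nlinarith [abs_nonneg (q i)]
  have h3 : |q j| * (1 / 4) ≤ |q j| * (q i ^ 2 - q j ^ 2) := by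
    gcongr
    linarith
  have h4 : capConst * μ / (4 * n) = capConst * μ / n * (1 / 4) := by field_simp
  linarith

lemma hasDerivAt_sum_empGrad (d : Fin n → ℝ) (t : ℝ) :
    HasDerivAt (fun t => ∑ j, empGrad μ Y (fun l => q l + t * d l) j * d j)
      ((∑ j, ∑ l, empHess μ Y (fun l => q l + t * d l) j l * (d j * d l)) / μ) t := by
  have hz : ∀ k, HasDerivAt (fun t => (∑ l, (q l + t * d l) * Y l k) / μ)
      ((∑ l, d l * Y l k) / μ) t := by
    intro k
    refine HasDerivAt.div_const (HasDerivAt.fun_sum fun l _ => ?_) μ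
    have := (((hasDerivAt_id t).mul_const (d l)).const_add (q l)).mul_const (Y l k)
    simpa using this
  have hT : ∀ j, HasDerivAt (fun t => empGrad μ Y (fun l => q l + t * d l) j * d j)
      ((1 / p * ∑ k, sechSq ((∑ l, (q l + t * d l) * Y l k) / μ) * ((∑ l, d l * Y l k) / μ) *
        Y j k) * d j) t := by
    intro j
    refine HasDerivAt.mul_const (HasDerivAt.const_mul _ (HasDerivAt.fun_sum fun k _ => ?_)) _
    exact ((hasDerivAt_tanh _).comp t (hz k)).mul_const _
  refine (HasDerivAt.fun_sum fun j _ => hT j).congr_deriv ?_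
  simp only [empHess, Finset.mul_sum, Finset.sum_mul, Finset.sum_div]
  refine Finset.sum_congr rfl fun j _ => ?_
  rw [Finset.sum_comm]
  refine Finset.sum_congr rfl fun l _ => Finset.sum_congr rfl fun k _ => ?_
  ring

/-- Strong monotonicity of the gradient in a cap. -/
lemma IsRegular.monotone_in_cap (hY : IsRegular θ μ τ Y) (ha : Admissible n θ μ)
    (hq : ∑ l, q l ^ 2 = 1) (hq' : ∑ l, q' l ^ 2 = 1) {i : Fin n} (h : InCap μ q i)
    (h' : InCap μ q' i) (hs : 0 < q i * q' i) :
    θ / (16 * μ) * ∑ j ∈ Finset.univ.erase i, (q j - q' j) ^ 2 ≤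
        ∑ j, (empGrad μ Y q j - empGrad μ Y q' j) * (q j - q' j) ∧
      (q i - q' i) ^ 2 ≤ ∑ j ∈ Finset.univ.erase i, (q j - q' j) ^ 2 := by
  have hn : 0 < n := Fin.pos i
  have hn' : (0 : ℝ) < n := by exact_mod_cast hn
  have hn1 : (1 : ℝ) ≤ n := by exact_mod_cast hn
  have hμ := ha.mu_pos
  have hμ1 := ha.mu_le_one hn
  have hθ := ha.theta_pos
  have hκ := capConst_pos
  have hκ1 := capConst_le
  set d : Fin n → ℝ := fun j => q j - q' j with hd
  set D := ∑ j ∈ Finset.univ.erase i, d j ^ 2 with hD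
  set A := ∑ j ∈ Finset.univ.erase i, |d j| with hA
  have hD0 : 0 ≤ D := Finset.sum_nonneg fun j _ => sq_nonneg _
  have hA0 : 0 ≤ A := Finset.sum_nonneg fun j _ => abs_nonneg _
  have hAD : A ^ 2 ≤ n * D := by
    have h1 := sq_sum_le_card_mul_sum_sq (s := Finset.univ.erase i) (f := fun j => |d j|)
    simp only [sq_abs] at h1
    have hcard : ((Finset.univ.erase i).card : ℝ) ≤ n := by
      have := Finset.card_le_univ (Finset.univ.erase i)
      rw [Fintype.card_fin] at this
      exact_mod_cast this
    exact h1.trans (by gcongr)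
  set ρ := capConst * μ / n with hρ
  have hρ0 : 0 ≤ ρ := by positivity
  -- Both points have norm one, so the sum of d_j(q_j + q'_j) vanishes. As |q_i + q'_i| ≥ 1, the
  -- axial difference is controlled by the off-axis ones with a factor of the size of the cap.
  have hdi : |d i| ≤ 2 * ρ * A := by
    have e1 : d i * (q i + q' i) = -∑ j ∈ Finset.univ.erase i, d j * (q j + q' j) := by
      have : ∑ j, d j * (q j + q' j) = 0 := by
        have : ∀ j, d j * (q j + q' j) = q j ^ 2 - q' j ^ 2 := fun j => by rw [hd]; ring
        simp_rw [this]
        rw [Finset.sum_sub_distrib, hq, hq', sub_self]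
      rw [← Finset.add_sum_erase _ _ (Finset.mem_univ i)] at this
      linarith
    have e2 : 1 ≤ |q i + q' i| := by
      have a := h.half_le_abs ha hq
      have b := h'.half_le_abs ha hq'
      rcases pos_and_pos_or_neg_and_neg_of_mul_pos hs with ⟨p1, p2⟩ | ⟨p1, p2⟩
      · rw [abs_of_pos p1] at a; rw [abs_of_pos p2] at b
        exact le_trans (by linarith) (le_abs_self _)
      · rw [abs_of_neg p1] at a; rw [abs_of_neg p2] at b
        exact le_trans (by linarith) (neg_le_abs _)
    have e3 : |∑ j ∈ Finset.univ.erase i, d j * (q j + q' j)| ≤ 2 * ρ * A := by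
      rw [hA, Finset.mul_sum]
      refine (Finset.abs_sum_le_sum_abs _ _).trans (Finset.sum_le_sum fun j hj => ?_)
      have hj' := Finset.ne_of_mem_erase hj
      rw [abs_mul, mul_comm]
      gcongr
      refine (abs_add_le _ _).trans ?_
      have := h j hj'
      have := h' j hj'
      linarith
    calc |d i| ≤ |d i| * |q i + q' i| := le_mul_of_one_le_right (abs_nonneg _) e2
      _ = |∑ j ∈ Finset.univ.erase i, d j * (q j + q' j)| := by rw [← abs_mul, e1, abs_neg]
      _ ≤ _ := e3
  have hdA : |d i| * A ≤ 1 / 40 * D := by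
    calc |d i| * A ≤ 2 * ρ * A * A := by gcongr
      _ = 2 * ρ * A ^ 2 := by ring
      _ ≤ 2 * ρ * (n * D) := by gcongr
      _ = 2 * capConst * μ * D := by rw [hρ]; field_simp
      _ ≤ 1 / 40 * D := by
        gcongr
        nlinarith
  have hdi2 : d i ^ 2 ≤ D := by
    have h1 : |d i| ^ 2 ≤ (2 * ρ * A) * |d i| := by
      rw [pow_two]; exact mul_le_mul_of_nonneg_right hdi (abs_nonneg _)
    have h2 : 2 * ρ ≤ 1 := by
      have : ρ ≤ capConst * μ := div_le_self (by positivity) hn1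
      nlinarith
    rw [← sq_abs]
    have h3 : 0 ≤ |d i| * A := by positivity
    nlinarith
  refine ⟨?_, hdi2⟩
  -- Mean value theorem along the straight segment. It leaves the sphere, which is why regularity is
  -- required on the whole cube.
  obtain ⟨t, ht, hder⟩ := exists_hasDerivAt_eq_slope
    (fun t => ∑ j, empGrad μ Y (fun l => q' l + t * d l) j * d j)
    (fun t => (∑ j, ∑ l, empHess μ Y (fun l => q' l + t * d l) j l * (d j * d l)) / μ)
    (zero_lt_one' ℝ) (fun t _ => (hasDerivAt_sum_empGrad d t).continuousAt.continuousWithinAt)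
    fun t _ => hasDerivAt_sum_empGrad d t
  set u : Fin n → ℝ := fun l => q' l + t * d l with hu
  have huc : ∀ l, u l = (1 - t) * q' l + t * q l := fun l => by rw [hu, hd]; ring
  have hconv : ∀ l r, |q l| ≤ r → |q' l| ≤ r → |u l| ≤ r := by
    intro l r h1 h2
    rw [huc]
    refine (abs_add_le _ _).trans ?_
    rw [abs_mul, abs_mul, abs_of_pos ht.1, abs_of_pos (sub_pos.2 ht.2)]
    have := ht.1
    have := ht.2
    nlinarith
  have hu1 : ∀ l, |u l| ≤ 1 := fun l =>
    hconv l 1 (abs_le_one_of_sum_sq hq l) (abs_le_one_of_sum_sq hq' l)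
  have hur : ∀ l ≠ i, |u l / μ| ≤ capConst / n := by
    intro l hl
    rw [abs_div, abs_of_pos hμ, div_le_iff₀ hμ]
    calc _ ≤ ρ := hconv l ρ (h l hl) (h' l hl)
      _ = _ := by rw [hρ]; ring
  have hr : n * (capConst / n) ^ 2 * hessConst ≤ 1 / 10 := by
    have e : n * (capConst / n) ^ 2 * hessConst = capConst ^ 2 * hessConst / n := by field_simp
    rw [e]
    exact (div_le_self (mul_nonneg (sq_nonneg _) hessConst_nonneg) hn1).trans
      capConst_sq_mul_hessConst_le
  have hpop := popHess_quadratic_ge (θ := θ) i ha.theta_le hr hur d hdA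
  rw [← hD] at hpop
  set ε := devConst * μ * θ / n with hε
  -- The 1/n in ε pays for the factor n that Cauchy–Schwarz produces from (∑ |d_j|)².
  have hnoise : ∑ j, ∑ l, popHess θ μ u j l * (d j * d l) - ε * (∑ j, |d j|) ^ 2 ≤
      ∑ j, ∑ l, empHess μ Y u j l * (d j * d l) := by
    have e : ε * (∑ j, |d j|) ^ 2 = ∑ j, ∑ l, ε * (|d j| * |d l|) := by
      rw [pow_two, Finset.sum_mul_sum, Finset.mul_sum]
      simp_rw [Finset.mul_sum]
    rw [e, ← Finset.sum_sub_distrib]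
    refine Finset.sum_le_sum fun j _ => ?_
    rw [← Finset.sum_sub_distrib]
    refine Finset.sum_le_sum fun l _ => ?_
    have h1 : |(empHess μ Y u j l - popHess θ μ u j l) * (d j * d l)| ≤ ε * (|d j| * |d l|) := by
      rw [abs_mul, abs_mul]
      have := hY.hess u j l hu1
      gcongr
    have := neg_abs_le ((empHess μ Y u j l - popHess θ μ u j l) * (d j * d l))
    linarith
  have hA' : (∑ j, |d j|) ^ 2 ≤ n * (2 * D) := by
    have h1 := sq_sum_le_card_mul_sum_sq (s := Finset.univ) (f := fun j => |d j|)
    simp only [sq_abs, Finset.card_univ, Fintype.card_fin] at h1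
    refine h1.trans ?_
    rw [← Finset.add_sum_erase _ _ (Finset.mem_univ i)]
    gcongr
    linarith
  have hε0 : 0 ≤ ε := by have := devConst_pos; positivity
  have hε1 : ε * (∑ j, |d j|) ^ 2 ≤ θ / 16 * D := by
    calc _ ≤ ε * (n * (2 * D)) := by gcongr
      _ = 2 * devConst * μ * θ * D := by rw [hε]; field_simp
      _ ≤ 2 * (1 / 2560) * 1 * θ * D := by
        have : devConst ≤ 1 / 2560 := by
          unfold devConst; linarith [capConst_mul_massConst_le]
        have := devConst_pos
        gcongr
      _ ≤ _ := by nlinarith [mul_nonneg hθ.le hD0]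
  have hfin : θ / 16 * D ≤ ∑ j, ∑ l, empHess μ Y u j l * (d j * d l) := by linarith
  have hdiv : θ / (16 * μ) * D ≤ (∑ j, ∑ l, empHess μ Y u j l * (d j * d l)) / μ := by
    rw [le_div_iff₀ hμ]
    calc θ / (16 * μ) * D * μ = θ / 16 * D := by field_simp
      _ ≤ _ := hfin
  rw [hder] at hdiv
  refine hdiv.trans (le_of_eq ?_)
  have e1 : (fun l => q' l + 1 * d l) = q := by ext l; rw [hd]; ring
  have e0 : (fun l => q' l + 0 * d l) = q' := by ext l; ring
  simp only [e1, e0, sub_zero, div_one, ← Finset.sum_sub_distrib, ← sub_mul]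
  rfl

/-- The Lagrange multiplier form of criticality. -/
lemma empGrad_eq_multiplier (hq : ∑ l, q l ^ 2 = 1)
    (hc : ∀ i j, i ≠ j → q i * empGrad μ Y q j = q j * empGrad μ Y q i) (j : Fin n) :
    empGrad μ Y q j = (∑ l, q l * empGrad μ Y q l) * q j := by
  calc empGrad μ Y q j = (∑ l, q l ^ 2) * empGrad μ Y q j := by rw [hq, one_mul]
    _ = ∑ l, q l * (q l * empGrad μ Y q j) := by
      rw [Finset.sum_mul]; exact Finset.sum_congr rfl fun l _ => by ring
    _ = ∑ l, q l * (q j * empGrad μ Y q l) := by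
      refine Finset.sum_congr rfl fun l _ => ?_
      by_cases h : l = j
      · rw [h]
      · rw [hc l j h]
    _ = _ := by rw [Finset.sum_mul]; exact Finset.sum_congr rfl fun l _ => by ring

lemma IsRegular.abs_empGrad_le (hY : IsRegular θ μ τ Y) (ha : Admissible n θ μ)
    (hq : ∑ l, q l ^ 2 = 1) (j : Fin n) : |empGrad μ Y q j| ≤ 2 := by
  have hn : 0 < n := Fin.pos j
  have hn1 : (1 : ℝ) ≤ n := by exact_mod_cast hn
  have h1 := hY.grad q j (abs_le_one_of_sum_sq hq)
  have h2 := abs_popGrad_le θ μ q j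
  have hd := devConst_pos
  have hμ := ha.mu_pos
  have hθ := ha.theta_pos
  have h3 : devConst * μ * θ / n ≤ 1 := by
    refine (div_le_self (by positivity) hn1).trans ?_
    have a1 : devConst ≤ 1 := by unfold devConst; linarith [capConst_mul_massConst_le]
    have a2 := ha.mu_le_one hn
    have a3 := ha.theta_le
    have : devConst * μ ≤ 1 := by nlinarith
    nlinarith
  have e : empGrad μ Y q j = (empGrad μ Y q j - popGrad θ μ q j) + popGrad θ μ q j := by ring
  rw [e]
  exact (abs_add_le _ _).trans (by linarith)

lemma IsRegular.abs_multiplier_le (hY : IsRegular θ μ τ Y) (ha : Admissible n θ μ)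
    (hq : ∑ l, q l ^ 2 = 1) : |∑ l, q l * empGrad μ Y q l| ≤ 2 * n := by
  refine (Finset.abs_sum_le_sum_abs _ _).trans ?_
  calc _ ≤ ∑ _l : Fin n, (2 : ℝ) := by
        refine Finset.sum_le_sum fun l _ => ?_
        rw [abs_mul]
        have h1 := abs_le_one_of_sum_sq hq l
        have h2 := hY.abs_empGrad_le ha hq l
        nlinarith [abs_nonneg (empGrad μ Y q l), abs_nonneg (q l)]
    _ = _ := by simp; ring

/-- Each half cap contains at most one critical point. -/
lemma IsRegular.eq_of_inCap (hY : IsRegular θ μ τ Y) (ha : Admissible n θ μ)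
    (hq : ∑ l, q l ^ 2 = 1) (hq' : ∑ l, q' l ^ 2 = 1) {i : Fin n} (h : InCap μ q i)
    (h' : InCap μ q' i) (hs : 0 < q i * q' i)
    (hc : ∀ i j, i ≠ j → q i * empGrad μ Y q j = q j * empGrad μ Y q i)
    (hc' : ∀ i j, i ≠ j → q' i * empGrad μ Y q' j = q' j * empGrad μ Y q' i) : q = q' := by
  have hn : 0 < n := Fin.pos i
  have hμ := ha.mu_pos
  obtain ⟨h1, h2⟩ := hY.monotone_in_cap ha hq hq' h h' hs
  set D := ∑ j ∈ Finset.univ.erase i, (q j - q' j) ^ 2 with hD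
  set a := ∑ l, q l * empGrad μ Y q l with haa
  set b := ∑ l, q' l * empGrad μ Y q' l with hbb
  have hD0 : 0 ≤ D := Finset.sum_nonneg fun j _ => sq_nonneg _
  have htot : ∑ j, (q j - q' j) ^ 2 = (q i - q' i) ^ 2 + D := by
    rw [← Finset.add_sum_erase _ _ (Finset.mem_univ i)]
  have hdot : ∑ j, (q j - q' j) ^ 2 = 2 - 2 * ∑ j, q j * q' j := by
    have : ∀ j, (q j - q' j) ^ 2 = q j ^ 2 + q' j ^ 2 - 2 * (q j * q' j) := fun j => by ring
    simp_rw [this]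
    rw [Finset.sum_sub_distrib, Finset.sum_add_distrib, hq, hq', ← Finset.mul_sum]
    ring
  -- At critical points the gradients are aq and bq', and ⟨aq - bq', q - q'⟩ = (a + b)|q - q'|²/2
  -- for unit vectors.
  have hlhs : ∑ j, (empGrad μ Y q j - empGrad μ Y q' j) * (q j - q' j) =
      (a + b) * ((∑ j, (q j - q' j) ^ 2) / 2) := by
    have e : ∀ j, (empGrad μ Y q j - empGrad μ Y q' j) * (q j - q' j) =
        a * q j ^ 2 + b * q' j ^ 2 - (a + b) * (q j * q' j) := by
      intro j
      rw [empGrad_eq_multiplier hq hc j, empGrad_eq_multiplier hq' hc' j]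
      ring
    simp_rw [e]
    rw [hdot, Finset.sum_sub_distrib, Finset.sum_add_distrib, ← Finset.mul_sum, ← Finset.mul_sum,
      ← Finset.mul_sum, hq, hq']
    ring
  have hab : a + b ≤ 4 * n := by
    have := (le_abs_self _).trans (hY.abs_multiplier_le ha hq)
    have := (le_abs_self _).trans (hY.abs_multiplier_le ha hq')
    linarith
  -- Otherwise strong monotonicity would give θ/(16μ) ≤ 4n, contradicting 128nμ < θ.
  have hDz : D = 0 := by
    by_contra hne
    have hDpos : 0 < D := lt_of_le_of_ne hD0 (Ne.symm hne)
    rw [hlhs] at h1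
    have h3 : (a + b) * ((∑ j, (q j - q' j) ^ 2) / 2) ≤ 4 * n * D := by
      have h4 : 0 ≤ (∑ j, (q j - q' j) ^ 2) / 2 := by positivity
      refine (mul_le_mul_of_nonneg_right hab h4).trans ?_
      gcongr
      linarith
    have h5 : θ / (16 * μ) ≤ 4 * n := le_of_mul_le_mul_right (h1.trans h3) hDpos
    rw [div_le_iff₀ (by positivity)] at h5
    have := ha.mu_lt
    have : 0 ≤ (n : ℝ) * μ := by positivity
    linarith
  have hall : ∑ j, (q j - q' j) ^ 2 = 0 :=
    le_antisymm (by linarith) (Finset.sum_nonneg fun j _ => sq_nonneg _)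
  rw [Finset.sum_eq_zero_iff_of_nonneg fun j _ => sq_nonneg _] at hall
  ext j
  have := hall j (Finset.mem_univ j)
  have := pow_eq_zero_iff (two_ne_zero) |>.1 this
  linarith

lemma empGrad_neg (j : Fin n) : empGrad μ Y (-q) j = -empGrad μ Y q j := by
  unfold empGrad
  rw [← mul_neg, ← Finset.sum_neg_distrib]
  congr 1
  refine Finset.sum_congr rfl fun k _ => ?_
  simp [neg_div, Real.tanh_neg]

/-- The distance from a critical point in a cap to the corresponding signed basis vector. -/
lemma IsRegular.sum_erase_sq_le (hY : IsRegular θ μ τ Y) (ha : Admissible n θ μ)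
    (hτ : 0 ≤ τ) (hq : ∑ l, q l ^ 2 = 1) {i : Fin n} (h : InCap μ q i)
    (hc : ∀ i j, i ≠ j → q i * empGrad μ Y q j = q j * empGrad μ Y q i) {s : ℝ}
    (hs : s = 1 ∨ s = -1) (hpos : 0 < s * q i) :
    Real.sqrt (∑ j ∈ Finset.univ.erase i, q j ^ 2) ≤ 32 * μ / θ * (Real.sqrt n * τ) := by
  have hn : 0 < n := Fin.pos i
  have hn1 : (1 : ℝ) ≤ n := by exact_mod_cast hn
  have hμ := ha.mu_pos
  have hθ := ha.theta_pos
  have hκ := capConst_pos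
  have hs2 : s ^ 2 = 1 := by rcases hs with rfl | rfl <;> norm_num
  set b : Fin n → ℝ := s • Pi.single i 1 with hb
  have hbi : b i = s := by simp [hb]
  have hbj : ∀ j ≠ i, b j = 0 := fun j hj => by simp [hb, hj]
  have hbsum : ∑ l, b l ^ 2 = 1 := by
    rw [← Finset.add_sum_erase _ _ (Finset.mem_univ i), hbi, Finset.sum_eq_zero, hs2, add_zero]
    intro l hl
    rw [hbj l (Finset.ne_of_mem_erase hl)]; ring
  have hbcap : InCap μ b i := fun j hj => by rw [hbj j hj, abs_zero]; positivity
  -- The signed basis vector b lies in the cap but need not be critical; its off-axis gradient, at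
  -- most τ, is the source of the error.
  obtain ⟨h1, -⟩ := hY.monotone_in_cap ha hq hbsum h hbcap (by rw [hbi]; linarith)
  set D := ∑ j ∈ Finset.univ.erase i, q j ^ 2 with hD
  have hDeq : ∑ j ∈ Finset.univ.erase i, (q j - b j) ^ 2 = D := by
    refine Finset.sum_congr rfl fun j hj => ?_
    rw [hbj j (Finset.ne_of_mem_erase hj), sub_zero]
  rw [hDeq] at h1
  have hD0 : 0 ≤ D := Finset.sum_nonneg fun j _ => sq_nonneg _
  have hqi : q i ^ 2 + D = 1 := by
    rw [hD, Finset.add_sum_erase _ (fun j => q j ^ 2) (Finset.mem_univ i), hq]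
  set η := 1 - s * q i with hη
  have hsq : s * q i ≤ 1 := by
    have : (s * q i) ^ 2 ≤ 1 := by rw [mul_pow, hs2]; linarith
    nlinarith
  have hη0 : 0 ≤ η := by rw [hη]; linarith
  -- The axial defect is quadratic: 1 - s q_i ≤ 1 - q_i² = D, so the multiplier terms are of order
  -- nD.
  have hηD : η ≤ D := by
    have : (s * q i) ^ 2 = q i ^ 2 := by rw [mul_pow, hs2, one_mul]
    rw [hη]; nlinarith
  set lam := ∑ l, q l * empGrad μ Y q l with hlam
  have hlhs : ∑ j, (empGrad μ Y q j - empGrad μ Y b j) * (q j - b j) =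
      lam * η - empGrad μ Y b i * (q i - s) -
        ∑ j ∈ Finset.univ.erase i, empGrad μ Y b j * q j := by
    have e1 : ∑ j, empGrad μ Y q j * (q j - b j) = lam * η := by
      have e : ∀ j, empGrad μ Y q j * (q j - b j) = lam * (q j ^ 2 - b j * q j) := fun j => by
        rw [empGrad_eq_multiplier hq hc j]; ring
      simp_rw [e]
      rw [← Finset.mul_sum, Finset.sum_sub_distrib, hq, hη]
      congr 2
      rw [← Finset.add_sum_erase _ _ (Finset.mem_univ i), hbi, Finset.sum_eq_zero, add_zero]
      intro l hl
      rw [hbj l (Finset.ne_of_mem_erase hl), zero_mul]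
    have e2 : ∑ j, empGrad μ Y b j * (q j - b j) = empGrad μ Y b i * (q i - s) +
        ∑ j ∈ Finset.univ.erase i, empGrad μ Y b j * q j := by
      rw [← Finset.add_sum_erase _ _ (Finset.mem_univ i), hbi]
      congr 1
      refine Finset.sum_congr rfl fun j hj => ?_
      rw [hbj j (Finset.ne_of_mem_erase hj), sub_zero]
    simp_rw [sub_mul]
    rw [Finset.sum_sub_distrib, e1, e2]
    ring
  have hbτ : ∀ j ∈ Finset.univ.erase i, |empGrad μ Y b j| ≤ τ := by
    intro j hj
    have := hY.basis i j (Finset.ne_of_mem_erase hj).symm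
    rcases hs with rfl | rfl
    · rwa [hb, one_smul]
    · rwa [hb, neg_one_smul, empGrad_neg, abs_neg]
  have t1 : lam * η ≤ 2 * n * D := by
    have := (le_abs_self _).trans (hY.abs_multiplier_le ha hq)
    calc lam * η ≤ 2 * n * η := by gcongr
      _ ≤ _ := by gcongr
  have t2 : -(empGrad μ Y b i * (q i - s)) ≤ 2 * n * D := by
    refine (neg_le_abs _).trans ?_
    have e : |q i - s| = η := by
      have : q i - s = -(s * η) := by rw [hη]; linear_combination (-q i) * hs2
      rw [this, abs_neg, abs_mul, abs_of_nonneg hη0]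
      rcases hs with rfl | rfl <;> simp
    rw [abs_mul, e]
    have := hY.abs_empGrad_le ha hbsum i
    calc |empGrad μ Y b i| * η ≤ 2 * D := by gcongr
      _ ≤ _ := by nlinarith
  have t3 : -∑ j ∈ Finset.univ.erase i, empGrad μ Y b j * q j ≤
      τ * (Real.sqrt n * Real.sqrt D) := by
    refine (neg_le_abs _).trans ((Finset.abs_sum_le_sum_abs _ _).trans ?_)
    calc _ ≤ ∑ j ∈ Finset.univ.erase i, τ * |q j| := by
          refine Finset.sum_le_sum fun j hj => ?_
          rw [abs_mul]
          have := hbτ j hj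
          gcongr
      _ = τ * ∑ j ∈ Finset.univ.erase i, |q j| := by rw [Finset.mul_sum]
      _ ≤ _ := by
          gcongr
          rw [← Real.sqrt_mul (by positivity)]
          refine Real.le_sqrt_of_sq_le ?_
          have h1 := sq_sum_le_card_mul_sum_sq (s := Finset.univ.erase i) (f := fun j => |q j|)
          simp only [sq_abs] at h1
          have hcard : ((Finset.univ.erase i).card : ℝ) ≤ n := by
            have := Finset.card_le_univ (Finset.univ.erase i)
            rw [Fintype.card_fin] at this
            exact_mod_cast this
          exact h1.trans (by gcongr)
  rw [hlhs] at h1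
  have h2 : θ / (16 * μ) * D ≤ 4 * n * D + τ * (Real.sqrt n * Real.sqrt D) := by linarith
  -- The multiplier terms consume half of the monotonicity constant; this is the use of the number
  -- 128 in `mu_lt`.
  have h3 : 4 * n * D ≤ θ / (32 * μ) * D := by
    gcongr
    rw [le_div_iff₀ (by positivity)]
    have := ha.mu_lt
    linarith
  have h4 : θ / (32 * μ) * D ≤ τ * (Real.sqrt n * Real.sqrt D) := by
    have e : θ / (16 * μ) * D = θ / (32 * μ) * D + θ / (32 * μ) * D := by field_simp; ring
    linarith
  rcases hD0.eq_or_lt with hz | hDpos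
  · rw [← hz, Real.sqrt_zero]; positivity
  have hsD := Real.sqrt_pos.2 hDpos
  have h5 : θ / (32 * μ) * Real.sqrt D * Real.sqrt D ≤ τ * Real.sqrt n * Real.sqrt D := by
    rw [mul_assoc, Real.mul_self_sqrt hD0]; linarith
  have h6 := le_of_mul_le_mul_right h5 hsD
  calc Real.sqrt D = 32 * μ / θ * (θ / (32 * μ) * Real.sqrt D) := by field_simp
    _ ≤ 32 * μ / θ * (τ * Real.sqrt n) := by gcongr
    _ = _ := by ring

lemma InCap.sqrt_sum_erase_sq_le (ha : Admissible n θ μ) {i : Fin n} (h : InCap μ q i) :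
    Real.sqrt (∑ j ∈ Finset.univ.erase i, q j ^ 2) ≤ μ / 16 := by
  have hn : 0 < n := Fin.pos i
  have hn1 : (1 : ℝ) ≤ n := by exact_mod_cast hn
  have hμ := ha.mu_pos
  have hκ := capConst_pos
  rw [Real.sqrt_le_left (by positivity)]
  have h1 : ∀ j ∈ Finset.univ.erase i, q j ^ 2 ≤ (capConst * μ / n) ^ 2 := fun j hj => by
    rw [← sq_abs]; have := h j (Finset.ne_of_mem_erase hj); gcongr
  have h2 := Finset.sum_le_card_nsmul _ _ _ h1
  have hcard : ((Finset.univ.erase i).card : ℝ) ≤ n := by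
    have := Finset.card_le_univ (Finset.univ.erase i)
    rw [Fintype.card_fin] at this
    exact_mod_cast this
  rw [nsmul_eq_mul] at h2
  calc _ ≤ _ := h2
    _ ≤ n * (capConst * μ / n) ^ 2 := by gcongr
    _ = (capConst * μ) ^ 2 / n := by field_simp
    _ ≤ (capConst * μ) ^ 2 := div_le_self (by positivity) hn1
    _ ≤ _ := by
      have := capConst_le
      have : capConst * μ ≤ μ / 16 := by nlinarith
      gcongr

end

/-! ### Rotations in coordinate planes -/

open Filter Topology

lemma eventually_lt_of_hasDerivAt_neg {f : ℝ → ℝ} {d : ℝ} (hf : HasDerivAt f d 0) (hd : d < 0) :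
    ∀ᶠ t in 𝓝[>] (0 : ℝ), f t < f 0 := by
  have h := (hasDerivAt_iff_tendsto_slope.1 hf).mono_left
    (nhdsWithin_mono (0 : ℝ) (fun t (ht : 0 < t) => ht.ne'))
  filter_upwards [h.eventually (gt_mem_nhds hd), self_mem_nhdsWithin] with t ht h0
  have h0 : 0 < t := h0
  rw [slope_def_field, sub_zero, div_neg_iff] at ht
  rcases ht with ht | ht <;> linarith [ht.1, ht.2]

/-- The second order necessary condition for a local minimum. -/
lemma nonneg_of_isLocalMin {f g : ℝ → ℝ} {c : ℝ} (hf : ∀ t, HasDerivAt f (g t) t)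
    (hg : HasDerivAt g c 0) (h : IsLocalMin f 0) : 0 ≤ c := by
  by_contra hc
  have hfg : deriv f = g := funext fun t => (hf t).deriv
  have h0 : g 0 = 0 := h.hasDerivAt_eq_zero (hf 0)
  -- A negative second derivative would make the point a local maximum as well, so f would be
  -- locally constant and its second derivative zero.
  have hmax : IsLocalMax f 0 := by
    refine isLocalMax_of_deriv_deriv_neg ?_ ?_ (hf 0).continuousAt
    · rw [hfg, hg.deriv]; exact not_le.1 hc
    · rw [hfg, h0]
  have hconst : f =ᶠ[𝓝 0] fun _ => f 0 := by
    filter_upwards [h, hmax] with t h1 h2 using le_antisymm h2 h1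
  have := hconst.deriv.deriv_eq
  rw [hfg, hg.deriv] at this
  simp at this
  exact hc this.ge

section
variable {n p : ℕ}

/-- The rotation of `q` by the angle `t` in the plane of the coordinates `i` and `j`. -/
noncomputable def rotate (q : Fin n → ℝ) (i j : Fin n) (t : ℝ) : Fin n → ℝ := fun l =>
  if l = i then q i * Real.cos t - q j * Real.sin t
  else if l = j then q j * Real.cos t + q i * Real.sin t else q l

variable {q : Fin n → ℝ} {i j : Fin n} {μ : ℝ} {Y : Matrix (Fin n) (Fin p) ℝ}

lemma rotate_fst (t : ℝ) : rotate q i j t i = q i * Real.cos t - q j * Real.sin t := by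
  simp [rotate]

lemma rotate_snd (hij : i ≠ j) (t : ℝ) :
    rotate q i j t j = q j * Real.cos t + q i * Real.sin t := by
  simp [rotate, hij.symm]

lemma rotate_of_ne {l : Fin n} (hi : l ≠ i) (hj : l ≠ j) (t : ℝ) : rotate q i j t l = q l := by
  simp [rotate, hi, hj]

lemma rotate_zero : rotate q i j 0 = q := by
  ext l
  by_cases hi : l = i
  · subst hi; simp [rotate]
  · by_cases hj : l = j
    · subst hj; simp [rotate, hi]
    · simp [rotate, hi, hj]

lemma sum_rotate_sq (hij : i ≠ j) (t : ℝ) : ∑ l, rotate q i j t l ^ 2 = ∑ l, q l ^ 2 := by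
  rw [← sub_eq_zero, ← Finset.sum_sub_distrib, Finset.sum_eq_add i j hij]
  · rw [rotate_fst, rotate_snd hij]
    linear_combination (q i ^ 2 + q j ^ 2) * Real.cos_sq_add_sin_sq t
  · intro l _ hl
    rw [rotate_of_ne hl.1 hl.2, sub_self]
  · simp
  · simp

lemma hasDerivAt_rotate_fst (hij : i ≠ j) (t : ℝ) :
    HasDerivAt (fun t => rotate q i j t i) (-rotate q i j t j) t := by
  simp_rw [rotate_fst, rotate_snd hij]
  exact (((Real.hasDerivAt_cos t).const_mul (q i)).sub
    ((Real.hasDerivAt_sin t).const_mul (q j))).congr_deriv (by ring)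

lemma hasDerivAt_rotate_snd (hij : i ≠ j) (t : ℝ) :
    HasDerivAt (fun t => rotate q i j t j) (rotate q i j t i) t := by
  simp_rw [rotate_fst, rotate_snd hij]
  exact (((Real.hasDerivAt_cos t).const_mul (q j)).add
    ((Real.hasDerivAt_sin t).const_mul (q i))).congr_deriv (by ring)

lemma sum_rotate_mul (hij : i ≠ j) (y : Fin n → ℝ) (t : ℝ) :
    ∑ l, rotate q i j t l * y l =
      (rotate q i j t i - q i) * y i + (rotate q i j t j - q j) * y j + ∑ l, q l * y l := by
  rw [← sub_eq_iff_eq_add, ← Finset.sum_sub_distrib, Finset.sum_eq_add i j hij]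
  · ring
  · intro l _ hl
    rw [rotate_of_ne hl.1 hl.2, sub_self]
  · simp
  · simp

lemma hasDerivAt_sum_rotate_mul (hij : i ≠ j) (y : Fin n → ℝ) (t : ℝ) :
    HasDerivAt (fun t => ∑ l, rotate q i j t l * y l)
      (rotate q i j t i * y j - rotate q i j t j * y i) t := by
  simp_rw [sum_rotate_mul hij]
  exact (((((hasDerivAt_rotate_fst hij t).sub_const _).mul_const _).add
    (((hasDerivAt_rotate_snd hij t).sub_const _).mul_const _)).add_const _).congr_deriv (by ring)

lemma continuous_rotate (hij : i ≠ j) : Continuous (rotate q i j) := by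
  refine continuous_pi fun l => ?_
  by_cases hi : l = i
  · subst hi
    exact continuous_iff_continuousAt.2 fun t => (hasDerivAt_rotate_fst hij t).continuousAt
  · by_cases hj : l = j
    · subst hj
      exact continuous_iff_continuousAt.2 fun t => (hasDerivAt_rotate_snd hij t).continuousAt
    · simp_rw [rotate_of_ne hi hj]
      exact continuous_const

/-! ### Derivatives of the objective along rotations -/

lemma hasDerivAt_smoothAbs (hμ : μ ≠ 0) (z : ℝ) :
    HasDerivAt (smoothAbs μ) (Real.tanh (z / μ)) z := by
  have h := ((((hasDerivAt_id z).div_const μ).cosh.log (Real.cosh_pos _).ne').const_mul μ)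
  refine h.congr_deriv ?_
  rw [Real.tanh_eq_sinh_div_cosh]
  have := (Real.cosh_pos (z / μ)).ne'
  simp only [id]
  field_simp

lemma continuous_objective (hμ : μ ≠ 0) : Continuous (objective μ Y) := by
  have h : Continuous (smoothAbs μ) :=
    continuous_iff_continuousAt.2 fun z => (hasDerivAt_smoothAbs hμ z).continuousAt
  unfold objective
  fun_prop

lemma hasDerivAt_objective_rotate (hμ : μ ≠ 0) (hij : i ≠ j) (t : ℝ) :
    HasDerivAt (fun t => objective μ Y (WithLp.toLp 2 (rotate q i j t)))
      (rotate q i j t i * empGrad μ Y (rotate q i j t) j -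
        rotate q i j t j * empGrad μ Y (rotate q i j t) i) t := by
  have h : ∀ k, HasDerivAt (fun t => smoothAbs μ (∑ l, rotate q i j t l * Y l k))
      (Real.tanh ((∑ l, rotate q i j t l * Y l k) / μ) *
        (rotate q i j t i * Y j k - rotate q i j t j * Y i k)) t := fun k =>
    (hasDerivAt_smoothAbs hμ _).comp t (hasDerivAt_sum_rotate_mul hij (fun l => Y l k) t)
  refine ((HasDerivAt.fun_sum fun k _ => h k).const_mul (1 / (p : ℝ))).congr_deriv ?_
  unfold empGrad
  simp only [Finset.mul_sum, ← Finset.sum_sub_distrib]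
  exact Finset.sum_congr rfl fun k _ => by ring

lemma hasDerivAt_empGrad_rotate (hij : i ≠ j) (m : Fin n) (t : ℝ) :
    HasDerivAt (fun t => empGrad μ Y (rotate q i j t) m)
      ((rotate q i j t i * empHess μ Y (rotate q i j t) j m -
        rotate q i j t j * empHess μ Y (rotate q i j t) i m) / μ) t := by
  have h : ∀ k, HasDerivAt (fun t => Real.tanh ((∑ l, rotate q i j t l * Y l k) / μ) * Y m k)
      (sechSq ((∑ l, rotate q i j t l * Y l k) / μ) *
        ((rotate q i j t i * Y j k - rotate q i j t j * Y i k) / μ) * Y m k) t := fun k =>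
    ((hasDerivAt_tanh _).comp t
      ((hasDerivAt_sum_rotate_mul hij (fun l => Y l k) t).div_const μ)).mul_const _
  refine ((HasDerivAt.fun_sum fun k _ => h k).const_mul (1 / (p : ℝ))).congr_deriv ?_
  unfold empHess
  simp only [Finset.mul_sum, ← Finset.sum_sub_distrib, Finset.sum_div]
  exact Finset.sum_congr rfl fun k _ => by ring

lemma mem_sphere_toLp {v : Fin n → ℝ} :
    WithLp.toLp 2 v ∈ Metric.sphere (0 : EuclideanSpace ℝ (Fin n)) 1 ↔ ∑ l, v l ^ 2 = 1 := by
  rw [mem_sphere_zero_iff_norm, EuclideanSpace.norm_eq, Real.sqrt_eq_one]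
  simp

lemma isLocalMin_rotate (hij : i ≠ j) (h : WithLp.toLp 2 q ∈ sphereLocalMinimizers μ Y) :
    IsLocalMin (fun t => objective μ Y (WithLp.toLp 2 (rotate q i j t))) 0 := by
  have hc : Continuous fun t => (WithLp.toLp 2 (rotate q i j t) : EuclideanSpace ℝ (Fin n)) :=
    (PiLp.continuous_toLp 2 _).comp (continuous_rotate hij)
  have ht : Tendsto (fun t => (WithLp.toLp 2 (rotate q i j t) : EuclideanSpace ℝ (Fin n))) (𝓝 0)
      (𝓝[Metric.sphere (0 : EuclideanSpace ℝ (Fin n)) 1] (WithLp.toLp 2 q)) := by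
    refine tendsto_nhdsWithin_iff.2 ⟨?_, Eventually.of_forall fun t => ?_⟩
    · have := hc.tendsto 0
      rwa [rotate_zero] at this
    · rw [mem_sphere_toLp, sum_rotate_sq hij]
      exact mem_sphere_toLp.1 h.1
  have := ht.eventually h.2
  filter_upwards [this] with t ht
  rwa [rotate_zero]

/-- First order condition at a local minimizer. -/
lemma mul_empGrad_eq (hμ : μ ≠ 0) (h : WithLp.toLp 2 q ∈ sphereLocalMinimizers μ Y)
    (i j : Fin n) (hij : i ≠ j) : q i * empGrad μ Y q j = q j * empGrad μ Y q i := by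
  have := (isLocalMin_rotate hij h).hasDerivAt_eq_zero (hasDerivAt_objective_rotate hμ hij 0)
  rw [rotate_zero] at this
  linarith

/-- Second order condition at a local minimizer. -/
lemma curvature_nonneg (hμ : μ ≠ 0) (h : WithLp.toLp 2 q ∈ sphereLocalMinimizers μ Y)
    (i j : Fin n) (hij : i ≠ j) :
    0 ≤ (q i ^ 2 * empHess μ Y q j j - 2 * (q i * q j) * empHess μ Y q i j +
        q j ^ 2 * empHess μ Y q i i) / μ -
      (q i * empGrad μ Y q i + q j * empGrad μ Y q j) := by
  refine nonneg_of_isLocalMin (hasDerivAt_objective_rotate hμ hij) ?_ (isLocalMin_rotate hij h)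
  refine (((hasDerivAt_rotate_fst hij 0).mul (hasDerivAt_empGrad_rotate hij j 0)).sub
    ((hasDerivAt_rotate_snd hij 0).mul (hasDerivAt_empGrad_rotate hij i 0))).congr_deriv ?_
  have hs : empHess μ Y q j i = empHess μ Y q i j := by
    unfold empHess
    simp_rw [mul_comm (Y j _) (Y i _)]
  simp only [rotate_zero, hs]
  ring

/-! ### The local minimizers at a regular sample -/

variable {θ : unitInterval} {τ : ℝ}

/-- On the boundary of a cap the objective decreases towards the axis. -/
lemma IsRegular.rotation_pos (hY : IsRegular θ μ τ Y) (ha : Admissible n θ μ)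
    (hq : ∑ l, q l ^ 2 = 1) (h : InCap μ q i) (hij : i ≠ j) (hj : |q j| = capConst * μ / n) :
    0 < (q i * q j) * (q i * empGrad μ Y q j - q j * empGrad μ Y q i) := by
  have hn : 0 < n := Fin.pos i
  have hn' : (0 : ℝ) < n := by exact_mod_cast hn
  have hn1 : (1 : ℝ) ≤ n := by exact_mod_cast hn
  have hθ := ha.theta_pos
  have hμ := ha.mu_pos
  have hm := massConst_pos
  have hκ := capConst_pos
  have hi2 := h.three_fourths_le ha hq
  have hia := h.half_le_abs ha hq
  have hj0 : 0 < |q j| := by rw [hj]; positivity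
  have hj1 : |q j| ≤ 1 / 80 := by
    rw [hj]
    refine (div_le_self (by positivity) hn1).trans ?_
    have := ha.mu_le_one hn
    have := capConst_le
    nlinarith
  have hle : |q j| ≤ |q i| := by linarith
  obtain ⟨S, hS, hpop⟩ := le_popGrad_rotation θ hμ (ha.mu_le_one hn) ha.theta_le hq hij
    (sq_le_sq.2 hle)
  have hnoise := hY.abs_rotation_sub_le hq hle
  rw [hpop] at hnoise
  set D := q i * empGrad μ Y q j - q j * empGrad μ Y q i
  have hS' : θ * massConst / 8 ≤ S := by
    refine le_trans ?_ hS
    have : q j ^ 2 ≤ 1 / 4 := by rw [← sq_abs]; nlinarith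
    have : 0 < θ * massConst := by positivity
    nlinarith
  have h1 : (q i * q j) ^ 2 * S - |q i * q j| * (|q i| * (2 * (devConst * μ * θ / n))) ≤
      (q i * q j) * D := by
    have e : (q i * q j) * D = (q i * q j) ^ 2 * S + (q i * q j) * (D - q i * q j * S) := by ring
    have h2 := neg_abs_le ((q i * q j) * (D - q i * q j * S))
    rw [abs_mul] at h2
    have h3 := mul_le_mul_of_nonneg_left hnoise (abs_nonneg (q i * q j))
    linarith
  refine lt_of_lt_of_le ?_ h1
  have e : (q i * q j) ^ 2 * S - |q i * q j| * (|q i| * (2 * (devConst * μ * θ / n))) =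
      |q i| ^ 2 * |q j| * (|q j| * S - 2 * (devConst * μ * θ / n)) := by
    rw [← sq_abs (q i * q j), abs_mul]; ring
  rw [e]
  -- On the boundary |q_j| equals the radius, and there the noise is at most half of the signal.
  have h4 : 2 * (devConst * μ * θ / n) < |q j| * S := by
    calc 2 * (devConst * μ * θ / n) = capConst * μ / n * (θ * massConst / 16) := by
          unfold devConst; ring
      _ < capConst * μ / n * (θ * massConst / 8) := by
          gcongr
          have : 0 < θ * massConst := by positivity
          linarith
      _ ≤ |q j| * S := by rw [hj]; gcongr
  have : 0 < |q i| := by linarith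
  have := sub_pos.2 h4
  positivity

lemma isCompact_cap (i : Fin n) (s r : ℝ) :
    IsCompact {v : EuclideanSpace ℝ (Fin n) | v ∈ Metric.sphere (0 : EuclideanSpace ℝ (Fin n)) 1 ∧
      (∀ j ≠ i, |v j| ≤ r) ∧ 0 ≤ s * v i} := by
  refine (isCompact_sphere (0 : EuclideanSpace ℝ (Fin n)) 1).inter_right (IsClosed.inter ?_ ?_)
  · have : {v : EuclideanSpace ℝ (Fin n) | ∀ j ≠ i, |v j| ≤ r} =
        ⋂ j, ⋂ (_ : j ≠ i), {v : EuclideanSpace ℝ (Fin n) | |v j| ≤ r} := by ext; simp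
    change IsClosed {v : EuclideanSpace ℝ (Fin n) | ∀ j ≠ i, |v j| ≤ r}
    rw [this]
    exact isClosed_iInter fun j => isClosed_iInter fun _ =>
      isClosed_le (PiLp.continuous_apply 2 _ j).abs continuous_const
  · exact isClosed_le continuous_const (continuous_const.mul (PiLp.continuous_apply 2 _ i))

/-- Each half cap contains a local minimizer. -/
lemma IsRegular.exists_mem_sphereLocalMinimizers (hY : IsRegular θ μ τ Y)
    (ha : Admissible n θ μ) (i : Fin n) {s : ℝ} (hs : s = 1 ∨ s = -1) :
    ∃ q : Fin n → ℝ, WithLp.toLp 2 q ∈ sphereLocalMinimizers μ Y ∧ InCap μ q i ∧ 0 < s * q i := by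
  have hn : 0 < n := Fin.pos i
  have hn' : (0 : ℝ) < n := by exact_mod_cast hn
  have hμ := ha.mu_pos
  have hκ := capConst_pos
  set ρ := capConst * μ / n with hρ
  have hρ0 : 0 < ρ := by positivity
  have hs2 : s ^ 2 = 1 := by rcases hs with rfl | rfl <;> norm_num
  obtain ⟨w, ⟨hw1, hw2, hw3⟩, hmin⟩ := (isCompact_cap i s ρ).exists_isMinOn
    ⟨WithLp.toLp 2 (s • Pi.single i 1), by
      refine ⟨mem_sphere_toLp.2 ?_, fun j hj => ?_, ?_⟩
      · rw [Finset.sum_eq_single i]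
        · simp [hs2]
        · intro j _ hj; simp [hj]
        · simp
      · simp [hj, hρ0.le]
      · simp only [Pi.smul_apply, Pi.single_eq_same, smul_eq_mul, mul_one]
        nlinarith⟩
    (continuous_objective hμ.ne').continuousOn (f := objective μ Y)
  obtain ⟨q, rfl⟩ : ∃ q, w = WithLp.toLp 2 q := ⟨w.ofLp, rfl⟩
  have hq := mem_sphere_toLp.1 hw1
  have hcap : InCap μ q i := hw2
  have hi2 := hcap.three_fourths_le ha hq
  have hpos : 0 < s * q i := by
    refine lt_of_le_of_ne hw3 fun h0 => ?_
    have : (s * q i) ^ 2 = q i ^ 2 := by rw [mul_pow, hs2, one_mul]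
    rw [← h0] at this
    linarith
  have hlt : ∀ j ≠ i, |q j| < ρ := by
    intro j hj
    refine lt_of_le_of_ne (hcap j hj) fun heq => ?_
    have hD := hY.rotation_pos ha hq hcap hj.symm heq
    -- Rotating with speed -w decreases the objective by `hD` and makes q_j² decrease with
    -- derivative -2w². So a point with |q_j| on the boundary can be moved within the cap to a
    -- smaller value.
    set w := q i * q j with hw
    have hlin : HasDerivAt (fun t : ℝ => -w * t) (-w) 0 := by
      simpa using (hasDerivAt_id (0 : ℝ)).const_mul (-w)
    have hz : -w * (0 : ℝ) = 0 := mul_zero _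
    have d1 : HasDerivAt (fun t => objective μ Y (WithLp.toLp 2 (rotate q i j (-w * t))))
        ((q i * empGrad μ Y q j - q j * empGrad μ Y q i) * -w) 0 := by
      have := hasDerivAt_objective_rotate (q := q) (Y := Y) hμ.ne' hj.symm (-w * 0)
      have := this.comp 0 hlin
      simpa only [hz, rotate_zero, Function.comp_def] using this
    have d2 : HasDerivAt (fun t => rotate q i j (-w * t) j ^ 2) (2 * q j * (q i * -w)) 0 := by
      have := hasDerivAt_rotate_snd (q := q) hj.symm (-w * 0)
      refine (((this.comp 0 hlin).fun_pow 2)).congr_deriv ?_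
      simp only [Function.comp_apply, hz, rotate_zero, pow_one, Nat.cast_ofNat,
        Nat.add_one_sub_one]
    have e1 := eventually_lt_of_hasDerivAt_neg d1 (by linarith)
    have e2 := eventually_lt_of_hasDerivAt_neg d2 (by
      have : 0 < w ^ 2 := by
        have : w ≠ 0 := by rintro h; rw [h, zero_mul] at hD; exact lt_irrefl _ hD
        positivity
      rw [hw] at this ⊢
      linarith)
    have e3 : ∀ᶠ t in 𝓝[>] (0 : ℝ), 0 < s * rotate q i j (-w * t) i := by
      refine nhdsWithin_le_nhds ?_
      have hc : ContinuousAt (fun t : ℝ => s * rotate q i j (-w * t) i) 0 := by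
        have h1 : Continuous fun t : ℝ => rotate q i j (-w * t) i :=
          (continuous_apply i).comp ((continuous_rotate hj.symm).comp (by fun_prop))
        exact (continuous_const.mul h1).continuousAt
      refine hc.eventually (lt_mem_nhds ?_)
      simpa only [hz, rotate_zero] using hpos
    obtain ⟨t, h1, h2, h3⟩ := (e1.and (e2.and e3)).exists
    rw [hz, rotate_zero] at h1 h2
    refine absurd (hmin (a := WithLp.toLp 2 (rotate q i j (-w * t))) ⟨?_, ?_, h3.le⟩) (not_le.2 h1)
    · rw [mem_sphere_toLp, sum_rotate_sq hj.symm, hq]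
    · intro l hl
      by_cases hlj : l = j
      · subst hlj
        exact (sq_lt_sq.1 h2).le.trans heq.le
      · change |rotate q i j (-w * t) l| ≤ ρ
        rw [rotate_of_ne hl hlj]
        exact hcap l hl
  refine ⟨q, ⟨hw1, ?_⟩, hcap, hpos⟩
  have hU : ∀ᶠ v : EuclideanSpace ℝ (Fin n) in 𝓝 (WithLp.toLp 2 q),
      (∀ j ≠ i, |v j| < ρ) ∧ 0 < s * v i := by
    refine Eventually.and (eventually_all.2 fun j => ?_) ?_
    · by_cases hj : j = i
      · exact Eventually.of_forall fun v h => absurd hj h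
      · have hc : Continuous fun v : EuclideanSpace ℝ (Fin n) => |v j| := by fun_prop
        filter_upwards [hc.continuousAt.eventually (gt_mem_nhds (hlt j hj))] with v hv _ using hv
    · have hc : Continuous fun v : EuclideanSpace ℝ (Fin n) => s * v i := by fun_prop
      exact hc.continuousAt.eventually (lt_mem_nhds hpos)
  filter_upwards [nhdsWithin_le_nhds hU, self_mem_nhdsWithin] with v hv hv1
  exact hmin ⟨hv1, fun j hj => (hv.1 j hj).le, hv.2.le⟩

/-- `q` lies in the half cap around the signed basis vector `b`. -/
def InHalfCap (μ : ℝ) (q b : EuclideanSpace ℝ (Fin n)) : Prop :=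
  ∃ (i : Fin n) (s : ℝ), (s = 1 ∨ s = -1) ∧ b = s • EuclideanSpace.single i 1 ∧
    InCap μ q.ofLp i ∧ 0 < s * q i

lemma InHalfCap.unique (ha : Admissible n θ μ) {q b b' : EuclideanSpace ℝ (Fin n)}
    (hq : q ∈ Metric.sphere (0 : EuclideanSpace ℝ (Fin n)) 1) (h : InHalfCap μ q b)
    (h' : InHalfCap μ q b') : b = b' := by
  obtain ⟨i, s, hs, rfl, hc, hp⟩ := h
  obtain ⟨i', s', hs', rfl, hc', hp'⟩ := h'
  have hq1 : ∑ l, q l ^ 2 = 1 := mem_sphere_toLp.1 hq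
  obtain rfl : i = i' := by
    by_contra hne
    have h1 := hc.three_fourths_le ha hq1
    have h2 := hc'.three_fourths_le ha hq1
    have h3 := Finset.sum_le_univ_sum_of_nonneg (s := {i, i'}) fun l => sq_nonneg (q l)
    rw [Finset.sum_pair hne, hq1] at h3
    linarith
  congr 1
  rcases hs with rfl | rfl <;> rcases hs' with rfl | rfl <;> first | rfl | (exfalso; linarith)

/-- With u = s q_i in (0, 1] the axial error satisfies (1 - u)² ≤ 1 - u², the off-axis mass. Thus
the squared distance at most doubles, whence √2. -/
lemma norm_sub_smul_single_le {q : EuclideanSpace ℝ (Fin n)} (hq : ∑ l, q l ^ 2 = 1) {s : ℝ}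
    (hs : s = 1 ∨ s = -1) {i : Fin n} (hpos : 0 < s * q i) :
    ‖q - s • EuclideanSpace.single i 1‖ ≤
      Real.sqrt 2 * Real.sqrt (∑ j ∈ Finset.univ.erase i, q j ^ 2) := by
  have hs2 : s ^ 2 = 1 := by rcases hs with rfl | rfl <;> norm_num
  rw [EuclideanSpace.norm_eq, ← Real.sqrt_mul (by norm_num)]
  refine Real.sqrt_le_sqrt ?_
  rw [← Finset.add_sum_erase _ _ (Finset.mem_univ i)]
  have e : ∑ j ∈ Finset.univ.erase i, ‖(q - s • EuclideanSpace.single i (1 : ℝ)) j‖ ^ 2 =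
      ∑ j ∈ Finset.univ.erase i, q j ^ 2 := by
    refine Finset.sum_congr rfl fun j hj => ?_
    simp [Finset.ne_of_mem_erase hj]
  rw [e]
  have hD := Finset.add_sum_erase Finset.univ (fun j => q j ^ 2) (Finset.mem_univ i)
  rw [hq] at hD
  have hD0 : 0 ≤ ∑ j ∈ Finset.univ.erase i, q j ^ 2 := Finset.sum_nonneg fun j _ => sq_nonneg _
  have e1 : ‖(q - s • EuclideanSpace.single i (1 : ℝ)) i‖ ^ 2 = (q i - s) ^ 2 := by
    simp
  have e2 : (s * q i) ^ 2 = q i ^ 2 := by rw [mul_pow, hs2, one_mul]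
  rw [e1]
  have : s * q i ≤ 1 := by nlinarith
  nlinarith

lemma encard_signedBasis : (signedBasis n).encard = 2 * n := by
  have e : signedBasis n = Set.range (fun i : Fin n => EuclideanSpace.single i (1 : ℝ)) ∪
      Set.range (fun i : Fin n => -EuclideanSpace.single i (1 : ℝ)) := by
    ext b
    simp only [signedBasis, Set.mem_ofPred_eq, Set.mem_union, Set.mem_range, eq_comm (a := b)]
    exact exists_or
  have hinj : Function.Injective fun i : Fin n => EuclideanSpace.single i (1 : ℝ) := by
    intro i j h
    by_contra hne
    have := congrArg (fun v : EuclideanSpace ℝ (Fin n) => v i) h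
    simp [hne] at this
  have hinj' : Function.Injective fun i : Fin n => -EuclideanSpace.single i (1 : ℝ) :=
    neg_injective.comp hinj
  rw [e, Set.encard_union_eq]
  · rw [← Set.image_univ, ← Set.image_univ, hinj.encard_image, hinj'.encard_image,
      Set.encard_univ, ENat.card_eq_coe_fintype_card, Fintype.card_fin, two_mul]
  · rw [Set.disjoint_left]
    rintro _ ⟨i, rfl⟩ ⟨j, h⟩
    have := congrArg (fun v : EuclideanSpace ℝ (Fin n) => v i) h
    simp only [PiLp.neg_apply, PiLp.single_apply, if_true] at this
    split_ifs at this <;> norm_num at this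

/-- At a regular sample the local minimizers correspond to the signed basis vectors. -/
theorem IsRegular.exists_equiv (hY : IsRegular θ μ τ Y) (ha : Admissible n θ μ) (hn : 0 < n)
    (hτ : 0 ≤ τ) :
    (sphereLocalMinimizers μ Y).encard = 2 * n ∧
      ∃ φ : sphereLocalMinimizers μ Y ≃ signedBasis n, ∀ q : sphereLocalMinimizers μ Y,
        ‖(q : EuclideanSpace ℝ (Fin n)) - (φ q : EuclideanSpace ℝ (Fin n))‖ ≤
          Real.sqrt 2 * min (32 * μ / θ * (Real.sqrt n * τ)) (μ / 16) := by
  have hμ := ha.mu_pos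
  have hunit : ∀ q : sphereLocalMinimizers μ Y,
      ∑ l, (q : EuclideanSpace ℝ (Fin n)) l ^ 2 = 1 := fun q => mem_sphere_toLp.1 q.2.1
  have hcrit : ∀ q : sphereLocalMinimizers μ Y, ∀ i j, i ≠ j → _ := fun q =>
    mul_empGrad_eq (q := (q : EuclideanSpace ℝ (Fin n)).ofLp) hμ.ne' q.2
  have hex : ∀ q : sphereLocalMinimizers μ Y, ∃ b : signedBasis n, InHalfCap μ q.1 b.1 := by
    intro q
    obtain ⟨i, hi⟩ := hY.exists_inCap ha hn (hunit q) (hcrit q)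
      (curvature_nonneg (q := (q : EuclideanSpace ℝ (Fin n)).ofLp) hμ.ne' q.2)
    have h0 : q.1 i ≠ 0 := by
      have := hi.half_le_abs ha (hunit q)
      intro h
      rw [h, abs_zero] at this
      norm_num at this
    rcases lt_or_gt_of_ne h0 with h | h
    · exact ⟨⟨_, i, Or.inr rfl⟩, i, -1, Or.inr rfl, by simp, hi, by linarith⟩
    · exact ⟨⟨_, i, Or.inl rfl⟩, i, 1, Or.inl rfl, by simp, hi, by linarith⟩
  choose f hf using hex
  -- Two minimizers with the same image share the axis and the sign, hence a half cap, which
  -- contains only one critical point.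
  have hinj : Function.Injective f := by
    intro q q' h
    obtain ⟨i, s, hs, hb, hc, hp⟩ := hf q
    have h' := hf q'
    rw [← h] at h'
    obtain ⟨i', s', hs', hb', hc', hp'⟩ := h'
    have hbb := hb.symm.trans hb'
    obtain rfl : i = i' := by
      by_contra hne
      have := congrArg (fun v : EuclideanSpace ℝ (Fin n) => v i) hbb
      simp [hne] at this
      rcases hs with rfl | rfl <;> norm_num at this
    obtain rfl : s = s' := by
      have := congrArg (fun v : EuclideanSpace ℝ (Fin n) => v i) hbb
      simpa using this
    have hpp : 0 < q.1 i * q'.1 i := by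
      have := mul_pos hp hp'
      rcases hs with rfl | rfl <;> linarith
    have := hY.eq_of_inCap ha (hunit q) (hunit q') hc hc' hpp (hcrit q) (hcrit q')
    exact Subtype.ext (WithLp.ofLp_injective 2 this)
  have hsurj : Function.Surjective f := by
    intro b
    obtain ⟨i, s, hs, hb⟩ : ∃ (i : Fin n) (s : ℝ), (s = 1 ∨ s = -1) ∧
        b.1 = s • EuclideanSpace.single i 1 := by
      obtain ⟨i, h | h⟩ := b.2
      · exact ⟨i, 1, Or.inl rfl, by simpa using h⟩
      · exact ⟨i, -1, Or.inr rfl, by simpa using h⟩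
    obtain ⟨q, hq, hc, hp⟩ := hY.exists_mem_sphereLocalMinimizers ha i hs
    exact ⟨⟨_, hq⟩, Subtype.ext
      (InHalfCap.unique ha hq.1 (hf ⟨_, hq⟩) ⟨i, s, hs, hb, hc, hp⟩)⟩
  refine ⟨(Set.encard_congr (Equiv.ofBijective f ⟨hinj, hsurj⟩)).trans encard_signedBasis,
    Equiv.ofBijective f ⟨hinj, hsurj⟩, fun q => ?_⟩
  change ‖(q : EuclideanSpace ℝ (Fin n)) - (f q : EuclideanSpace ℝ (Fin n))‖ ≤ _
  obtain ⟨i, s, hs, hb, hc, hp⟩ := hf q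
  rw [hb]
  refine (norm_sub_smul_single_le (hunit q) hs hp).trans ?_
  gcongr
  exact le_min (hY.sum_erase_sq_le ha hτ (hunit q) hc (hcrit q) hs hp)
    (hc.sqrt_sum_erase_sq_le ha)

end

/-! ### Random samples are regular -/

section
variable {Ω : Type*} [MeasurableSpace Ω] {P : Measure Ω} [IsProbabilityMeasure P] {n p : ℕ}
  {θ : unitInterval} {μ τ : ℝ} {X : Ω → Matrix (Fin n) (Fin p) ℝ}

lemma devConst_le_one : devConst ≤ 1 := by
  unfold devConst; linarith [capConst_mul_massConst_le]

/-- The probability that an i.i.d. Bernoulli-Gaussian sample is not regular. -/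
theorem measure_not_isRegular_le (hX : IsIIDBernoulliGaussian X θ P) (ha : Admissible n θ μ)
    (hn : 0 < n) (hp : 0 < p) (hτ : 0 ≤ τ) (hτ1 : τ ≤ 1) {N : ℕ}
    (hN : 6144 * n ≤ devConst * μ * θ / n * μ * N) :
    P.real {ω | ¬ IsRegular θ μ τ (X ω)} ≤
      (n + n ^ 2) * ((2 * (2 * N + 1) ^ n + 1) *
        Real.exp (-(p * (devConst * μ * θ / n) ^ 2 / 18432))) +
      n ^ 2 * (2 * Real.exp (-(p * τ ^ 2 / 2048))) := by
  have hn' : (0 : ℝ) < n := by exact_mod_cast hn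
  have hn1 : (1 : ℝ) ≤ n := by exact_mod_cast hn
  have hp' : (0 : ℝ) < p := by exact_mod_cast hp
  have hμ := ha.mu_pos
  have hθ := ha.theta_pos
  have hd := devConst_pos
  obtain ⟨hind, hlaw⟩ := hX.columns
  set ε := devConst * μ * θ / n with hε
  have hε0 : 0 < ε := by positivity
  have hε1 : ε ≤ 1 := by
    refine (div_le_self (by positivity) hn1).trans ?_
    have a1 := devConst_le_one
    have a2 := ha.mu_le_one hn
    have a3 := ha.theta_le
    have : devConst * μ ≤ 1 := by nlinarith
    nlinarith
  set κ := (2 * (2 * (N : ℝ) + 1) ^ n + 1) * Real.exp (-(p * ε ^ 2 / 18432))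
  -- These events are unions over uncountably many q. Only monotonicity and subadditivity of the
  -- measure are used, so their measurability plays no role.
  set G : Fin n → Set Ω := fun j => {ω | ∃ q : Fin n → ℝ, (∀ l, |q l| ≤ 1) ∧
    ε < |empGrad μ (X ω) q j - popGrad θ μ q j|} with hG
  set H : Fin n × Fin n → Set Ω := fun e => {ω | ∃ q : Fin n → ℝ, (∀ l, |q l| ≤ 1) ∧
    ε < |empHess μ (X ω) q e.1 e.2 - popHess θ μ q e.1 e.2|} with hH
  set B : Fin n × Fin n → Set Ω := fun e => {ω | e.1 ≠ e.2 ∧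
    τ < |empGrad μ (X ω) (Pi.single e.1 1) e.2|} with hB
  have hsub : {ω | ¬ IsRegular θ μ τ (X ω)} ⊆ ((⋃ j, G j) ∪ ⋃ e, H e) ∪ ⋃ e, B e := by
    intro ω hω
    by_contra hc
    simp only [Set.mem_union, Set.mem_iUnion, not_or, not_exists] at hc
    obtain ⟨⟨h1, h2⟩, h3⟩ := hc
    refine hω ⟨fun q j hq => ?_, fun q i j hq => ?_, fun i j hij => ?_⟩
    · exact not_lt.1 fun h => h1 j ⟨q, hq, h⟩
    · exact not_lt.1 fun h => h2 (i, j) ⟨q, hq, h⟩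
    · exact not_lt.1 fun h => h3 (i, j) ⟨hij, h⟩
  have hGle : ∀ j, P.real (G j) ≤ κ := fun j =>
    measure_exists_ridgeFun_deviation_le (g := Real.tanh) (W := fun x => x j) (i := j) (j := j)
      hind hlaw hμ continuous_tanh (continuous_apply j) (fun z => (Real.abs_tanh_lt_one z).le)
      abs_tanh_sub_le (abs_eval_le_envelope j) hε0 hε1 hN hp
  have hHle : ∀ e, P.real (H e) ≤ κ := fun e =>
    measure_exists_ridgeFun_deviation_le (g := sechSq) (W := fun x => x e.1 * x e.2) (i := e.1)
      (j := e.2) hind hlaw hμ continuous_sechSq (by fun_prop)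
      (fun z => by rw [abs_of_pos (sechSq_pos z)]; exact sechSq_le_one z)
      abs_sechSq_sub_le (abs_mul_le_envelope e.1 e.2) hε0 hε1 hN hp
  have hBle : ∀ e, P.real (B e) ≤ 2 * Real.exp (-(p * τ ^ 2 / 2048)) := by
    rintro ⟨i, j⟩
    by_cases hij : i = j
    · have : B (i, j) = ∅ := by
        ext ω; simp [hB, hij]
      rw [this, measureReal_empty]
      positivity
    have hW : ∀ x : Fin n → ℝ, |(fun x : Fin n → ℝ => x j) x| ≤ envelope j j x :=
      abs_eval_le_envelope j
    have hz : ∫ x, ridgeFun μ Real.tanh (fun x => x j) (Pi.single i 1) x ∂bgVec θ n = 0 :=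
      popGrad_eq_zero θ μ (Pi.single i 1) (by simp [Ne.symm hij])
    have h := measure_abs_sum_sub_ge_le hind hlaw
      (continuous_ridgeFun (μ := μ) continuous_tanh (continuous_apply j)
        (Pi.single i 1)).measurable (V := envelope j j)
      (abs_ridgeFun_le (fun z => (Real.abs_tanh_lt_one z).le) hW _)
      (integrable_envelope_sq_mul_exp θ j j) (integral_envelope_sq_mul_exp_le θ j j)
      (by norm_num) (integrable_ridgeFun continuous_tanh (continuous_apply j)
        (fun z => (Real.abs_tanh_lt_one z).le) hW _) hτ hτ1
    rw [hz] at h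
    norm_num at h
    refine le_trans (measureReal_mono ?_) h
    rintro ω ⟨-, hω⟩
    have e : ∑ k, ridgeFun μ Real.tanh (fun x => x j) (Pi.single i 1) (fun l => X ω l k) =
        p * empGrad μ (X ω) (Pi.single i 1) j := by
      unfold empGrad ridgeFun
      rw [← mul_assoc, mul_one_div_cancel hp'.ne', one_mul]
    change p * τ ≤ |∑ k, ridgeFun μ Real.tanh (fun x => x j) (Pi.single i 1) (fun l => X ω l k)|
    rw [e, abs_mul, abs_of_pos hp']
    gcongr
  calc _ ≤ P.real (((⋃ j, G j) ∪ ⋃ e, H e) ∪ ⋃ e, B e) := measureReal_mono hsub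
    _ ≤ P.real (⋃ j, G j) + P.real (⋃ e, H e) + P.real (⋃ e, B e) :=
        (measureReal_union_le _ _).trans (by gcongr; exact measureReal_union_le _ _)
    _ ≤ ∑ j, P.real (G j) + ∑ e, P.real (H e) + ∑ e, P.real (B e) := by
        gcongr <;> exact measureReal_iUnion_fintype_le _
    _ ≤ ∑ _j : Fin n, κ + ∑ _e : Fin n × Fin n, κ +
        ∑ _e : Fin n × Fin n, 2 * Real.exp (-(p * τ ^ 2 / 2048)) := by
        gcongr with j _ e _ e _
        · exact hGle j
        · exact hHle e
        · exact hBle e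
    _ = _ := by
        simp only [Finset.sum_const, Finset.card_univ, Fintype.card_prod, Fintype.card_fin,
          nsmul_eq_mul]
        push_cast
        ring

end

/-! ### Choice of the constants -/

/-- The smallness of μ makes the ratio at least 128 > e. The logarithm can then absorb additive
constants. -/
lemma one_le_log_ratio {N t μ : ℝ} (hN : 1 ≤ N) (ht : 0 < t) (ht1 : t ≤ 1 / 2) (hμ : 0 < μ)
    (hμ1 : 128 * N * μ < t) : N ≤ N / (μ * t) ∧ 1 ≤ Real.log (N / (μ * t)) := by
  have h1 : μ ≤ 1 / 128 := by nlinarith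
  have h2 : μ * t ≤ 1 / 128 := by nlinarith
  have h0 : 0 < μ * t := by positivity
  refine ⟨by rw [le_div_iff₀ h0]; nlinarith, ?_⟩
  rw [Real.le_log_iff_exp_le (by positivity)]
  refine (Real.exp_one_lt_d9.le.trans (by norm_num : (2.7182818286 : ℝ) ≤ 128)).trans ?_
  rw [le_div_iff₀ h0]
  linarith

/-- The covering number is absorbed by the exponential for large samples. -/
lemma covering_mul_exp_le {d : ℝ} (hd : 0 < d) (hd1 : d ≤ 1) {n N p : ℕ} {t μ : ℝ} (hn : 0 < n)
    (ht : 0 < t) (ht1 : t ≤ 1 / 2) (hμ : 0 < μ) (hμ1 : 128 * n * μ < t)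
    (hN : (N : ℝ) ≤ 6144 * n / (d * μ * t / n * μ) + 1)
    (hp : (Real.log (12291 / d) + 4) * 36864 / d ^ 2 / (μ ^ 2 * t ^ 2) * n ^ 3 *
      Real.log (n / (μ * t)) ≤ p) :
    (n + n ^ 2) * ((2 * (2 * N + 1) ^ n + 1) * Real.exp (-(p * (d * μ * t / n) ^ 2 / 18432))) ≤
      6 * Real.exp (-(d ^ 2 / 36864 * p * μ ^ 2 * t ^ 2 / n ^ 2)) := by
  have hn1 : (1 : ℝ) ≤ n := by exact_mod_cast hn
  have hn' : (0 : ℝ) < n := by linarith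
  obtain ⟨hx1, hL⟩ := one_le_log_ratio hn1 ht ht1 hμ hμ1
  set x : ℝ := n / (μ * t) with hx
  set L := Real.log x with hL'
  have hx0 : 0 < x := by positivity
  have hexpL : Real.exp L = x := Real.exp_log hx0
  set A := 12291 / d with hA
  have hA0 : 0 < A := by positivity
  have hA1 : 1 ≤ A := by rw [hA, one_le_div hd]; linarith
  have hlogA : 0 ≤ Real.log A := Real.log_nonneg hA1
  -- 12291 = 2 · 6144 + 3, where 3 covers the rounding up of N (counted twice) and the final 1.
  have hNx : 2 * (N : ℝ) + 1 ≤ A * x ^ 2 := by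
    have e1 : 6144 * n / (d * μ * t / n * μ) = 6144 / d * (x ^ 2 * t) := by
      rw [hx]; field_simp
    have e2 : x ^ 2 * t ≤ x ^ 2 := mul_le_of_le_one_right (by positivity) (by linarith)
    have e3 : 6144 / d * (x ^ 2 * t) ≤ 6144 / d * x ^ 2 := by gcongr
    have e4 : 3 ≤ 3 / d * x ^ 2 := by
      have : 3 ≤ 3 / d := by rw [le_div_iff₀ hd]; linarith
      have : 1 ≤ x ^ 2 := one_le_pow₀ (hn1.trans hx1)
      nlinarith
    have e5 : A * x ^ 2 = 2 * (6144 / d * x ^ 2) + 3 / d * x ^ 2 := by rw [hA]; ring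
    rw [e1] at hN
    linarith
  have hAx : A * x ^ 2 ≤ Real.exp ((Real.log A + 2) * L) := by
    have : A * x ^ 2 = Real.exp (Real.log A + 2 * L) := by
      rw [Real.exp_add, Real.exp_log hA0, two_mul, Real.exp_add, hexpL, pow_two]
    rw [this, Real.exp_le_exp]
    nlinarith
  have hpow : (2 * (N : ℝ) + 1) ^ n ≤ Real.exp (n * ((Real.log A + 2) * L)) := by
    rw [Real.exp_nat_mul]
    exact pow_le_pow_left₀ (by positivity) (hNx.trans hAx) n
  have hnn : (n : ℝ) ^ 2 ≤ Real.exp (n * (2 * L)) := by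
    calc (n : ℝ) ^ 2 ≤ x ^ 2 := by gcongr
      _ = Real.exp (2 * L) := by rw [two_mul, Real.exp_add, hexpL, pow_two]
      _ ≤ _ := by rw [Real.exp_le_exp]; nlinarith
  have hcover : (n + (n : ℝ) ^ 2) * (2 * (2 * N + 1) ^ n + 1) ≤
      6 * Real.exp (n * ((Real.log A + 4) * L)) := by
    have h1 : 1 ≤ (2 * (N : ℝ) + 1) ^ n := one_le_pow₀ (by linarith [Nat.cast_nonneg (α := ℝ) N])
    calc _ ≤ (2 * (n : ℝ) ^ 2) * (3 * (2 * N + 1) ^ n) := by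
          gcongr
          · nlinarith
          · linarith
      _ ≤ (2 * Real.exp (n * (2 * L))) * (3 * Real.exp (n * ((Real.log A + 2) * L))) := by gcongr
      _ = 6 * (Real.exp (n * (2 * L)) * Real.exp (n * ((Real.log A + 2) * L))) := by ring
      _ = _ := by rw [← Real.exp_add]; congr 2; ring
  -- The sample size lets the covering entropy use half of the Bernstein exponent; the other half is
  -- the claimed tail. In log A + 4, one 2 comes from x² in the mesh and the other from the n² union
  -- bound.
  have hmain : n * ((Real.log A + 4) * L) ≤ d ^ 2 / 36864 * p * μ ^ 2 * t ^ 2 / n ^ 2 := by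
    calc n * ((Real.log A + 4) * L) = d ^ 2 / 36864 * ((Real.log A + 4) * 36864 / d ^ 2 /
          (μ ^ 2 * t ^ 2) * n ^ 3 * L) * μ ^ 2 * t ^ 2 / n ^ 2 := by field_simp
      _ ≤ _ := by gcongr
  rw [← mul_assoc]
  calc _ ≤ 6 * Real.exp (n * ((Real.log A + 4) * L)) *
        Real.exp (-(p * (d * μ * t / n) ^ 2 / 18432)) := by gcongr
    _ = 6 * Real.exp (n * ((Real.log A + 4) * L) - p * (d * μ * t / n) ^ 2 / 18432) := by
        rw [mul_assoc, ← Real.exp_add, sub_eq_add_neg]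
    _ ≤ _ := by
        gcongr
        have e : (p : ℝ) * (d * μ * t / n) ^ 2 / 18432 =
            2 * (d ^ 2 / 36864 * p * μ ^ 2 * t ^ 2 / n ^ 2) := by
          field_simp; ring
        rw [e]
        linarith

/-- From log p ≤ 2√p, the condition √p ≥ 40960 suffices, and 40960² < 2 · 10⁹. This is the origin of
the additive constant in `sampleConst`. -/
lemma log_div_self_le {p : ℝ} (hp : 2000000000 ≤ p) : 20480 * Real.log p / p ≤ 1 := by
  have hp0 : 0 < p := by linarith
  rw [div_le_one hp0]
  have h1 := Real.log_le_sub_one_of_pos (Real.sqrt_pos.2 hp0)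
  rw [Real.log_sqrt hp0.le] at h1
  have h2 : 40960 ≤ Real.sqrt p := Real.le_sqrt_of_sq_le (by linarith)
  have h3 := Real.mul_self_sqrt hp0.le
  nlinarith

/-- A scaling form of the deviation of a critical point. -/
lemma deviation_scale_le {N p t μ : ℝ} (hN : 0 ≤ N) (ht : 0 < t) (hμ : 0 < μ) :
    32 * μ / t * (Real.sqrt N * Real.sqrt (20480 * Real.log p / p)) ≤
      4608 * μ / t * Real.sqrt (N * Real.log p / p) := by
  have h1 : Real.sqrt N * Real.sqrt (20480 * Real.log p / p) =
      Real.sqrt 20480 * Real.sqrt (N * Real.log p / p) := by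
    rw [← Real.sqrt_mul hN, ← Real.sqrt_mul (by norm_num)]
    congr 1; ring
  -- 144² = 20736, and 32 · 144 = 4608.
  have h2 : Real.sqrt 20480 ≤ 144 := Real.sqrt_le_iff.2 ⟨by norm_num, by norm_num⟩
  rw [h1]
  calc _ ≤ 32 * μ / t * (144 * Real.sqrt (N * Real.log p / p)) := by gcongr
    _ = _ := by ring

lemma admissible_of_lt {n : ℕ} {θ : unitInterval} {μ : ℝ} (hn : 0 < n) (hθ : 0 < (θ : ℝ))
    (hθ1 : (θ : ℝ) < 1 / 2) (hμ : 0 < μ) (h : μ < 1 / 128 * θ * (n : ℝ)⁻¹) :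
    Admissible n θ μ := by
  have hn' : (0 : ℝ) < n := by exact_mod_cast hn
  refine ⟨hθ, hθ1.le, hμ, ?_⟩
  rw [← div_eq_mul_inv, lt_div_iff₀ hn'] at h
  linarith

/-- The sample size constant. -/
noncomputable def sampleConst : ℝ :=
  2000000000 + (Real.log (12291 / devConst) + 4) * 36864 / devConst ^ 2

lemma log_devConst_nonneg : 0 ≤ (Real.log (12291 / devConst) + 4) * 36864 / devConst ^ 2 := by
  have hd := devConst_pos
  have : 0 ≤ Real.log (12291 / devConst) := by
    refine Real.log_nonneg ?_
    rw [one_le_div hd]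
    linarith [devConst_le_one]
  positivity

lemma sampleConst_le {n p : ℕ} {t μ : ℝ} (hn : 0 < n) (ht : 0 < t) (ht1 : t ≤ 1 / 2) (hμ : 0 < μ)
    (hμ1 : 128 * n * μ < t)
    (hp : sampleConst / (μ ^ 2 * t ^ 2) * n ^ 3 * Real.log (n / (μ * t)) ≤ p) :
    2000000000 ≤ (p : ℝ) ∧ (Real.log (12291 / devConst) + 4) * 36864 / devConst ^ 2 /
      (μ ^ 2 * t ^ 2) * n ^ 3 * Real.log (n / (μ * t)) ≤ p := by
  have hn1 : (1 : ℝ) ≤ n := by exact_mod_cast hn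
  obtain ⟨-, hL⟩ := one_le_log_ratio hn1 ht ht1 hμ hμ1
  have hc := log_devConst_nonneg
  have hL0 : 0 ≤ Real.log (n / (μ * t)) := by linarith
  refine ⟨le_trans ?_ hp, le_trans ?_ hp⟩
  · have h1 : μ * t ≤ 1 := by nlinarith
    have h2 : μ ^ 2 * t ^ 2 ≤ 1 := by rw [← mul_pow]; exact pow_le_one₀ (by positivity) h1
    have h3 : 2000000000 ≤ sampleConst := by unfold sampleConst; linarith
    have h4 : 2000000000 ≤ sampleConst / (μ ^ 2 * t ^ 2) := by
      rw [le_div_iff₀ (by positivity)]; nlinarith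
    have h5 : 1 ≤ (n : ℝ) ^ 3 * Real.log (n / (μ * t)) :=
      one_le_mul_of_one_le_of_one_le (one_le_pow₀ hn1) hL
    rw [mul_assoc]
    nlinarith
  · gcongr
    unfold sampleConst
    linarith

end DictLearning

/-! ### Assembly of the main theorem -/

theorem corollary2 :
    ∃ C c_a c_b c_c c_d : ℝ, 0 < C ∧ 0 < c_a ∧ 0 < c_b ∧ 0 < c_c ∧ 0 < c_d ∧
      ∀ (n p : ℕ) (θ : unitInterval) (μ : ℝ),
        1 ≤ n → 0 < (θ : ℝ) → (θ : ℝ) < 1 / 2 → 0 < μ →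
        μ < min (c_a * (θ : ℝ) * (n : ℝ)⁻¹) (c_b * (n : ℝ) ^ (-(5 / 4) : ℝ)) →
        C / (μ ^ 2 * (θ : ℝ) ^ 2) * (n : ℝ) ^ 3 * Real.log ((n : ℝ) / (μ * (θ : ℝ))) ≤ (p : ℝ) →
        ∀ (Ω : Type*) [MeasurableSpace Ω] (P : Measure Ω) [IsProbabilityMeasure P]
          (X₀ : Ω → Matrix (Fin n) (Fin p) ℝ),
          DictLearning.IsIIDBernoulliGaussian X₀ θ P →
          ∃ E : Set Ω, MeasurableSet E ∧
            1 - 8 * (n : ℝ) ^ 2 * (p : ℝ) ^ (-10 : ℤ)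
                - (θ : ℝ) * ((n : ℝ) * (p : ℝ)) ^ (-7 : ℤ)
                - Real.exp (-0.3 * (θ : ℝ) * (n : ℝ) * (p : ℝ))
                - c_c * Real.exp (-(c_d * (p : ℝ) * μ ^ 2 * (θ : ℝ) ^ 2 / (n : ℝ) ^ 2))
              ≤ P.real E ∧
            ∀ ω ∈ E,
              (DictLearning.sphereLocalMinimizers μ (X₀ ω)).encard = 2 * n ∧
              ∃ φ : DictLearning.sphereLocalMinimizers μ (X₀ ω) ≃ DictLearning.signedBasis n,
                ∀ q : DictLearning.sphereLocalMinimizers μ (X₀ ω),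
                  ‖(q : EuclideanSpace ℝ (Fin n)) - (φ q : EuclideanSpace ℝ (Fin n))‖ ≤
                    Real.sqrt 2 *
                      min (c_c * μ / (θ : ℝ) *
                        Real.sqrt ((n : ℝ) * Real.log (p : ℝ) / (p : ℝ))) (μ / 16) := by
  open DictLearning in
  have hd := devConst_pos
  -- 1/128 yields `Admissible`. The constant 4608 is dictated by the distance bound and exceeds the
  -- 6 needed in front of the tail.
  refine ⟨sampleConst, 1 / 128, 1, 4608, devConst ^ 2 / 36864,
    by unfold sampleConst; linarith [log_devConst_nonneg], by norm_num, by norm_num, by norm_num,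
    by positivity, ?_⟩
  intro n p θ μ hn hθ hθ1 hμ hμlt hp Ω _ P _ X₀ hX
  have ha := admissible_of_lt hn hθ hθ1 hμ (hμlt.trans_le (min_le_left _ _))
  have hn' : (0 : ℝ) < n := by exact_mod_cast hn
  obtain ⟨hp1, hp2⟩ := sampleConst_le hn hθ hθ1.le hμ ha.mu_lt hp
  have hp0 : (0 : ℝ) < p := by linarith
  have hlog : 0 ≤ Real.log p := Real.log_nonneg (by linarith)
  -- 20480 = 10 · 2048, so that the Bernstein tail exp(-pτ²/2048) equals p^(-10).
  set τ := Real.sqrt (20480 * Real.log p / p) with hτ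
  have hτ0 : 0 ≤ τ := Real.sqrt_nonneg _
  have hτ1 : τ ≤ 1 := Real.sqrt_le_one.2 (log_div_self_le hp1)
  have hε0 : 0 < devConst * μ * θ / n * μ := by positivity
  have hN := Nat.le_ceil (6144 * (n : ℝ) / (devConst * μ * θ / n * μ))
  have hN' := Nat.ceil_lt_add_one (a := 6144 * (n : ℝ) / (devConst * μ * θ / n * μ)) (by positivity)
  rw [div_le_iff₀' hε0] at hN
  have hbad := measure_not_isRegular_le hX ha hn (by exact_mod_cast hp0) hτ0 hτ1 hN
  have hcov := covering_mul_exp_le hd devConst_le_one hn hθ hθ1.le hμ ha.mu_lt hN'.le hp2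
  have hbasis : Real.exp (-(p * τ ^ 2 / 2048)) = (p : ℝ) ^ (-10 : ℤ) := by
    rw [hτ, Real.sq_sqrt (by positivity), ← Real.exp_log (zpow_pos hp0 (-10)), Real.log_zpow]
    congr 1
    push_cast
    field_simp
    ring
  -- The set of irregular samples is replaced by a measurable superset of the same measure; its
  -- complement still consists of regular samples.
  refine ⟨(toMeasurable P {ω | ¬ IsRegular θ μ τ (X₀ ω)})ᶜ, (measurableSet_toMeasurable _ _).compl,
    ?_, fun ω hω => ?_⟩
  · rw [measureReal_compl (measurableSet_toMeasurable _ _), probReal_univ,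
      measureReal_def P (toMeasurable _ _), measure_toMeasurable, ← measureReal_def]
    rw [hbasis] at hbad
    -- The failure probability is at most 2n²p^(-10) plus 6 times the exponential tail, so for the
    -- other terms nonnegativity is enough.
    have h1 : 0 ≤ (θ : ℝ) * ((n : ℝ) * (p : ℝ)) ^ (-7 : ℤ) := by positivity
    have h2 := (Real.exp_pos (-0.3 * (θ : ℝ) * (n : ℝ) * (p : ℝ))).le
    have h3 := (Real.exp_pos (-(devConst ^ 2 / 36864 * p * μ ^ 2 * (θ : ℝ) ^ 2 / n ^ 2))).le
    have h4 : 0 ≤ (n : ℝ) ^ 2 * (p : ℝ) ^ (-10 : ℤ) := by positivity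
    linarith
  · have hY : IsRegular θ μ τ (X₀ ω) := by
      by_contra h
      exact hω (subset_toMeasurable P _ h)
    obtain ⟨h1, φ, hφ⟩ := hY.exists_equiv ha hn hτ0
    refine ⟨h1, φ, fun q => (hφ q).trans ?_⟩
    exact mul_le_mul_of_nonneg_left (min_le_min_right _ (deviation_scale_le hn'.le hθ hμ))
      (Real.sqrt_nonneg _)
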